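/- Let $1\le p<\infty$, $p\ne 2$, and let $H^p$ be the Hardy space of the open unit disc $D$, with norm $\|f\|^p=\sup_{0<r<1}\int_{\mathbb T}|f(r\zeta)|^p\,dm(\zeta)$ ($m$ normalized Lebesgue measure on the unit circle $\mathbb T$). Let $\mathbb A$ be the group of holomorphic automorphisms $\phi(z)=\lambda\frac{z-a}{1-\bar a z}$ of $D$ ($|\lambda|=1$, $|a|<1$), with identity $e$ and compositional inverse written $\phi_{-1}$. For $\phi\in\mathbb A$ put $U_\phi f=(\bar\lambda\phi')^{1/p}\, f\circ\phi$ (principal branch), and let $M_F$ denote multiplication by $F\in H^\infty$. An automorphism $\phi\neq e$ is elliptic if it has a fixed point in $D$. Bounded operators $A,B$ on $H^p$ are isometrically equivalent, $B\approx A$, if $B=VAV^{-1}$ for some linear isometry $V$ of $H^p$ onto $H^p$. For all $\phi,\eta\in\mathbb A$ there is a unimodular constant $\rho(\phi,\eta)$ (depending only on $\phi,\eta$ and $p$) with $$U_\eta U_\phi U_{\eta_{-1}}=\rho(\phi,\eta)\,U_{\eta_{-1}\circ\phi\circ\eta}.$$ Let $d\ge 1$, let $\Psi$ be a $d$-fold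 Blaschke product (a unimodular constant times a product of $d$ factors $\frac{z-a_i}{1-\bar a_i z}$, $|a_i|<1$), let $\phi\in\mathbb A$, and let $S=M_\Psi U_\phi$ (an isometry of $H^p$ of codimension $d$). Then: (i) for a bounded linear operator $\widetilde S$ on $H^p$, $\widetilde S\approx S$ if and only if there is $\eta\in\mathbb A$ with $\widetilde S=\rho(\phi,\eta)\,M_{\Psi\circ\eta}\,U_{\eta_{-1}\circ\phi\circ\eta}$; (ii) $\bigcap_n S^nH^p=\{0\}$ if and only if $\phi$ is elliptic or $\phi=e$. -/

import Mathlib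

open Complex Metric Set Real MeasureTheory
open scoped ComplexConjugate

noncomputable section

/-- A holomorphic automorphism `z ↦ lam * (z - a) / (1 - conj a * z)` of the open unit disc, with
`|lam| = 1` and `|a| < 1`. -/
@[ext]
structure DiscAut where
  lam : ℂ
  a : ℂ
  norm_lam : ‖lam‖ = 1
  norm_a : ‖a‖ < 1

namespace DiscAut

/-- The underlying function; only its values on the open unit disc matter. -/
def toFun (φ : DiscAut) (z : ℂ) : ℂ := φ.lam * (z - φ.a) / (1 - conj φ.a * z)

instance : CoeFun DiscAut (fun _ => ℂ → ℂ) := ⟨toFun⟩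

theorem apply_def (φ : DiscAut) (z : ℂ) : φ z = φ.lam * (z - φ.a) / (1 - conj φ.a * z) := rfl

theorem lam_mul_conj (φ : DiscAut) : φ.lam * conj φ.lam = 1 := by
  rw [Complex.mul_conj, Complex.normSq_eq_norm_sq, φ.norm_lam]; simp

theorem one_sub_ne_zero {a z : ℂ} (ha : ‖a‖ < 1) (hz : ‖z‖ < 1) : 1 - conj a * z ≠ 0 := by
  intro h
  have h1 : conj a * z = 1 := (sub_eq_zero.mp h).symm
  have h2 : ‖a‖ * ‖z‖ = 1 := by
    have := congrArg norm h1
    simpa using this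
  nlinarith [norm_nonneg a, norm_nonneg z]

theorem norm_apply_lt (φ : DiscAut) {z : ℂ} (hz : ‖z‖ < 1) : ‖φ z‖ < 1 := by
  have h0 := one_sub_ne_zero φ.norm_a hz
  have ha := φ.norm_a
  rw [apply_def, norm_div, norm_mul, φ.norm_lam, one_mul, div_lt_one (norm_pos_iff.mpr h0)]
  refine lt_of_pow_lt_pow_left₀ 2 (norm_nonneg _) ?_
  have e : ‖1 - conj φ.a * z‖ ^ 2 - ‖z - φ.a‖ ^ 2 = (1 - ‖φ.a‖ ^ 2) * (1 - ‖z‖ ^ 2) := by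
    simp only [← Complex.normSq_eq_norm_sq, Complex.normSq_apply, Complex.sub_re, Complex.sub_im,
      Complex.mul_re, Complex.mul_im, Complex.conj_re, Complex.conj_im, Complex.one_re,
      Complex.one_im]
    ring
  have h1 : 0 < 1 - ‖φ.a‖ ^ 2 := by nlinarith [norm_nonneg φ.a]
  have h2 : 0 < 1 - ‖z‖ ^ 2 := by nlinarith [norm_nonneg z]
  nlinarith [mul_pos h1 h2]

/-- The identity `e(z) = z`. -/
protected def id : DiscAut := ⟨1, 0, by simp, by simp⟩

/-- The compositional inverse. -/
protected def inv (φ : DiscAut) : DiscAut where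
  lam := conj φ.lam
  a := -(φ.lam * φ.a)
  norm_lam := by simpa using φ.norm_lam
  norm_a := by simpa [φ.norm_lam] using φ.norm_a

/-- The composition `ψ ∘ φ`. -/
protected def comp (ψ φ : DiscAut) : DiscAut where
  lam := ψ.lam * φ.lam * ((1 + conj φ.lam * conj φ.a * ψ.a) / (1 + φ.lam * φ.a * conj ψ.a))
  a := φ.inv ψ.a
  norm_lam := by
    have h : 1 + φ.lam * φ.a * conj ψ.a = conj (1 + conj φ.lam * conj φ.a * ψ.a) := by simp
    have h0 : 1 + conj φ.lam * conj φ.a * ψ.a ≠ 0 := by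
      have := one_sub_ne_zero φ.inv.norm_a ψ.norm_a
      simpa [DiscAut.inv] using this
    rw [norm_mul, norm_mul, norm_div, h, Complex.norm_conj, ψ.norm_lam, φ.norm_lam,
      div_self (norm_ne_zero_iff.mpr h0)]
    norm_num
  norm_a := φ.inv.norm_apply_lt ψ.norm_a

theorem id_apply (z : ℂ) : DiscAut.id z = z := by simp [apply_def, DiscAut.id]

theorem inv_apply_apply (φ : DiscAut) {z : ℂ} (hz : ‖z‖ < 1) : φ.inv (φ z) = z := by
  have h0 := one_sub_ne_zero φ.norm_a hz
  have hl := φ.lam_mul_conj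
  have h2 := one_sub_ne_zero φ.inv.norm_a (φ.norm_apply_lt hz)
  have hw : φ z * (1 - conj φ.a * z) = φ.lam * (z - φ.a) := div_mul_cancel₀ _ h0
  rw [apply_def φ.inv, div_eq_iff h2]
  refine mul_right_cancel₀ h0 ?_
  simp only [DiscAut.inv, map_neg, map_mul]
  linear_combination (conj φ.lam - z * conj φ.lam * conj φ.a) * hw +
    ((z - φ.a) + φ.a * (1 - conj φ.a * z) - z * conj φ.a * (z - φ.a)) * hl

theorem comp_apply (ψ φ : DiscAut) {z : ℂ} (hz : ‖z‖ < 1) : (ψ.comp φ) z = ψ (φ z) := by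
  have h0 := one_sub_ne_zero φ.norm_a hz
  have hl := φ.lam_mul_conj
  have h2 := one_sub_ne_zero ψ.norm_a (φ.norm_apply_lt hz)
  have h3 := one_sub_ne_zero (ψ.comp φ).norm_a hz
  have hN : 1 + conj φ.lam * conj φ.a * ψ.a ≠ 0 := by
    have := one_sub_ne_zero φ.inv.norm_a ψ.norm_a
    simpa [DiscAut.inv] using this
  have hM : 1 + φ.lam * φ.a * conj ψ.a ≠ 0 := by
    have := (map_ne_zero (starRingEnd ℂ)).mpr hN
    simpa using this
  have hw : φ z * (1 - conj φ.a * z) = φ.lam * (z - φ.a) := div_mul_cancel₀ _ h0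
  have ha : (ψ.comp φ).a * (1 + conj φ.lam * conj φ.a * ψ.a) =
      conj φ.lam * (ψ.a + φ.lam * φ.a) := by
    have : (ψ.comp φ).a = conj φ.lam * (ψ.a + φ.lam * φ.a) /
        (1 + conj φ.lam * conj φ.a * ψ.a) := by
      simp [DiscAut.comp, apply_def, DiscAut.inv]
    rw [this, div_mul_cancel₀ _ hN]
  have hb : conj (ψ.comp φ).a * (1 + φ.lam * φ.a * conj ψ.a) =
      φ.lam * (conj ψ.a + conj φ.lam * conj φ.a) := by
    simpa using congrArg conj ha
  have hc : (ψ.comp φ).lam * (1 + φ.lam * φ.a * conj ψ.a) =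
      ψ.lam * φ.lam * (1 + conj φ.lam * conj φ.a * ψ.a) := by
    simp only [DiscAut.comp]
    field_simp
  rw [apply_def, apply_def ψ, div_eq_div_iff h3 h2]
  generalize (ψ.comp φ).lam = L at *
  generalize conj (ψ.comp φ).a = B at *
  generalize (ψ.comp φ).a = A at *
  generalize φ z = w at *
  refine mul_right_cancel₀ (mul_ne_zero h0 hM) ?_
  have e1 : L * (z - A) * (1 + φ.lam * φ.a * conj ψ.a) =
      ψ.lam * (φ.lam * (z - φ.a) - ψ.a * (1 - conj φ.a * z)) := by
    linear_combination (z - A) * hc - ψ.lam * φ.lam * ha +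
      ψ.lam * (ψ.a * conj φ.a * z - ψ.a - φ.lam * φ.a) * hl
  have e2 : (1 - B * z) * (1 + φ.lam * φ.a * conj ψ.a) =
      (1 - conj φ.a * z) - conj ψ.a * (φ.lam * (z - φ.a)) := by
    linear_combination (-z) * hb - conj φ.a * z * hl
  calc _ = (L * (z - A) * (1 + φ.lam * φ.a * conj ψ.a)) *
        ((1 - conj φ.a * z) - conj ψ.a * (w * (1 - conj φ.a * z))) := by ring
    _ = (ψ.lam * (w * (1 - conj φ.a * z) - ψ.a * (1 - conj φ.a * z))) *
        ((1 - B * z) * (1 + φ.lam * φ.a * conj ψ.a)) := by rw [e1, e2, hw]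
    _ = _ := by ring

/-- Elliptic automorphisms: those other than the identity with a fixed point in the open disc. -/
def IsElliptic (φ : DiscAut) : Prop := φ ≠ DiscAut.id ∧ ∃ z : ℂ, ‖z‖ < 1 ∧ φ z = z

theorem differentiableOn (φ : DiscAut) : DifferentiableOn ℂ φ (ball 0 1) := by
  intro z hz
  have h0 := one_sub_ne_zero φ.norm_a (mem_ball_zero_iff.mp hz)
  have : DifferentiableAt ℂ (fun z => φ.lam * (z - φ.a) / (1 - conj φ.a * z)) z :=
    DifferentiableAt.div (by fun_prop) (by fun_prop) h0
  exact this.differentiableWithinAt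

theorem mapsTo (φ : DiscAut) : MapsTo φ (ball 0 1) (ball 0 1) := fun z hz => by
  rw [mem_ball_zero_iff] at hz ⊢
  exact φ.norm_apply_lt hz

/-- `conj lam * φ'` in closed form. -/
theorem conj_lam_mul_deriv (φ : DiscAut) {z : ℂ} (hz : ‖z‖ < 1) :
    conj φ.lam * deriv φ z = ((1 - ‖φ.a‖ ^ 2 : ℝ) : ℂ) * ((1 - conj φ.a * z)⁻¹) ^ 2 := by
  have h0 := one_sub_ne_zero φ.norm_a hz
  have hd : HasDerivAt φ ((φ.lam * 1 * (1 - conj φ.a * z) -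
      φ.lam * (z - φ.a) * (-(conj φ.a * 1))) / (1 - conj φ.a * z) ^ 2) z := by
    refine HasDerivAt.div (((hasDerivAt_id z).sub_const _).const_mul _) ?_ h0
    exact ((hasDerivAt_id z).const_mul _).const_sub _
  have e : ((‖φ.a‖ ^ 2 : ℝ) : ℂ) = φ.a * conj φ.a := by
    rw [Complex.mul_conj, Complex.normSq_eq_norm_sq]
  rw [hd.deriv, Complex.ofReal_sub, e]
  field_simp
  push_cast
  linear_combination (1 - φ.a * conj φ.a) * φ.lam_mul_conj

end DiscAut

/-- Bounded holomorphic functions on the open unit disc; only the values on the disc matter. -/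
structure HInf where
  toFun : ℂ → ℂ
  differentiableOn : DifferentiableOn ℂ toFun (ball 0 1)
  bounded : ∃ C : ℝ, ∀ z ∈ ball (0 : ℂ) 1, ‖toFun z‖ ≤ C

namespace HInf

/-- `F ∘ η` for a disc automorphism `η`. -/
def comp (F : HInf) (η : DiscAut) : HInf where
  toFun z := F.toFun (η z)
  differentiableOn := F.differentiableOn.comp η.differentiableOn η.mapsTo
  bounded := by
    obtain ⟨C, hC⟩ := F.bounded
    exact ⟨C, fun z hz => hC _ (η.mapsTo hz)⟩

/-- `F` is a `d`-fold Blaschke product: a unimodular constant times a product of `d` factors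
`(z - a i) / (1 - conj (a i) * z)` with `|a i| < 1` (repetitions allowed). -/
def IsBlaschke (d : ℕ) (F : HInf) : Prop :=
  ∃ (c : ℂ) (a : Fin d → ℂ), ‖c‖ = 1 ∧ (∀ i, ‖a i‖ < 1) ∧
    ∀ z ∈ ball (0 : ℂ) 1, F.toFun z = c * ∏ i, (z - a i) / (1 - conj (a i) * z)

end HInf

theorem mem_slitPlane_weight (φ : DiscAut) {z : ℂ} (hz : ‖z‖ < 1) :
    conj φ.lam * deriv φ z ∈ slitPlane := by
  rw [φ.conj_lam_mul_deriv hz]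
  have ha := φ.norm_a
  have hpos : 0 < 1 - ‖φ.a‖ ^ 2 := by nlinarith [norm_nonneg φ.a]
  have hre : 0 < (1 - conj φ.a * z).re := by
    have h1 : (conj φ.a * z).re ≤ ‖conj φ.a * z‖ := Complex.re_le_norm _
    have h2 : ‖conj φ.a * z‖ = ‖φ.a‖ * ‖z‖ := by simp
    have h3 : ‖φ.a‖ * ‖z‖ < 1 := by nlinarith [norm_nonneg φ.a, norm_nonneg z]
    rw [Complex.sub_re, Complex.one_re]; linarith
  have hinv : 0 < ((1 - conj φ.a * z)⁻¹).re := by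
    rw [Complex.inv_re]
    exact div_pos hre (Complex.normSq_pos.mpr (DiscAut.one_sub_ne_zero ha hz))
  set w := (1 - conj φ.a * z)⁻¹
  rw [Complex.mem_slitPlane_iff, Complex.re_ofReal_mul, Complex.im_ofReal_mul, sq w,
    Complex.mul_re, Complex.mul_im]
  by_cases him : w.im = 0
  · left; rw [him]; have := mul_pos hinv hinv; simp only [mul_zero, sub_zero]; positivity
  · right
    have : w.re * w.im + w.im * w.re = 2 * (w.re * w.im) := by ring
    rw [this]
    exact mul_ne_zero hpos.ne' (mul_ne_zero two_ne_zero (mul_ne_zero hinv.ne' him))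

/-- The weight `(conj lam * φ') ^ (1/p)`, with the principal branch of the power. -/
def weight (p : ℝ) [Fact (1 ≤ p)] (φ : DiscAut) : HInf where
  toFun z := (conj φ.lam * deriv φ z) ^ (((1 / p : ℝ)) : ℂ)
  differentiableOn := by
    refine DifferentiableOn.cpow_const ?_ (fun z hz =>
      mem_slitPlane_weight φ (mem_ball_zero_iff.mp hz))
    exact (φ.differentiableOn.deriv isOpen_ball).const_mul _
  bounded := by
    have hp : (1 : ℝ) ≤ p := Fact.out
    have ha := φ.norm_a
    refine ⟨((1 - ‖φ.a‖ ^ 2) * ((1 - ‖φ.a‖)⁻¹) ^ 2) ^ (1 / p), fun z hz => ?_⟩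
    have hz' := mem_ball_zero_iff.mp hz
    have hpos : 0 < 1 - ‖φ.a‖ ^ 2 := by nlinarith [norm_nonneg φ.a]
    rw [Complex.norm_cpow_real, φ.conj_lam_mul_deriv hz', norm_mul, norm_pow, norm_inv,
      Complex.norm_real, Real.norm_of_nonneg hpos.le]
    have h1 : 1 - ‖φ.a‖ ≤ ‖1 - conj φ.a * z‖ := by
      have h2 : ‖conj φ.a * z‖ = ‖φ.a‖ * ‖z‖ := by simp
      have h3 := norm_sub_norm_le (1 : ℂ) (conj φ.a * z)
      rw [norm_one, h2] at h3
      nlinarith [norm_nonneg φ.a, norm_nonneg z]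
    have h4 : 0 < 1 - ‖φ.a‖ := by linarith
    gcongr

/-- The integral mean `∫_T |f(r ζ)|^p dm(ζ)`, `m` being normalized Lebesgue measure. -/
def pMean (p : ℝ) (f : ℂ → ℂ) (r : ℝ) : ℝ := circleAverage (fun z => ‖f z‖ ^ p) 0 r

/-- Membership in the Hardy space. A function on the open unit disc is represented by its
extension by zero to `ℂ`. -/
structure MemHp (p : ℝ) (f : ℂ → ℂ) : Prop where
  differentiableOn : DifferentiableOn ℂ f (ball 0 1)
  eq_zero : ∀ z, z ∉ ball (0 : ℂ) 1 → f z = 0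
  bdd : BddAbove (range fun r : Ioo (0 : ℝ) 1 => pMean p f r)

/-- `(sup_{0<r<1} ∫_T |f(r ζ)|^p dm(ζ))^(1/p)`. -/
def hpNorm (p : ℝ) (f : ℂ → ℂ) : ℝ := (⨆ r : Ioo (0 : ℝ) 1, pMean p f r) ^ (1 / p)

section aux

variable {p : ℝ}

theorem mem_ball_of_mem_sphere {r : ℝ} (hr : r ∈ Ioo (0 : ℝ) 1) {z : ℂ}
    (hz : z ∈ sphere (0 : ℂ) |r|) : z ∈ ball (0 : ℂ) 1 := by
  rw [mem_sphere_zero_iff_norm, abs_of_pos hr.1] at hz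
  rw [mem_ball_zero_iff, hz]; exact hr.2

theorem continuousOn_norm_rpow {f : ℂ → ℂ} {s : Set ℂ} (hp : 1 ≤ p) (hf : ContinuousOn f s) :
    ContinuousOn (fun z => ‖f z‖ ^ p) s :=
  hf.norm.rpow_const fun _ _ => Or.inr (by linarith)

theorem continuousOn_sphere {f : ℂ → ℂ} (hf : DifferentiableOn ℂ f (ball 0 1)) {r : ℝ}
    (hr : r ∈ Ioo (0 : ℝ) 1) : ContinuousOn f (sphere 0 |r|) :=
  hf.continuousOn.mono fun _ hz => mem_ball_of_mem_sphere hr hz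

theorem circleIntegrable_pow {f : ℂ → ℂ} (hp : 1 ≤ p) (hf : DifferentiableOn ℂ f (ball 0 1))
    {r : ℝ} (hr : r ∈ Ioo (0 : ℝ) 1) : CircleIntegrable (fun z => ‖f z‖ ^ p) 0 r :=
  (continuousOn_norm_rpow hp (continuousOn_sphere hf hr)).circleIntegrable'

theorem pMean_nonneg (f : ℂ → ℂ) (r : ℝ) : 0 ≤ pMean p f r :=
  circleAverage_nonneg_of_nonneg fun _ _ => by positivity

theorem pMean_smul (c : ℂ) (f : ℂ → ℂ) (r : ℝ) :
    pMean p (c • f) r = ‖c‖ ^ p * pMean p f r := by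
  have : (fun z => ‖(c • f) z‖ ^ p) = fun z => (‖c‖ ^ p) • (‖f z‖ ^ p) := by
    funext z
    rw [Pi.smul_apply, norm_smul, Real.mul_rpow (norm_nonneg _) (norm_nonneg _), smul_eq_mul]
  rw [pMean, this, circleAverage_fun_smul, smul_eq_mul, pMean]

theorem pMean_root (hp : 1 ≤ p) {f : ℂ → ℂ} (hf : DifferentiableOn ℂ f (ball 0 1)) {r : ℝ}
    (hr : r ∈ Ioo (0 : ℝ) 1) : (pMean p f r) ^ (1 / p) = ((2 * π)⁻¹) ^ (1 / p) *
      (eLpNorm (fun θ => f (circleMap 0 r θ)) (ENNReal.ofReal p)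
        (volume.restrict (Ioc 0 (2 * π)))).toReal ∧
      MemLp (fun θ => f (circleMap 0 r θ)) (ENNReal.ofReal p)
        (volume.restrict (Ioc 0 (2 * π))) := by
  have hp0 : 0 < p := by linarith
  have hcont : Continuous (fun θ => f (circleMap 0 r θ)) :=
    (continuousOn_sphere hf hr).comp_continuous (continuous_circleMap 0 r)
      fun θ => circleMap_mem_sphere' 0 r θ
  have hne : ENNReal.ofReal p ≠ 0 := by simpa using hp0
  have hmem : MemLp (fun θ => f (circleMap 0 r θ)) (ENNReal.ofReal p)
      (volume.restrict (Ioc 0 (2 * π))) := by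
    obtain ⟨C, hC⟩ := isCompact_Icc.exists_bound_of_continuousOn
      (s := Icc 0 (2 * π)) hcont.continuousOn
    refine MemLp.of_bound hcont.aestronglyMeasurable C ?_
    filter_upwards [ae_restrict_mem measurableSet_Ioc] with θ hθ
    exact hC θ (Ioc_subset_Icc_self hθ)
  refine ⟨?_, hmem⟩
  rw [hmem.eLpNorm_eq_integral_rpow_norm hne ENNReal.ofReal_ne_top,
    ENNReal.toReal_ofReal (by positivity), ENNReal.toReal_ofReal hp0.le, pMean,
    circleAverage_def, smul_eq_mul, Real.mul_rpow (by positivity)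
      (intervalIntegral.integral_nonneg (by positivity) fun _ _ => by positivity),
    intervalIntegral.integral_of_le (by positivity), one_div]

theorem pMean_add (hp : 1 ≤ p) {f g : ℂ → ℂ} (hf : DifferentiableOn ℂ f (ball 0 1))
    (hg : DifferentiableOn ℂ g (ball 0 1)) {r : ℝ} (hr : r ∈ Ioo (0 : ℝ) 1) :
    (pMean p (f + g) r) ^ (1 / p) ≤ (pMean p f r) ^ (1 / p) + (pMean p g r) ^ (1 / p) := by
  obtain ⟨e1, m1⟩ := pMean_root hp hf hr
  obtain ⟨e2, m2⟩ := pMean_root hp hg hr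
  rw [(pMean_root hp (hf.add hg) hr).1, e1, e2, ← mul_add]
  refine mul_le_mul_of_nonneg_left ?_ (by positivity)
  rw [← ENNReal.toReal_add m1.eLpNorm_ne_top m2.eLpNorm_ne_top]
  refine ENNReal.toReal_mono (ENNReal.add_ne_top.mpr ⟨m1.eLpNorm_ne_top, m2.eLpNorm_ne_top⟩) ?_
  exact eLpNorm_add_le m1.aestronglyMeasurable m2.aestronglyMeasurable
    (by simpa using ENNReal.ofReal_le_ofReal hp)

theorem hpNorm_nonneg (f : ℂ → ℂ) : 0 ≤ hpNorm p f :=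
  Real.rpow_nonneg (Real.iSup_nonneg fun _ => pMean_nonneg _ _) _

theorem pMean_root_le (hp : 1 ≤ p) {f : ℂ → ℂ} (hf : MemHp p f) {r : ℝ}
    (hr : r ∈ Ioo (0 : ℝ) 1) : (pMean p f r) ^ (1 / p) ≤ hpNorm p f :=
  Real.rpow_le_rpow (pMean_nonneg _ _) (le_ciSup hf.bdd ⟨r, hr⟩)
    (one_div_nonneg.mpr (zero_le_one.trans hp))

theorem pMean_le_of_root_le (hp : 1 ≤ p) {f : ℂ → ℂ} {r C : ℝ}
    (h : (pMean p f r) ^ (1 / p) ≤ C) : pMean p f r ≤ C ^ p := by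
  have hp0 : p ≠ 0 := by linarith
  have := Real.rpow_le_rpow (Real.rpow_nonneg (pMean_nonneg f r) _) h (by linarith : 0 ≤ p)
  rwa [← Real.rpow_mul (pMean_nonneg _ _), one_div_mul_cancel hp0, Real.rpow_one] at this

instance : Nonempty (Ioo (0 : ℝ) 1) := ⟨⟨1 / 2, by norm_num, by norm_num⟩⟩

theorem hpNorm_le (hp : 1 ≤ p) {f : ℂ → ℂ} {C : ℝ} (hC : 0 ≤ C)
    (h : ∀ r ∈ Ioo (0 : ℝ) 1, (pMean p f r) ^ (1 / p) ≤ C) : hpNorm p f ≤ C := by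
  have hp0 : p ≠ 0 := by linarith
  have h1 : (⨆ r : Ioo (0 : ℝ) 1, pMean p f r) ≤ C ^ p :=
    ciSup_le fun r => pMean_le_of_root_le hp (h r r.2)
  have := Real.rpow_le_rpow (Real.iSup_nonneg fun _ => pMean_nonneg _ _) h1
    (by positivity : 0 ≤ 1 / p)
  rwa [← Real.rpow_mul hC, mul_one_div_cancel hp0, Real.rpow_one] at this

theorem MemHp.of_root_le (hp : 1 ≤ p) {f : ℂ → ℂ} (hd : DifferentiableOn ℂ f (ball 0 1))
    (h0 : ∀ z, z ∉ ball (0 : ℂ) 1 → f z = 0) (C : ℝ)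
    (h : ∀ r ∈ Ioo (0 : ℝ) 1, (pMean p f r) ^ (1 / p) ≤ C) : MemHp p f := by
  refine ⟨hd, h0, C ^ p, ?_⟩
  rintro _ ⟨r, rfl⟩
  exact pMean_le_of_root_le hp (h r r.2)

theorem pMean_smul_root (hp : 1 ≤ p) (c : ℂ) (f : ℂ → ℂ) (r : ℝ) :
    (pMean p (c • f) r) ^ (1 / p) = ‖c‖ * (pMean p f r) ^ (1 / p) := by
  have hp0 : p ≠ 0 := by linarith
  rw [pMean_smul, Real.mul_rpow (by positivity) (pMean_nonneg _ _),
    ← Real.rpow_mul (norm_nonneg _), mul_one_div_cancel hp0, Real.rpow_one]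

theorem MemHp.add (hp : 1 ≤ p) {f g : ℂ → ℂ} (hf : MemHp p f) (hg : MemHp p g) :
    MemHp p (f + g) := by
  refine MemHp.of_root_le hp (hf.1.add hg.1)
    (fun z hz => by simp [hf.2 z hz, hg.2 z hz]) (hpNorm p f + hpNorm p g) fun r hr => ?_
  exact (pMean_add hp hf.1 hg.1 hr).trans
    (add_le_add (pMean_root_le hp hf hr) (pMean_root_le hp hg hr))

theorem MemHp.smul (hp : 1 ≤ p) (c : ℂ) {f : ℂ → ℂ} (hf : MemHp p f) : MemHp p (c • f) := by
  refine MemHp.of_root_le hp (hf.1.const_smul c) (fun z hz => by simp [hf.2 z hz])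
    (‖c‖ * hpNorm p f) fun r hr => ?_
  rw [pMean_smul_root hp]
  exact mul_le_mul_of_nonneg_left (pMean_root_le hp hf hr) (norm_nonneg _)

theorem MemHp.zero (hp : 1 ≤ p) : MemHp p (0 : ℂ → ℂ) := by
  refine MemHp.of_root_le hp (differentiableOn_const 0) (fun _ _ => rfl) 0 fun r _ => ?_
  have := pMean_smul_root hp 0 (0 : ℂ → ℂ) r
  simp only [zero_smul, norm_zero, zero_mul] at this
  exact this.le

theorem hpNorm_add (hp : 1 ≤ p) {f g : ℂ → ℂ} (hf : MemHp p f) (hg : MemHp p g) :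
    hpNorm p (f + g) ≤ hpNorm p f + hpNorm p g :=
  hpNorm_le hp (add_nonneg (hpNorm_nonneg _) (hpNorm_nonneg _)) fun _ hr =>
    (pMean_add hp hf.1 hg.1 hr).trans
      (add_le_add (pMean_root_le hp hf hr) (pMean_root_le hp hg hr))

theorem hpNorm_smul (hp : 1 ≤ p) (c : ℂ) (f : ℂ → ℂ) :
    hpNorm p (c • f) = ‖c‖ * hpNorm p f := by
  have hp0 : p ≠ 0 := by linarith
  simp_rw [hpNorm, pMean_smul]
  rw [← Real.mul_iSup_of_nonneg (by positivity),
    Real.mul_rpow (by positivity) (Real.iSup_nonneg fun _ => pMean_nonneg _ _),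
    ← Real.rpow_mul (norm_nonneg _), mul_one_div_cancel hp0, Real.rpow_one]

/-- Jensen's inequality against the Poisson kernel. -/
theorem pow_le_poisson (hp : 1 ≤ p) {f : ℂ → ℂ} (hf : DifferentiableOn ℂ f (ball 0 1)) {R : ℝ}
    (hR : R ∈ Ioo (0 : ℝ) 1) {w : ℂ} (hw : w ∈ ball (0 : ℂ) R) :
    ‖f w‖ ^ p ≤ circleAverage (fun z => poissonKernel 0 w z * ‖f z‖ ^ p) 0 R := by
  have hR0 := hR.1
  set s := ‖f w‖ with hs
  set P := poissonKernel 0 w with hP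
  have hsub : closedBall (0 : ℂ) R ⊆ ball 0 1 := closedBall_subset_ball hR.2
  have hPc : ContinuousOn P (sphere 0 |R|) := by
    rw [hP, poissonKernel_eq_re_herglotzRieszKernel]
    exact Complex.continuous_re.comp_continuousOn (continuousOn_herglotzRieszKernel_sphere hw)
  have hfc := continuousOn_sphere hf hR
  have hP0 : ∀ z ∈ sphere (0 : ℂ) |R|, 0 ≤ P z := by
    intro z hz
    rw [abs_of_pos hR0, mem_sphere_zero_iff_norm] at hz
    rw [mem_ball_zero_iff] at hw
    simp only [hP, poissonKernel, sub_zero, hz]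
    have : 0 ≤ R ^ 2 - ‖w‖ ^ 2 := by nlinarith [norm_nonneg w]
    positivity
  have i1 : CircleIntegrable P 0 R := hPc.circleIntegrable'
  have i2 : CircleIntegrable (fun z => P z * ‖f z‖) 0 R := (hPc.mul hfc.norm).circleIntegrable'
  have i3 : CircleIntegrable (fun z => P z * ‖f z‖ ^ p) 0 R :=
    (hPc.mul (continuousOn_norm_rpow hp hfc)).circleIntegrable'
  have hdc : DiffContOnCl ℂ f (ball 0 R) := by
    refine DifferentiableOn.diffContOnCl ?_
    rw [closure_ball _ hR0.ne']
    exact hf.mono hsub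
  have a1 : circleAverage P 0 R = 1 := by
    have h := (diffContOnCl_const (𝕜 := ℂ) (s := ball (0 : ℂ) R) (c := (1 : ℂ)))
    have h2 := h.circleAverage_poissonKernel_smul hw
    have h3 := Complex.ofRealCLM.circleAverage_comp_comm i1
    have e : (Complex.ofRealCLM ∘ P : ℂ → ℂ) = poissonKernel 0 w • fun _ => (1 : ℂ) := by
      funext z; simp [hP]
    rw [e, h2] at h3
    exact (Complex.ofReal_injective (by simpa using h3)).symm
  have a2 : s ≤ circleAverage (fun z => P z * ‖f z‖) 0 R := by
    have h2 := hdc.circleAverage_poissonKernel_smul hw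
    rw [hs, ← h2, circleAverage_def, circleAverage_def, norm_smul, smul_eq_mul,
      Real.norm_of_nonneg (by positivity)]
    refine mul_le_mul_of_nonneg_left ?_ (by positivity)
    refine (intervalIntegral.norm_integral_le_integral_norm (by positivity)).trans_eq ?_
    refine intervalIntegral.integral_congr fun θ _ => ?_
    have := hP0 _ (circleMap_mem_sphere' 0 R θ)
    simp only [Pi.smul_apply', norm_smul]
    rw [Real.norm_of_nonneg this]
  rcases (norm_nonneg (f w)).eq_or_lt' with h0 | h0
  · rw [hs, h0, Real.zero_rpow (by linarith)]
    exact circleAverage_nonneg_of_nonneg fun z hz => mul_nonneg (hP0 z hz) (by positivity)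
  rw [← hs] at h0
  set c := p * s ^ p / s with hc
  have hc0 : 0 ≤ c := by positivity
  have tangent : ∀ x : ℝ, 0 ≤ x → (s ^ p - c * s) + c * x ≤ x ^ p := by
    intro x hx
    have hx' : 0 ≤ x / s := by positivity
    have h := one_add_mul_self_le_rpow_one_add (s := x / s - 1) (by linarith) hp
    rw [add_sub_cancel, Real.div_rpow hx h0.le, le_div_iff₀ (by positivity)] at h
    refine le_trans (le_of_eq ?_) h
    rw [hc]
    field_simp
    ring
  have key : circleAverage (fun z => (s ^ p - c * s) • P z + c • (P z * ‖f z‖)) 0 R ≤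
      circleAverage (fun z => P z * ‖f z‖ ^ p) 0 R := by
    refine circleAverage_mono ((i1.const_smul).add (i2.const_smul)) i3 fun z hz => ?_
    have := mul_le_mul_of_nonneg_left (tangent ‖f z‖ (norm_nonneg _)) (hP0 z hz)
    simp only [smul_eq_mul]
    linarith
  have j1 : CircleIntegrable (fun z => (s ^ p - c * s) • P z) 0 R := i1.const_smul
  have j2 : CircleIntegrable (fun z => c • (P z * ‖f z‖)) 0 R := i2.const_smul
  rw [circleAverage_fun_add j1 j2, circleAverage_fun_smul, circleAverage_fun_smul, a1] at key
  simp only [smul_eq_mul, mul_one] at key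
  nlinarith [mul_le_mul_of_nonneg_left a2 hc0]

theorem poissonKernel_le {R : ℝ} {w z : ℂ} (hz : z ∈ sphere (0 : ℂ) R) (hw : w ∈ ball (0 : ℂ) R) :
    poissonKernel 0 w z ≤ (R + ‖w‖) / (R - ‖w‖) := by
  have := re_herglotzRieszKernel_le hz hw
  rw [poissonKernel_eq_re_herglotzRieszKernel]
  simpa [herglotzRieszKernel_def] using this

theorem circleAverage_poisson_le (hp : 1 ≤ p) {f : ℂ → ℂ} (hf : DifferentiableOn ℂ f (ball 0 1))
    {R : ℝ} (hR : R ∈ Ioo (0 : ℝ) 1) {w : ℂ} (hw : w ∈ ball (0 : ℂ) R) :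
    circleAverage (fun z => poissonKernel 0 w z * ‖f z‖ ^ p) 0 R ≤
      (R + ‖w‖) / (R - ‖w‖) * pMean p f R := by
  have hPc : ContinuousOn (poissonKernel 0 w) (sphere 0 |R|) := by
    rw [poissonKernel_eq_re_herglotzRieszKernel]
    exact Complex.continuous_re.comp_continuousOn (continuousOn_herglotzRieszKernel_sphere hw)
  have hfc := continuousOn_norm_rpow hp (continuousOn_sphere hf hR)
  rw [pMean, ← smul_eq_mul, ← circleAverage_fun_smul]
  refine circleAverage_mono (hPc.mul hfc).circleIntegrable'
    (hfc.circleIntegrable').const_smul fun z hz => ?_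
  rw [abs_of_pos hR.1] at hz
  exact mul_le_mul_of_nonneg_right (poissonKernel_le hz hw) (by positivity)

/-- Composition with a disc automorphism is bounded on the Hardy space. -/
theorem pMean_comp_le (hp : 1 ≤ p) (φ : DiscAut) {f : ℂ → ℂ} (hf : MemHp p f) {r : ℝ}
    (hr : r ∈ Ioo (0 : ℝ) 1) :
    pMean p (fun z => f (φ z)) r ≤ 4 / (1 - ‖φ 0‖) * ⨆ r : Ioo (0 : ℝ) 1, pMean p f r := by
  have hr0 := hr.1
  have hsub : closedBall (0 : ℂ) r ⊆ ball 0 1 := closedBall_subset_ball hr.2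
  obtain ⟨z₀, hz₀, hmax⟩ := (isCompact_closedBall (0 : ℂ) r).exists_isMaxOn
    ⟨0, mem_closedBall_self hr0.le⟩ (φ.differentiableOn.continuousOn.mono hsub).norm
  set q := ‖φ z₀‖ with hq
  have hq1 : q < 1 := φ.norm_apply_lt (mem_ball_zero_iff.mp (hsub hz₀))
  have hq0 : 0 ≤ q := norm_nonneg _
  have hle : ∀ z ∈ closedBall (0 : ℂ) r, ‖φ z‖ ≤ q := fun z hz => hmax hz
  have h00 := hle 0 (mem_closedBall_self hr0.le)
  obtain ⟨R, hRdef⟩ : ∃ R, R = (1 + q) / 2 := ⟨_, rfl⟩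
  have hR : R ∈ Ioo (0 : ℝ) 1 := ⟨by linarith, by linarith⟩
  have hball : ∀ z ∈ closedBall (0 : ℂ) r, φ z ∈ ball (0 : ℂ) R := fun z hz => by
    rw [mem_ball_zero_iff]; linarith [hle z hz]
  set g : ℂ → ℝ := fun z => ‖f z‖ ^ p with hg
  have hgc := continuousOn_norm_rpow hp (continuousOn_sphere hf.1 hR)
  have gi : CircleIntegrable g 0 R := hgc.circleIntegrable'
  have gi' : CircleIntegrable (fun z => ((g z : ℝ) : ℂ)) 0 R :=
    (Complex.continuous_ofReal.comp_continuousOn hgc).circleIntegrable'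
  set G : ℂ → ℂ :=
    fun w => circleAverage (fun ζ => herglotzRieszKernel 0 w ζ • ((g ζ : ℝ) : ℂ)) 0 R with hG
  have hGd : DifferentiableOn ℂ G (ball 0 R) :=
    differentiableOn_circleAverage_herglotzRieszKernel_smul gi'
  have hGre : ∀ w ∈ ball (0 : ℂ) R,
      (G w).re = circleAverage (fun z => poissonKernel 0 w z * ‖f z‖ ^ p) 0 R := fun w hw => by
    rw [hG, poissonKernel_eq_re_herglotzRieszKernel]
    exact re_circleAverage_herglotzRieszKernel_smul gi hw
  have hGφ : DifferentiableOn ℂ (G ∘ φ) (closedBall 0 r) :=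
    hGd.comp (φ.differentiableOn.mono hsub) hball
  have hdc : DiffContOnCl ℂ (G ∘ φ) (ball 0 |r|) := by
    refine DifferentiableOn.diffContOnCl ?_
    rwa [abs_of_pos hr0, closure_ball _ hr0.ne']
  have hss : sphere (0 : ℂ) |r| ⊆ closedBall 0 r := by
    rw [abs_of_pos hr0]; exact sphere_subset_closedBall
  have ci : CircleIntegrable (G ∘ φ) 0 r := (hGφ.continuousOn.mono hss).circleIntegrable'
  have hmean := Complex.reCLM.circleAverage_comp_comm ci
  rw [hdc.circleAverage] at hmean
  have cφ : ContinuousOn (fun z => f (φ z)) (sphere 0 |r|) :=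
    (hf.1.comp φ.differentiableOn φ.mapsTo).continuousOn.mono (hss.trans hsub)
  have step : pMean p (fun z => f (φ z)) r ≤ circleAverage (Complex.reCLM ∘ (G ∘ φ)) 0 r := by
    refine circleAverage_mono (continuousOn_norm_rpow hp cφ).circleIntegrable'
      (Complex.continuous_re.comp_continuousOn (hGφ.continuousOn.mono hss)).circleIntegrable'
      fun z hz => ?_
    have hz' := hball z (hss hz)
    have := pow_le_poisson hp hf.1 hR hz'
    rw [← hGre _ hz'] at this
    exact this
  have h0R := hball 0 (mem_closedBall_self hr0.le)
  have last := circleAverage_poisson_le hp hf.1 hR h0R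
  rw [← hGre _ h0R] at last
  have hsup : pMean p f R ≤ ⨆ r : Ioo (0 : ℝ) 1, pMean p f r := le_ciSup hf.bdd ⟨R, hR⟩
  have hfrac : (R + ‖φ 0‖) / (R - ‖φ 0‖) ≤ 4 / (1 - ‖φ 0‖) := by
    rw [div_le_div_iff₀ (by linarith) (by linarith)]
    nlinarith [norm_nonneg (φ 0)]
  calc pMean p (fun z => f (φ z)) r ≤ (G (φ 0)).re := step.trans_eq hmean
    _ ≤ _ := last
    _ ≤ _ := mul_le_mul hfrac hsup (pMean_nonneg _ _)
      (div_nonneg (by norm_num) (by linarith))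

theorem pMean_mul_root_le (hp : 1 ≤ p) {F f : ℂ → ℂ} (hF : DifferentiableOn ℂ F (ball 0 1))
    {C : ℝ} (hC : 0 ≤ C) (hb : ∀ z ∈ ball (0 : ℂ) 1, ‖F z‖ ≤ C)
    (hf : DifferentiableOn ℂ f (ball 0 1)) {r : ℝ} (hr : r ∈ Ioo (0 : ℝ) 1) :
    (pMean p (fun z => F z * f z) r) ^ (1 / p) ≤ C * (pMean p f r) ^ (1 / p) := by
  have h := pMean_smul_root hp (C : ℂ) f r
  rw [Complex.norm_real, Real.norm_of_nonneg hC] at h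
  rw [← h]
  refine Real.rpow_le_rpow (pMean_nonneg _ _) ?_ (by positivity)
  refine circleAverage_mono (circleIntegrable_pow hp (hF.mul hf) hr)
    (circleIntegrable_pow hp (hf.const_smul _) hr) fun z hz => ?_
  refine Real.rpow_le_rpow (norm_nonneg _) ?_ (by linarith)
  rw [norm_mul, Pi.smul_apply, norm_smul, Complex.norm_real, Real.norm_of_nonneg hC]
  exact mul_le_mul_of_nonneg_right (hb z (mem_ball_of_mem_sphere hr hz)) (norm_nonneg _)

theorem pMean_indicator (f : ℂ → ℂ) {r : ℝ} (hr : r ∈ Ioo (0 : ℝ) 1) :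
    pMean p ((ball (0 : ℂ) 1).indicator f) r = pMean p f r := by
  refine circleAverage_congr_sphere fun z hz => ?_
  simp only [indicator_of_mem (mem_ball_of_mem_sphere hr hz)]

end aux

/-- The Hardy space as a space of functions. -/
def hpSubmodule (p : ℝ) [hp : Fact (1 ≤ p)] : Submodule ℂ (ℂ → ℂ) where
  carrier := {f | MemHp p f}
  add_mem' hf hg := MemHp.add hp.out hf hg
  zero_mem' := MemHp.zero hp.out
  smul_mem' c _ hf := MemHp.smul hp.out c hf

/-- The Hardy space `H^p` of the open unit disc, `1 ≤ p < ∞`. -/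
def Hp (p : ℝ) [Fact (1 ≤ p)] : Type := hpSubmodule p

namespace Hp

variable (p : ℝ) [hp : Fact (1 ≤ p)]

instance : AddCommGroup (Hp p) := inferInstanceAs (AddCommGroup (hpSubmodule p))

instance : Module ℂ (Hp p) := inferInstanceAs (Module ℂ (hpSubmodule p))

instance : CoeFun (Hp p) (fun _ => ℂ → ℂ) := ⟨Subtype.val⟩

instance : Norm (Hp p) := ⟨fun f => hpNorm p f⟩

theorem norm_def (f : Hp p) : ‖f‖ = hpNorm p f := rfl

theorem core : NormedSpace.Core ℂ (Hp p) where
  norm_nonneg f := hpNorm_nonneg _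
  norm_smul c f := hpNorm_smul hp.out c f.1
  norm_triangle f g := hpNorm_add hp.out f.2 g.2
  norm_eq_zero_iff f := by
    have hp0 : (0 : ℝ) < p := by have := hp.out; linarith
    refine ⟨fun h => ?_, fun h => ?_⟩
    · refine Subtype.ext (funext fun z => ?_)
      by_cases hz : z ∈ ball (0 : ℂ) 1
      · obtain ⟨R, h1, h2⟩ := exists_between (mem_ball_zero_iff.mp hz)
        have hR : R ∈ Ioo (0 : ℝ) 1 := ⟨(norm_nonneg z).trans_lt h1, h2⟩
        have hle := pMean_le_of_root_le hp.out (pMean_root_le hp.out f.2 hR)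
        rw [show hpNorm p f.1 = 0 from h, Real.zero_rpow hp0.ne'] at hle
        have h3 := (pow_le_poisson hp.out f.2.1 hR (mem_ball_zero_iff.mpr h1)).trans
          (circleAverage_poisson_le hp.out f.2.1 hR (mem_ball_zero_iff.mpr h1))
        rw [le_antisymm hle (pMean_nonneg _ _), mul_zero] at h3
        have h4 := le_antisymm h3 (by positivity)
        rw [Real.rpow_eq_zero (norm_nonneg _) hp0.ne'] at h4
        exact norm_eq_zero.mp h4
      · exact f.2.2 z hz
    · subst h
      have := hpNorm_smul hp.out 0 (0 : ℂ → ℂ)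
      simp only [zero_smul, norm_zero, zero_mul] at this
      exact this

instance : NormedAddCommGroup (Hp p) := NormedAddCommGroup.ofCore (core p)

instance : NormedSpace ℂ (Hp p) := NormedSpace.ofCore (core p)

variable {p} in
/-- The multiplication operator `M_F : f ↦ F f`. -/
def mulOp (F : HInf) : Hp p →L[ℂ] Hp p :=
  have hb : ∃ C : ℝ, 0 ≤ C ∧ ∀ z ∈ ball (0 : ℂ) 1, ‖F.toFun z‖ ≤ C := by
    obtain ⟨C, hC⟩ := F.bounded
    exact ⟨C, (norm_nonneg _).trans (hC 0 (mem_ball_self one_pos)), hC⟩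
  LinearMap.mkContinuousOfExistsBound
    { toFun := fun f => ⟨fun z => F.toFun z * f z, by
        obtain ⟨C, hC0, hC⟩ := hb
        exact MemHp.of_root_le hp.out (F.differentiableOn.mul f.2.1)
          (fun z hz => by rw [f.2.2 z hz, mul_zero]) (C * hpNorm p f) fun r hr =>
          (pMean_mul_root_le hp.out F.differentiableOn hC0 hC f.2.1 hr).trans
            (mul_le_mul_of_nonneg_left (pMean_root_le hp.out f.2 hr) hC0)⟩
      map_add' := fun f g => Subtype.ext (funext fun z => mul_add _ (f z) (g z))
      map_smul' := fun c f => Subtype.ext (funext fun z => mul_left_comm _ c (f z)) }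
    (by
      obtain ⟨C, hC0, hC⟩ := hb
      exact ⟨C, fun f => hpNorm_le hp.out (mul_nonneg hC0 (hpNorm_nonneg _)) fun r hr =>
        (pMean_mul_root_le hp.out F.differentiableOn hC0 hC f.2.1 hr).trans
          (mul_le_mul_of_nonneg_left (pMean_root_le hp.out f.2 hr) hC0)⟩)

variable {p} in
theorem mulOp_apply (F : HInf) (f : Hp p) (z : ℂ) : mulOp F f z = F.toFun z * f z := rfl

variable {p} in
theorem comp_root_le (φ : DiscAut) (f : Hp p) {r : ℝ} (hr : r ∈ Ioo (0 : ℝ) 1) :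
    (pMean p ((ball (0 : ℂ) 1).indicator fun z => f (φ z)) r) ^ (1 / p) ≤
      (4 / (1 - ‖φ 0‖)) ^ (1 / p) * hpNorm p f := by
  have hp1 := hp.out
  have h0 : ‖φ 0‖ < 1 := φ.norm_apply_lt (by simp)
  rw [pMean_indicator _ hr, hpNorm, ← Real.mul_rpow (div_nonneg (by norm_num) (by linarith))
    (Real.iSup_nonneg fun _ => pMean_nonneg _ _)]
  exact Real.rpow_le_rpow (pMean_nonneg _ _) (pMean_comp_le hp1 φ f.2 hr) (by positivity)

variable {p} in
/-- The composition operator `C_φ : f ↦ f ∘ φ` (again extended by zero off the disc). -/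
def compOp (φ : DiscAut) : Hp p →L[ℂ] Hp p :=
  LinearMap.mkContinuous
    { toFun := fun f => ⟨(ball (0 : ℂ) 1).indicator fun z => f (φ z),
        MemHp.of_root_le hp.out
          ((f.2.1.comp φ.differentiableOn φ.mapsTo).congr fun _ hz => indicator_of_mem hz _)
          (fun _ hz => indicator_of_notMem hz _) _ fun _ hr => comp_root_le φ f hr⟩
      map_add' := fun _ _ => Subtype.ext (indicator_add _ _ _)
      map_smul' := fun c _ => Subtype.ext (indicator_const_smul _ c _) }
    ((4 / (1 - ‖φ 0‖)) ^ (1 / p)) fun f => by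
      have h0 : ‖φ 0‖ < 1 := φ.norm_apply_lt (by simp)
      exact hpNorm_le hp.out (mul_nonneg (Real.rpow_nonneg
        (div_nonneg (by norm_num) (by linarith)) _) (hpNorm_nonneg _))
        fun _ hr => comp_root_le φ f hr

variable {p} in
theorem compOp_apply (φ : DiscAut) (f : Hp p) {z : ℂ} (hz : z ∈ ball (0 : ℂ) 1) :
    compOp φ f z = f (φ z) :=
  indicator_of_mem hz fun z => f (φ z)

/-- `U_φ = M_{(conj lam * φ') ^ (1/p)} C_φ`. -/
def U (φ : DiscAut) : Hp p →L[ℂ] Hp p := mulOp (weight p φ) ∘L compOp φ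

theorem U_apply (φ : DiscAut) (f : Hp p) {z : ℂ} (hz : z ∈ ball (0 : ℂ) 1) :
    U p φ f z = (conj φ.lam * deriv φ z) ^ ((1 / p : ℝ) : ℂ) * f (φ z) := by
  rw [← compOp_apply φ f hz]
  rfl

end Hp

/-- Isometric equivalence: `B = V A V⁻¹` for some isometry `V` of the space onto itself. -/
def IsometricallyEquivalent {X : Type*} [NormedAddCommGroup X] [NormedSpace ℂ X]
    (B A : X →L[ℂ] X) : Prop :=
  ∃ V : X ≃ₗᵢ[ℂ] X, ∀ f, B f = V (A (V.symm f))

end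

section means

variable {p : ℝ}

/-- `|f|^p` has a majorant on `|w| < R` which is the real part of a holomorphic function. -/
theorem exists_re_majorant (hp : 1 ≤ p) {f : ℂ → ℂ} (hf : DifferentiableOn ℂ f (ball 0 1))
    {R : ℝ} (hR : R ∈ Ioo (0 : ℝ) 1) :
    ∃ G : ℂ → ℂ, DifferentiableOn ℂ G (ball 0 R) ∧
      (∀ w ∈ ball (0 : ℂ) R, ‖f w‖ ^ p ≤ (G w).re) ∧
      ∀ w ∈ ball (0 : ℂ) R, (G w).re ≤ (R + ‖w‖) / (R - ‖w‖) * pMean p f R := by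
  have hgc := continuousOn_norm_rpow hp (continuousOn_sphere hf hR)
  have gi : CircleIntegrable (fun z => ‖f z‖ ^ p) 0 R := hgc.circleIntegrable'
  have gi' : CircleIntegrable (fun z => ((‖f z‖ ^ p : ℝ) : ℂ)) 0 R :=
    (Complex.continuous_ofReal.comp_continuousOn hgc).circleIntegrable'
  have hre : ∀ w ∈ ball (0 : ℂ) R,
      (circleAverage (fun ζ => herglotzRieszKernel 0 w ζ • ((‖f ζ‖ ^ p : ℝ) : ℂ)) 0 R).re =
        circleAverage (fun z => poissonKernel 0 w z * ‖f z‖ ^ p) 0 R := fun w hw => by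
    rw [poissonKernel_eq_re_herglotzRieszKernel]
    exact re_circleAverage_herglotzRieszKernel_smul gi hw
  refine ⟨_, differentiableOn_circleAverage_herglotzRieszKernel_smul gi', fun w hw => ?_,
    fun w hw => ?_⟩
  · rw [hre w hw]
    exact pow_le_poisson hp hf hR hw
  · rw [hre w hw]
    exact circleAverage_poisson_le hp hf hR hw

theorem circleAverage_re_eq {G : ℂ → ℂ} {r R : ℝ} (hr : 0 < r) (hrR : r < R)
    (hG : DifferentiableOn ℂ G (ball 0 R)) :
    circleAverage (fun z => (G z).re) 0 r = (G 0).re := by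
  have hG' : DifferentiableOn ℂ G (closedBall 0 r) := hG.mono (closedBall_subset_ball hrR)
  have hdc : DiffContOnCl ℂ G (ball 0 |r|) := by
    refine DifferentiableOn.diffContOnCl ?_
    rwa [abs_of_pos hr, closure_ball _ hr.ne']
  have ci : CircleIntegrable G 0 r := by
    refine (hG'.continuousOn.mono ?_).circleIntegrable'
    rw [abs_of_pos hr]; exact sphere_subset_closedBall
  have h := Complex.reCLM.circleAverage_comp_comm ci
  rw [hdc.circleAverage] at h
  exact h

theorem pMean_mono (hp : 1 ≤ p) {f : ℂ → ℂ} (hf : DifferentiableOn ℂ f (ball 0 1)) {r R : ℝ}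
    (hr : 0 < r) (hrR : r ≤ R) (hR : R < 1) : pMean p f r ≤ pMean p f R := by
  rcases hrR.eq_or_lt with rfl | hlt
  · rfl
  have hR' : R ∈ Ioo (0 : ℝ) 1 := ⟨hr.trans hlt, hR⟩
  obtain ⟨G, hG, h1, h2⟩ := exists_re_majorant hp hf hR'
  have hss : sphere (0 : ℂ) |r| ⊆ ball 0 R := fun z hz => by
    rw [mem_sphere_zero_iff_norm, abs_of_pos hr] at hz
    rwa [mem_ball_zero_iff, hz]
  have h3 : pMean p f r ≤ circleAverage (fun z => (G z).re) 0 r :=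
    circleAverage_mono (circleIntegrable_pow hp hf ⟨hr, hlt.trans hR⟩)
      (Complex.continuous_re.comp_continuousOn
        (hG.continuousOn.mono hss)).circleIntegrable' fun z hz => h1 z (hss hz)
  rw [circleAverage_re_eq hr hlt hG] at h3
  have h4 := h2 0 (mem_ball_self hR'.1)
  rw [norm_zero, add_zero, sub_zero, div_self hR'.1.ne', one_mul] at h4
  exact h3.trans h4

theorem norm_rpow_le_of_pMean_le (hp : 1 ≤ p) {f : ℂ → ℂ} (hf : DifferentiableOn ℂ f (ball 0 1))
    {K : ℝ} (hK : ∀ r ∈ Ioo (0 : ℝ) 1, pMean p f r ≤ K) {z : ℂ} (hz : ‖z‖ < 1) :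
    ‖f z‖ ^ p ≤ 4 / (1 - ‖z‖) * K := by
  have h0 := norm_nonneg z
  have hR : (1 + ‖z‖) / 2 ∈ Ioo (0 : ℝ) 1 := ⟨by linarith, by linarith⟩
  obtain ⟨G, hG, h1, h2⟩ := exists_re_majorant hp hf hR
  have hz' : z ∈ ball (0 : ℂ) ((1 + ‖z‖) / 2) := by rw [mem_ball_zero_iff]; linarith
  refine (h1 z hz').trans ((h2 z hz').trans ?_)
  refine mul_le_mul ?_ (hK _ hR) (pMean_nonneg _ _) (div_nonneg (by norm_num) (by linarith))
  rw [div_le_div_iff₀ (by linarith) (by linarith)]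
  nlinarith

theorem tendsto_pMean_of_bound (hp : 1 ≤ p) {f : ℕ → ℂ → ℂ} {g : ℂ → ℂ} {r C : ℝ}
    (hf : ∀ n, ContinuousOn (f n) (sphere 0 |r|))
    (hC : ∀ n, ∀ z ∈ sphere (0 : ℂ) |r|, ‖f n z‖ ≤ C)
    (h : ∀ z ∈ sphere (0 : ℂ) |r|, Filter.Tendsto (fun n => f n z) Filter.atTop (nhds (g z))) :
    Filter.Tendsto (fun n => pMean p (f n) r) Filter.atTop (nhds (pMean p g r)) := by
  have hp0 : 0 < p := by linarith
  simp only [pMean, circleAverage_def]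
  refine Filter.Tendsto.const_smul ?_ _
  refine intervalIntegral.tendsto_integral_filter_of_dominated_convergence (fun _ => C ^ p) ?_ ?_
    (by simp) ?_
  · refine Filter.Eventually.of_forall fun n => ?_
    exact ((continuousOn_norm_rpow hp (hf n)).comp_continuous (continuous_circleMap 0 r)
      fun θ => circleMap_mem_sphere' 0 r θ).aestronglyMeasurable
  · refine Filter.Eventually.of_forall fun n => Filter.Eventually.of_forall fun θ _ => ?_
    rw [Real.norm_of_nonneg (by positivity)]
    exact Real.rpow_le_rpow (norm_nonneg _) (hC n _ (circleMap_mem_sphere' 0 r θ)) hp0.le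
  · refine Filter.Eventually.of_forall fun θ _ => ?_
    exact ((h _ (circleMap_mem_sphere' 0 r θ)).norm).rpow_const (Or.inr hp0.le)

theorem pMean_le_of_norm_le (hp : 1 ≤ p) {f : ℂ → ℂ} {r C : ℝ}
    (hC : ∀ z ∈ sphere (0 : ℂ) |r|, ‖f z‖ ≤ C) (hf : ContinuousOn f (sphere 0 |r|)) :
    pMean p f r ≤ C ^ p := by
  have hp0 : 0 < p := by linarith
  refine circleAverage_mono_on_of_le_circle
    (continuousOn_norm_rpow hp hf).circleIntegrable' fun z hz => ?_
  exact Real.rpow_le_rpow (norm_nonneg _) (hC z hz) hp0.le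

theorem pMean_dilate (f : ℂ → ℂ) (s r : ℝ) :
    pMean p (fun z => f (s * z)) r = pMean p f (s * r) := by
  simp only [pMean, circleAverage_def]
  congr 2
  funext θ
  simp [circleMap, mul_assoc]

theorem pMean_congr {f g : ℂ → ℂ} (h : ∀ z ∈ ball (0 : ℂ) 1, f z = g z) {r : ℝ}
    (hr : r ∈ Ioo (0 : ℝ) 1) : pMean p f r = pMean p g r :=
  circleAverage_congr_sphere fun z hz => by
    simp only [h z (mem_ball_of_mem_sphere hr hz)]

theorem one_sub_mem_Ioo (n : ℕ) : 1 - 1 / ((n : ℝ) + 2) ∈ Ioo (0 : ℝ) 1 := by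
  have h1 : 0 < 1 / ((n : ℝ) + 2) := by positivity
  have h2 : 1 / ((n : ℝ) + 2) < 1 := by
    rw [div_lt_one (by positivity)]; linarith [(Nat.cast_nonneg n : (0 : ℝ) ≤ n)]
  constructor <;> linarith

theorem tendsto_one_sub : Filter.Tendsto (fun n : ℕ => 1 - 1 / ((n : ℝ) + 2)) Filter.atTop
    (nhds 1) := by
  have h := (tendsto_one_div_add_atTop_nhds_zero_nat (𝕜 := ℝ)).comp (Filter.tendsto_add_atTop_nat 1)
  have h2 : Filter.Tendsto (fun n : ℕ => 1 / ((n : ℝ) + 2)) Filter.atTop (nhds 0) := by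
    refine h.congr fun n => ?_
    simp only [Function.comp_apply]; push_cast; congr 1; ring
  simpa using h2.const_sub 1

theorem pMean_one_eq_of_continuous (hp : 1 ≤ p) {f : ℂ → ℂ} (hf : Continuous f) :
    Filter.Tendsto (fun n : ℕ => pMean p f (1 - 1 / ((n : ℝ) + 2))) Filter.atTop
      (nhds (pMean p f 1)) := by
  obtain ⟨C, hC⟩ := (isCompact_closedBall (0 : ℂ) 1).exists_bound_of_continuousOn hf.continuousOn
  have hlim := tendsto_one_sub
  have e : ∀ n : ℕ, pMean p f (1 - 1 / ((n : ℝ) + 2)) =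
      pMean p (fun z => f (((1 - 1 / ((n : ℝ) + 2) : ℝ) : ℂ) * z)) 1 := fun n => by
    rw [pMean_dilate, mul_one]
  simp_rw [e]
  refine tendsto_pMean_of_bound hp (C := C) (fun n => by fun_prop) (fun n z hz => hC _ ?_)
    fun z hz => ?_
  · rw [mem_closedBall_zero_iff, norm_mul, Complex.norm_real]
    rw [mem_sphere_zero_iff_norm, abs_one] at hz
    rw [hz, mul_one, Real.norm_eq_abs, abs_le]
    have h1 : 0 ≤ 1 / ((n : ℝ) + 2) := by positivity
    have h2 : 1 / ((n : ℝ) + 2) ≤ 1 := by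
      rw [div_le_one (by positivity)]; linarith [(Nat.cast_nonneg n : (0 : ℝ) ≤ n)]
    constructor <;> linarith
  · have h3 := ((Complex.continuous_ofReal.tendsto 1).comp hlim).mul_const z
    have := (hf.tendsto _).comp h3
    simpa [Function.comp_def] using this

theorem pMean_le_pMean_one (hp : 1 ≤ p) {f : ℂ → ℂ} (hf : Differentiable ℂ f) {r : ℝ}
    (hr : r ∈ Ioo (0 : ℝ) 1) : pMean p f r ≤ pMean p f 1 := by
  refine ge_of_tendsto (pMean_one_eq_of_continuous hp hf.continuous) ?_
  filter_upwards [tendsto_one_sub.eventually (lt_mem_nhds hr.2)] with n hn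
  exact pMean_mono hp hf.differentiableOn hr.1 hn.le (one_sub_mem_Ioo n).2

end means

namespace Hp

variable {p : ℝ} [hp : Fact (1 ≤ p)]

theorem p_pos (p : ℝ) [hp : Fact (1 ≤ p)] : 0 < p := lt_of_lt_of_le one_pos hp.out

theorem differentiableOn (f : Hp p) : DifferentiableOn ℂ f (ball 0 1) := f.2.1

@[ext] theorem ext {f g : Hp p} (h : ∀ z ∈ ball (0 : ℂ) 1, f z = g z) : f = g := by
  refine Subtype.ext (funext fun z => ?_)
  by_cases hz : z ∈ ball (0 : ℂ) 1
  · exact h z hz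
  · rw [f.2.2 z hz, g.2.2 z hz]

theorem add_apply (f g : Hp p) (z : ℂ) : (f + g) z = f z + g z := rfl
theorem sub_apply (f g : Hp p) (z : ℂ) : (f - g) z = f z - g z := rfl
theorem smul_apply (c : ℂ) (f : Hp p) (z : ℂ) : (c • f) z = c * f z := rfl
theorem zero_apply (z : ℂ) : (0 : Hp p) z = 0 := rfl

theorem norm_rpow (f : Hp p) : ‖f‖ ^ p = ⨆ r : Ioo (0 : ℝ) 1, pMean p f r := by
  rw [norm_def, hpNorm, ← Real.rpow_mul (Real.iSup_nonneg fun _ => pMean_nonneg _ _),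
    one_div_mul_cancel (p_pos p).ne', Real.rpow_one]

theorem pMean_le (f : Hp p) {r : ℝ} (hr : r ∈ Ioo (0 : ℝ) 1) : pMean p f r ≤ ‖f‖ ^ p := by
  rw [norm_rpow]; exact le_ciSup f.2.bdd ⟨r, hr⟩

theorem norm_rpow_le (f : Hp p) {K : ℝ} (h : ∀ r ∈ Ioo (0 : ℝ) 1, pMean p f r ≤ K) :
    ‖f‖ ^ p ≤ K := by
  rw [norm_rpow]; exact ciSup_le fun r => h r r.2

theorem norm_le_of_rpow_le {f : Hp p} {C : ℝ} (hC : 0 ≤ C) (h : ‖f‖ ^ p ≤ C ^ p) : ‖f‖ ≤ C :=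
  (Real.rpow_le_rpow_iff (norm_nonneg _) hC (p_pos p)).mp h

theorem norm_apply_le (f : Hp p) {z : ℂ} (hz : ‖z‖ < 1) :
    ‖f z‖ ≤ (4 / (1 - ‖z‖)) ^ (1 / p) * ‖f‖ := by
  have hp0 := p_pos p
  have h := norm_rpow_le_of_pMean_le hp.out f.differentiableOn (fun r hr => f.pMean_le hr) hz
  have h4 : 0 ≤ 4 / (1 - ‖z‖) := div_nonneg (by norm_num) (by linarith)
  refine (Real.rpow_le_rpow_iff (norm_nonneg _) (by positivity) hp0).mp (h.trans_eq ?_)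
  rw [Real.mul_rpow (by positivity) (norm_nonneg _), ← Real.rpow_mul h4,
    one_div_mul_cancel hp0.ne', Real.rpow_one]

/-- A holomorphic function with bounded integral means as an element of the Hardy space. -/
noncomputable def ofFun (f : ℂ → ℂ) (hf : DifferentiableOn ℂ f (ball 0 1))
    (hb : ∃ K, ∀ r ∈ Ioo (0 : ℝ) 1, pMean p f r ≤ K) : Hp p :=
  ⟨(ball (0 : ℂ) 1).indicator f, hf.congr fun _ hz => indicator_of_mem hz _,
    fun _ hz => indicator_of_notMem hz _, by
      obtain ⟨K, hK⟩ := hb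
      refine ⟨K, ?_⟩
      rintro _ ⟨r, rfl⟩
      show pMean p _ _ ≤ K
      rw [pMean_indicator f r.2]
      exact hK r r.2⟩

theorem ofFun_apply {f : ℂ → ℂ} (hf : DifferentiableOn ℂ f (ball 0 1))
    (hb : ∃ K, ∀ r ∈ Ioo (0 : ℝ) 1, pMean p f r ≤ K) {z : ℂ} (hz : z ∈ ball (0 : ℂ) 1) :
    ofFun f hf hb z = f z := indicator_of_mem hz f

theorem exists_pMean_le_of_bound {f : ℂ → ℂ} (hf : DifferentiableOn ℂ f (ball 0 1)) {C : ℝ}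
    (hC : ∀ z ∈ ball (0 : ℂ) 1, ‖f z‖ ≤ C) {r : ℝ} (hr : r ∈ Ioo (0 : ℝ) 1) :
    pMean p f r ≤ C ^ p :=
  pMean_le_of_norm_le hp.out (fun z hz => hC z (mem_ball_of_mem_sphere hr hz))
    (continuousOn_sphere hf hr)

/-- Polynomials as elements of the Hardy space. -/
noncomputable def ofPoly (p : ℝ) [hp : Fact (1 ≤ p)] : Polynomial ℂ →ₗ[ℂ] Hp p where
  toFun P := ofFun (fun z => P.eval z) P.differentiable.differentiableOn
    ⟨_, fun _ hr => pMean_le_pMean_one hp.out P.differentiable hr⟩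
  map_add' P Q := by
    ext z hz
    rw [add_apply, ofFun_apply _ _ hz, ofFun_apply _ _ hz, ofFun_apply _ _ hz, Polynomial.eval_add]
  map_smul' c P := by
    ext z hz
    rw [RingHom.id_apply, smul_apply, ofFun_apply _ _ hz, ofFun_apply _ _ hz,
      Polynomial.eval_smul, smul_eq_mul]

theorem ofPoly_apply (P : Polynomial ℂ) {z : ℂ} (hz : z ∈ ball (0 : ℂ) 1) :
    ofPoly p P z = P.eval z :=
  indicator_of_mem hz fun z => P.eval z

theorem norm_ofPoly_rpow (P : Polynomial ℂ) :
    ‖ofPoly p P‖ ^ p = pMean p (fun z => P.eval z) 1 := by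
  have hc : Continuous (fun z => P.eval z) := P.continuous
  refine le_antisymm (norm_rpow_le _ fun r hr => ?_) ?_
  · rw [pMean_congr (fun z hz => ofPoly_apply P hz) hr]
    exact pMean_le_pMean_one hp.out P.differentiable hr
  refine le_of_tendsto (pMean_one_eq_of_continuous hp.out hc) (Filter.Eventually.of_forall
    fun n => ?_)
  rw [← pMean_congr (fun z hz => ofPoly_apply (p := p) P hz) (one_sub_mem_Ioo n)]
  exact pMean_le _ (one_sub_mem_Ioo n)

end Hp

open Filter Topology in
/-- Taylor polynomials approximate a function holomorphic past the closed unit disc. -/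
theorem exists_poly_near {f : ℂ → ℂ} {R : ℝ} (hR : 1 < R) (hf : DifferentiableOn ℂ f (ball 0 R))
    {ε : ℝ} (hε : 0 < ε) :
    ∃ P : Polynomial ℂ, ∀ z ∈ closedBall (0 : ℂ) 1, ‖f z - P.eval z‖ ≤ ε := by
  lift R to NNReal using by linarith
  obtain ⟨ρ, h1, h2⟩ := exists_between (show (1 : NNReal) < R by exact_mod_cast hR)
  obtain ⟨s, h3, h4⟩ := exists_between h1
  have hs : HasFPowerSeriesOnBall f (cauchyPowerSeries f 0 ρ) 0 ρ :=
    (hf.mono (closedBall_subset_ball (by exact_mod_cast h2))).hasFPowerSeriesOnBall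
      (one_pos.trans h1)
  have hu := hs.tendstoUniformlyOn (r' := s) (by exact_mod_cast h4)
  rw [Metric.tendstoUniformlyOn_iff] at hu
  obtain ⟨n, hn⟩ := (hu ε hε).exists
  refine ⟨∑ k ∈ Finset.range n, Polynomial.C ((cauchyPowerSeries f 0 ρ).coeff k) *
    Polynomial.X ^ k, fun z hz => ?_⟩
  have hz' : z ∈ ball (0 : ℂ) s := by
    rw [mem_closedBall_zero_iff] at hz
    rw [mem_ball_zero_iff]
    exact hz.trans_lt (by exact_mod_cast h3)
  have := (hn z hz').le
  rw [dist_eq_norm, zero_add] at this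
  rw [Polynomial.eval_finsetSum]
  refine le_of_eq_of_le ?_ this
  congr 2
  refine Finset.sum_congr rfl fun k _ => ?_
  rw [FormalMultilinearSeries.apply_eq_pow_smul_coeff, smul_eq_mul, Polynomial.eval_mul,
    Polynomial.eval_C, Polynomial.eval_pow, Polynomial.eval_X, mul_comm]

theorem clarkson {q : ℝ} (hq : 2 ≤ q) (a b : ℂ) :
    ‖a + b‖ ^ q + ‖a - b‖ ^ q ≤ 2 ^ (q - 1) * (‖a‖ ^ q + ‖b‖ ^ q) := by
  have hs : 1 ≤ q / 2 := by linarith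
  have sq : ∀ x : ℂ, ‖x‖ ^ q = (‖x‖ ^ 2) ^ (q / 2) := fun x => by
    rw [← Real.rpow_natCast, ← Real.rpow_mul (norm_nonneg _)]; congr 1; push_cast; ring
  have par : ‖a + b‖ ^ 2 + ‖a - b‖ ^ 2 = 2 * (‖a‖ ^ 2 + ‖b‖ ^ 2) := by
    have := parallelogram_law_with_norm ℝ a b
    linarith [pow_two ‖a + b‖, pow_two ‖a - b‖, pow_two ‖a‖, pow_two ‖b‖]
  have h1 : (‖a + b‖ ^ 2) ^ (q / 2) + (‖a - b‖ ^ 2) ^ (q / 2) ≤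
      (‖a + b‖ ^ 2 + ‖a - b‖ ^ 2) ^ (q / 2) := by
    have := NNReal.add_rpow_le_rpow_add (⟨‖a + b‖ ^ 2, by positivity⟩ : NNReal)
      ⟨‖a - b‖ ^ 2, by positivity⟩ hs
    exact_mod_cast this
  have h2 : (‖a‖ ^ 2 + ‖b‖ ^ 2) ^ (q / 2) ≤
      2 ^ (q / 2 - 1) * ((‖a‖ ^ 2) ^ (q / 2) + (‖b‖ ^ 2) ^ (q / 2)) := by
    have := NNReal.rpow_add_le_mul_rpow_add_rpow (⟨‖a‖ ^ 2, by positivity⟩ : NNReal)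
      ⟨‖b‖ ^ 2, by positivity⟩ hs
    exact_mod_cast this
  rw [sq, sq, sq, sq]
  refine h1.trans ?_
  rw [par, Real.mul_rpow (by norm_num) (by positivity)]
  refine (mul_le_mul_of_nonneg_left h2 (by positivity)).trans_eq ?_
  rw [← mul_assoc, ← Real.rpow_add (by norm_num)]
  congr 2; ring

theorem pMean_clarkson {q : ℝ} (hq : 2 ≤ q) {f g : ℂ → ℂ} (hf : DifferentiableOn ℂ f (ball 0 1))
    (hg : DifferentiableOn ℂ g (ball 0 1)) {r : ℝ} (hr : r ∈ Ioo (0 : ℝ) 1) :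
    pMean q (fun z => f z + g z) r + pMean q (fun z => f z - g z) r ≤
      2 ^ (q - 1) * (pMean q f r + pMean q g r) := by
  have h1 : 1 ≤ q := by linarith
  have i1 := circleIntegrable_pow h1 hf hr
  have i2 := circleIntegrable_pow h1 hg hr
  have i3 := circleIntegrable_pow h1 (hf.add hg) hr
  have i4 := circleIntegrable_pow h1 (hf.sub hg) hr
  have e1 := circleAverage_fun_add i3 i4
  have e2 := circleAverage_fun_add i1 i2
  have e3 : circleAverage (fun z => (2 : ℝ) ^ (q - 1) • (‖f z‖ ^ q + ‖g z‖ ^ q)) 0 r =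
    _ := circleAverage_fun_smul
  simp only [pMean]
  rw [← e2, ← smul_eq_mul, ← e3]
  refine le_of_eq_of_le e1.symm ?_
  exact circleAverage_mono (i3.add i4) ((i1.add i2).const_smul) fun z _ => clarkson hq _ _

theorem differentiableOn_dilate {f : ℂ → ℂ} (hf : DifferentiableOn ℂ f (ball 0 1)) {s : ℝ}
    (hs : s ∈ Ioo (0 : ℝ) 1) : DifferentiableOn ℂ (fun z => f (s * z)) (ball 0 (1 / s)) := by
  refine hf.comp (by fun_prop) fun z hz => ?_
  rw [mem_ball_zero_iff] at hz ⊢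
  rw [norm_mul, Complex.norm_real, Real.norm_of_nonneg hs.1.le]
  rwa [lt_div_iff₀ hs.1, mul_comm] at hz

theorem one_lt_one_div_of_mem {s : ℝ} (hs : s ∈ Ioo (0 : ℝ) 1) : 1 < 1 / s := by
  rw [lt_div_iff₀ hs.1, one_mul]; exact hs.2

theorem differentiableOn_dilate' {f : ℂ → ℂ} (hf : DifferentiableOn ℂ f (ball 0 1)) {s : ℝ}
    (hs : s ∈ Ioo (0 : ℝ) 1) : DifferentiableOn ℂ (fun z => f (s * z)) (ball 0 1) :=
  (differentiableOn_dilate hf hs).mono (ball_subset_ball (one_lt_one_div_of_mem hs).le)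

theorem pMean_dilate_le {p : ℝ} (hp : 1 ≤ p) {f : ℂ → ℂ} (hf : DifferentiableOn ℂ f (ball 0 1))
    {s : ℝ} (hs : s ∈ Ioo (0 : ℝ) 1) {r : ℝ} (hr : r ∈ Ioo (0 : ℝ) 1) :
    pMean p (fun z => f (s * z)) r ≤ pMean p f r := by
  rw [pMean_dilate]
  exact pMean_mono hp hf (mul_pos hs.1 hr.1) (by nlinarith [hs.1, hs.2, hr.1]) hr.2

open Filter Topology in
theorem tendsto_dilate {f : ℂ → ℂ} (hf : DifferentiableOn ℂ f (ball 0 1)) {z : ℂ}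
    (hz : z ∈ ball (0 : ℂ) 1) :
    Tendsto (fun n : ℕ => f ((1 - 1 / ((n : ℝ) + 2) : ℝ) * z)) atTop (𝓝 (f z)) := by
  have h1 := ((Complex.continuous_ofReal.tendsto 1).comp tendsto_one_sub).mul_const z
  have h2 := (hf.continuousOn.continuousAt (isOpen_ball.mem_nhds hz)).tendsto
  rw [Complex.ofReal_one, one_mul] at h1
  exact h2.comp h1

open Filter Topology in
/-- For `q ≥ 2`, dilates converge in the mean of order `q`. -/
theorem exists_dilate_near {q : ℝ} (hq : 2 ≤ q) {f : ℂ → ℂ}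
    (hf : DifferentiableOn ℂ f (ball 0 1)) {K : ℝ} (hK : ∀ r ∈ Ioo (0 : ℝ) 1, pMean q f r ≤ K)
    {ε : ℝ} (hε : 0 < ε) :
    ∃ s ∈ Ioo (0 : ℝ) 1, ∀ r ∈ Ioo (0 : ℝ) 1, pMean q (fun z => f z - f (s * z)) r ≤ ε := by
  have h1 : 1 ≤ q := by linarith
  have hbdd : BddAbove (range fun r : Ioo (0 : ℝ) 1 => pMean q f r) :=
    ⟨K, by rintro _ ⟨r, rfl⟩; exact hK r r.2⟩
  set S := ⨆ r : Ioo (0 : ℝ) 1, pMean q f r with hS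
  have hle : ∀ r ∈ Ioo (0 : ℝ) 1, pMean q f r ≤ S := fun r hr => le_ciSup hbdd ⟨r, hr⟩
  have h2q : (0 : ℝ) < 2 ^ q := by positivity
  obtain ⟨⟨t, ht⟩, hlt⟩ := exists_lt_of_lt_ciSup (show S - ε / 2 ^ q < S by
    have : 0 < ε / 2 ^ q := by positivity
    linarith)
  simp only at hlt
  have hsub : sphere (0 : ℂ) |t| ⊆ ball 0 1 := fun z hz => mem_ball_of_mem_sphere ht hz
  obtain ⟨C, hC⟩ := (isCompact_closedBall (0 : ℂ) t).exists_bound_of_continuousOn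
    (hf.continuousOn.mono (closedBall_subset_ball ht.2))
  have hlim : Tendsto (fun n : ℕ => pMean q
      (fun z => f z + f ((1 - 1 / ((n : ℝ) + 2) : ℝ) * z)) t) atTop
      (𝓝 (pMean q (fun z => f z + f z) t)) := by
    refine tendsto_pMean_of_bound h1 (C := C + C) (fun n => ?_) (fun n z hz => ?_) fun z hz => ?_
    · exact continuousOn_sphere (hf.add (differentiableOn_dilate' hf (one_sub_mem_Ioo n))) ht
    · rw [mem_sphere_zero_iff_norm, abs_of_pos ht.1] at hz
      refine (norm_add_le _ _).trans (add_le_add (hC z ?_) (hC _ ?_))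
      · rw [mem_closedBall_zero_iff, hz]
      · have := one_sub_mem_Ioo n
        rw [mem_closedBall_zero_iff, norm_mul, Complex.norm_real, Real.norm_of_nonneg this.1.le, hz]
        nlinarith [ht.1, this.1, this.2]
    · exact tendsto_const_nhds.add (tendsto_dilate hf (hsub hz))
  have e2 : pMean q (fun z => f z + f z) t = 2 ^ q * pMean q f t := by
    have := pMean_smul (p := q) 2 f t
    rw [Complex.norm_two] at this
    rw [← this]
    congr 1
    funext z
    simp [two_mul]
  rw [e2] at hlim
  obtain ⟨n, hn⟩ := (hlim.eventually (lt_mem_nhds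
    (mul_lt_mul_of_pos_left hlt h2q))).exists
  set s : ℝ := 1 - 1 / ((n : ℝ) + 2) with hs
  have hs' : s ∈ Ioo (0 : ℝ) 1 := one_sub_mem_Ioo n
  have hd := differentiableOn_dilate' hf hs'
  refine ⟨s, hs', ?_⟩
  have big : ∀ r ∈ Ioo (0 : ℝ) 1, t ≤ r → pMean q (fun z => f z - f (s * z)) r ≤ ε := by
    intro r hr htr
    have c1 := pMean_clarkson hq hf hd hr
    have c2 : pMean q (fun z => f z + f (s * z)) t ≤ pMean q (fun z => f z + f (s * z)) r :=
      pMean_mono h1 (hf.add hd) ht.1 htr hr.2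
    have c3 := pMean_dilate_le h1 hf hs' hr
    have c4 := hle r hr
    have c5 : (2 : ℝ) ^ (q - 1) * (S + S) = 2 ^ q * S := by
      rw [Real.rpow_sub_one (by norm_num)]; ring
    have c6 : (2 : ℝ) ^ (q - 1) * (pMean q f r + pMean q (fun z => f (s * z)) r) ≤
        2 ^ (q - 1) * (S + S) :=
      mul_le_mul_of_nonneg_left (by linarith) (by positivity)
    have c7 : 2 ^ q * (S - ε / 2 ^ q) = 2 ^ q * S - ε := by field_simp
    linarith
  intro r hr
  rcases le_total t r with h | h
  · exact big r hr h
  · exact (pMean_mono h1 (hf.sub hd) hr.1 h ht.2).trans (big t ht le_rfl)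

theorem pMean_add_root' {p : ℝ} (hp : 1 ≤ p) {f g h : ℂ → ℂ}
    (hf : DifferentiableOn ℂ f (ball 0 1)) (hg : DifferentiableOn ℂ g (ball 0 1))
    (e : ∀ z, h z = f z + g z) {r : ℝ} (hr : r ∈ Ioo (0 : ℝ) 1) :
    (pMean p h r) ^ (1 / p) ≤ (pMean p f r) ^ (1 / p) + (pMean p g r) ^ (1 / p) := by
  rw [show h = f + g from funext e]
  exact pMean_add hp hf hg hr

theorem root_le_of_le {p x C : ℝ} (hp : 1 ≤ p) (hx : 0 ≤ x) (hC : 0 ≤ C) (h : x ≤ C ^ p) :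
    x ^ (1 / p) ≤ C := by
  have := Real.rpow_le_rpow hx h (by positivity : 0 ≤ 1 / p)
  rwa [← Real.rpow_mul hC, mul_one_div_cancel (by linarith), Real.rpow_one] at this

theorem exists_poly_pMean_near_of_two_le {q : ℝ} (hq : 2 ≤ q) {f : ℂ → ℂ}
    (hf : DifferentiableOn ℂ f (ball 0 1)) {K : ℝ} (hK : ∀ r ∈ Ioo (0 : ℝ) 1, pMean q f r ≤ K)
    {ε : ℝ} (hε : 0 < ε) :
    ∃ P : Polynomial ℂ, ∀ r ∈ Ioo (0 : ℝ) 1,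
      (pMean q (fun z => f z - P.eval z) r) ^ (1 / q) ≤ ε := by
  have h1 : 1 ≤ q := by linarith
  obtain ⟨s, hs, h2⟩ := exists_dilate_near hq hf hK (ε := (ε / 2) ^ q) (by positivity)
  obtain ⟨P, hP⟩ := exists_poly_near (one_lt_one_div_of_mem hs) (differentiableOn_dilate hf hs)
    (half_pos hε)
  have hd := differentiableOn_dilate' hf hs
  have hPd : DifferentiableOn ℂ (fun z => P.eval z) (ball 0 1) := P.differentiable.differentiableOn
  refine ⟨P, fun r hr => ?_⟩
  have a1 := pMean_add_root' h1 (hf.sub hd) (hd.sub hPd) (h := fun z => f z - P.eval z)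
    (fun z => by simp) hr
  have a2 := root_le_of_le h1 (pMean_nonneg _ _) (half_pos hε).le (h2 r hr)
  have a3 : pMean q (fun z => f (s * z) - P.eval z) r ≤ (ε / 2) ^ q :=
    pMean_le_of_norm_le h1 (fun z hz => hP z (ball_subset_closedBall
      (mem_ball_of_mem_sphere hr hz))) (continuousOn_sphere (hd.sub hPd) hr)
  have a4 := root_le_of_le h1 (pMean_nonneg _ _) (half_pos hε).le a3
  exact a1.trans ((add_le_add a2 a4).trans_eq (add_halves ε))

theorem norm_taylorCoeff_le {f : ℂ → ℂ} (hf : DifferentiableOn ℂ f (ball 0 1)) {ρ C : ℝ}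
    (hρ : ρ ∈ Ioo (0 : ℝ) 1) (hC : ∀ z, ‖z‖ ≤ ρ → ‖f z‖ ≤ C) (k : ℕ) :
    ‖(k.factorial : ℂ)⁻¹ * iteratedDeriv k f 0‖ ≤ C / ρ ^ k := by
  have h1 : DiffContOnCl ℂ f (ball 0 ρ) := by
    refine DifferentiableOn.diffContOnCl ?_
    rw [closure_ball _ hρ.1.ne']
    exact hf.mono (closedBall_subset_ball hρ.2)
  have h2 := norm_iteratedDeriv_le_of_forall_mem_sphere_norm_le k hρ.1 h1 (C := C)
    fun z hz => hC z (mem_sphere_zero_iff_norm.mp hz).le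
  have hk : (0 : ℝ) < k.factorial := by exact_mod_cast k.factorial_pos
  rw [norm_mul, norm_inv, Complex.norm_natCast, inv_mul_le_iff₀ hk]
  rwa [mul_div_assoc] at h2

theorem differentiableOn_tsum_mul_pow {b : ℕ → ℂ}
    (hb : ∀ ρ ∈ Ioo (0 : ℝ) 1, ∃ C, ∀ k, ‖b k‖ ≤ C / ρ ^ k) :
    DifferentiableOn ℂ (fun z => ∑' k, b k * z ^ k) (ball 0 1) := by
  intro z hz
  obtain ⟨s, h1, h2⟩ := exists_between (mem_ball_zero_iff.mp hz)
  obtain ⟨ρ, h3, h4⟩ := exists_between h2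
  have hs0 : 0 < s := (norm_nonneg z).trans_lt h1
  have hρ0 : 0 < ρ := hs0.trans h3
  obtain ⟨C, hC⟩ := hb ρ ⟨hρ0, h4⟩
  have hsum : Summable fun k : ℕ => C * (s / ρ) ^ k :=
    (summable_geometric_of_lt_one (by positivity) ((div_lt_one hρ0).mpr h3)).mul_left _
  refine ((differentiableOn_tsum_of_summable_norm hsum (U := ball 0 s) (F := fun k w => b k * w ^ k)
    (fun k => by fun_prop) isOpen_ball fun k w hw => ?_).differentiableAt
    (isOpen_ball.mem_nhds (mem_ball_zero_iff.mpr h1))).differentiableWithinAt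
  rw [norm_mul, norm_pow, div_pow, ← mul_div_assoc, mul_div_right_comm]
  rw [mem_ball_zero_iff] at hw
  exact mul_le_mul (hC k) (pow_le_pow_left₀ (norm_nonneg _) hw.le k) (by positivity)
    ((norm_nonneg _).trans (hC k))

open Filter Topology in
/-- Montel's theorem in the unit disc (with pointwise convergence). -/
theorem exists_subseq_tendsto {f : ℕ → ℂ → ℂ} (hf : ∀ n, DifferentiableOn ℂ (f n) (ball 0 1))
    (hb : ∀ ρ ∈ Ioo (0 : ℝ) 1, ∃ C, ∀ n z, ‖z‖ ≤ ρ → ‖f n z‖ ≤ C) :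
    ∃ (φ : ℕ → ℕ) (g : ℂ → ℂ), StrictMono φ ∧ DifferentiableOn ℂ g (ball 0 1) ∧
      ∀ z ∈ ball (0 : ℂ) 1, Tendsto (fun n => f (φ n) z) atTop (𝓝 (g z)) := by
  set a : ℕ → ℕ → ℂ := fun n k => (k.factorial : ℂ)⁻¹ * iteratedDeriv k (f n) 0 with ha
  have hab : ∀ ρ ∈ Ioo (0 : ℝ) 1, ∃ C, ∀ n k, ‖a n k‖ ≤ C / ρ ^ k := fun ρ hρ => by
    obtain ⟨C, hC⟩ := hb ρ hρ
    exact ⟨C, fun n k => norm_taylorCoeff_le (hf n) hρ (hC n) k⟩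
  obtain ⟨C₀, hC₀⟩ := hab (1 / 2) ⟨by norm_num, by norm_num⟩
  have hcomp : IsCompact (Set.pi univ fun k : ℕ => closedBall (0 : ℂ) (C₀ / (1 / 2) ^ k)) :=
    isCompact_univ_pi fun k => isCompact_closedBall _ _
  obtain ⟨b, -, φ, hφ, hlim⟩ := hcomp.tendsto_subseq (x := a) fun n k _ =>
    mem_closedBall_zero_iff.mpr (hC₀ n k)
  rw [tendsto_pi_nhds] at hlim
  have hbb : ∀ ρ ∈ Ioo (0 : ℝ) 1, ∃ C, ∀ k, ‖b k‖ ≤ C / ρ ^ k := fun ρ hρ => by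
    obtain ⟨C, hC⟩ := hab ρ hρ
    exact ⟨C, fun k => le_of_tendsto (hlim k).norm (Eventually.of_forall fun n => hC _ k)⟩
  refine ⟨φ, _, hφ, differentiableOn_tsum_mul_pow hbb, fun z hz => ?_⟩
  have e : ∀ n, f (φ n) z = ∑' k, a (φ n) k * z ^ k := fun n => by
    have := taylorSeries_eq_on_ball' hz (hf (φ n))
    simpa using this.symm
  simp_rw [e]
  obtain ⟨ρ, h1, h2⟩ := exists_between (mem_ball_zero_iff.mp hz)
  have hρ0 : 0 < ρ := (norm_nonneg z).trans_lt h1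
  obtain ⟨C, hC⟩ := hab ρ ⟨hρ0, h2⟩
  have hsum : Summable fun k : ℕ => C * (‖z‖ / ρ) ^ k :=
    (summable_geometric_of_lt_one (by positivity) ((div_lt_one hρ0).mpr h1)).mul_left _
  refine tendsto_tsum_of_dominated_convergence hsum (fun k => (hlim k).mul_const _)
    (Eventually.of_forall fun n k => ?_)
  rw [norm_mul, norm_pow, div_pow, ← mul_div_assoc, mul_div_right_comm]
  exact mul_le_mul_of_nonneg_right (hC _ k) (by positivity)

theorem differentiableOn_one_sub_mul_cpow {b : ℂ} (hb : ‖b‖ ≤ 1) :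
    DifferentiableOn ℂ (fun z => (1 - b * z) ^ (1 / 2 : ℂ)) (ball 0 1) := by
  refine DifferentiableOn.cpow_const (by fun_prop) fun z hz => Or.inl ?_
  have h1 : (b * z).re ≤ ‖b * z‖ := Complex.re_le_norm _
  rw [mem_ball_zero_iff] at hz
  rw [norm_mul] at h1
  rw [Complex.sub_re, Complex.one_re]
  nlinarith [norm_nonneg z, norm_nonneg b]

theorem cpow_half_sq (z : ℂ) : (z ^ (1 / 2 : ℂ)) ^ 2 = z := by
  simp

theorem norm_sub_le_norm_one_sub {a z : ℂ} (ha : ‖a‖ ≤ 1) (hz : ‖z‖ ≤ 1) :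
    ‖z - a‖ ≤ ‖1 - conj a * z‖ := by
  refine le_of_sq_le_sq ?_ (norm_nonneg _)
  have e : ‖1 - conj a * z‖ ^ 2 - ‖z - a‖ ^ 2 = (1 - ‖a‖ ^ 2) * (1 - ‖z‖ ^ 2) := by
    simp only [← Complex.normSq_eq_norm_sq, Complex.normSq_apply, Complex.sub_re, Complex.sub_im,
      Complex.mul_re, Complex.mul_im, Complex.conj_re, Complex.conj_im, Complex.one_re,
      Complex.one_im]
    ring
  have h1 : 0 ≤ 1 - ‖a‖ ^ 2 := by nlinarith [norm_nonneg a]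
  have h2 : 0 ≤ 1 - ‖z‖ ^ 2 := by nlinarith [norm_nonneg z]
  nlinarith [mul_nonneg h1 h2]

theorem norm_sub_eq_norm_one_sub {a z : ℂ} (hz : ‖z‖ = 1) : ‖z - a‖ = ‖1 - conj a * z‖ := by
  have e : ‖1 - conj a * z‖ ^ 2 - ‖z - a‖ ^ 2 = (1 - ‖a‖ ^ 2) * (1 - ‖z‖ ^ 2) := by
    simp only [← Complex.normSq_eq_norm_sq, Complex.normSq_apply, Complex.sub_re, Complex.sub_im,
      Complex.mul_re, Complex.mul_im, Complex.conj_re, Complex.conj_im, Complex.one_re,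
      Complex.one_im]
    ring
  rw [hz] at e
  exact (sq_eq_sq₀ (norm_nonneg _) (norm_nonneg _)).mp (by linarith)

/-- `P = u v` on the disc, `v ^ 2` being a polynomial of the same modulus as `P` on the circle. -/
def HasSqrtFactor (P : Polynomial ℂ) : Prop :=
  ∃ (g : Polynomial ℂ) (u v : ℂ → ℂ), DifferentiableOn ℂ u (ball 0 1) ∧
    DifferentiableOn ℂ v (ball 0 1) ∧
    (∀ z ∈ ball (0 : ℂ) 1, P.eval z = u z * v z ∧ (v z) ^ 2 = g.eval z ∧ ‖u z‖ ≤ ‖v z‖) ∧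
    ∀ z : ℂ, ‖z‖ = 1 → ‖g.eval z‖ = ‖P.eval z‖

theorem HasSqrtFactor.mul {P Q : Polynomial ℂ} (hP : HasSqrtFactor P) (hQ : HasSqrtFactor Q) :
    HasSqrtFactor (P * Q) := by
  obtain ⟨g, u, v, hu, hv, h1, h2⟩ := hP
  obtain ⟨g', u', v', hu', hv', h1', h2'⟩ := hQ
  refine ⟨g * g', fun z => u z * u' z, fun z => v z * v' z, hu.mul hu', hv.mul hv',
    fun z hz => ?_, fun z hz => ?_⟩
  · obtain ⟨a1, a2, a3⟩ := h1 z hz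
    obtain ⟨b1, b2, b3⟩ := h1' z hz
    refine ⟨?_, ?_, ?_⟩
    · rw [Polynomial.eval_mul, a1, b1]; ring
    · rw [Polynomial.eval_mul, ← a2, ← b2]; ring
    · rw [norm_mul, norm_mul]
      exact mul_le_mul a3 b3 (norm_nonneg _) (norm_nonneg _)
  · rw [Polynomial.eval_mul, Polynomial.eval_mul, norm_mul, norm_mul, h2 z hz, h2' z hz]

theorem hasSqrtFactor_C (c : ℂ) : HasSqrtFactor (Polynomial.C c) := by
  refine ⟨Polynomial.C c, fun _ => c ^ (1 / 2 : ℂ), fun _ => c ^ (1 / 2 : ℂ),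
    differentiableOn_const _, differentiableOn_const _, fun z _ => ⟨?_, ?_, le_rfl⟩, fun _ _ => rfl⟩
  · rw [Polynomial.eval_C, ← sq, cpow_half_sq]
  · rw [Polynomial.eval_C, cpow_half_sq]

theorem hasSqrtFactor_X_sub_C (a : ℂ) : HasSqrtFactor (Polynomial.X - Polynomial.C a) := by
  rcases lt_or_ge ‖a‖ 1 with ha | ha
  · have hne : ∀ z ∈ ball (0 : ℂ) 1, 1 - conj a * z ≠ 0 := fun z hz =>
      DiscAut.one_sub_ne_zero ha (mem_ball_zero_iff.mp hz)
    have hv := differentiableOn_one_sub_mul_cpow (b := conj a) (by simpa using ha.le)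
    refine ⟨1 - Polynomial.C (conj a) * Polynomial.X,
      fun z => (z - a) / (1 - conj a * z) * (1 - conj a * z) ^ (1 / 2 : ℂ),
      fun z => (1 - conj a * z) ^ (1 / 2 : ℂ), ?_, hv, fun z hz => ⟨?_, ?_, ?_⟩, fun z hz => ?_⟩
    · exact (DifferentiableOn.div (by fun_prop) (by fun_prop) hne).mul hv
    · rw [mul_assoc, ← sq, cpow_half_sq, div_mul_cancel₀ _ (hne z hz)]; simp
    · rw [cpow_half_sq]; simp
    · rw [norm_mul]
      refine mul_le_of_le_one_left (norm_nonneg _) ?_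
      rw [norm_div, div_le_one (norm_pos_iff.mpr (hne z hz))]
      exact norm_sub_le_norm_one_sub ha.le (mem_ball_zero_iff.mp hz).le
    · simpa using (norm_sub_eq_norm_one_sub (a := a) hz).symm
  · have ha0 : a ≠ 0 := by rintro rfl; simp at ha; linarith
    have hv := (differentiableOn_one_sub_mul_cpow (b := a⁻¹) (by
      rw [norm_inv]; exact inv_le_one_of_one_le₀ ha)).const_mul ((-a) ^ (1 / 2 : ℂ))
    have key : ∀ z, ((-a) ^ (1 / 2 : ℂ) * (1 - a⁻¹ * z) ^ (1 / 2 : ℂ)) ^ 2 = z - a := fun z => by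
      rw [mul_pow, cpow_half_sq, cpow_half_sq]; field_simp; ring
    refine ⟨Polynomial.X - Polynomial.C a, _, _, hv, hv, fun z _ => ⟨?_, ?_, le_rfl⟩, fun _ _ => rfl⟩
    · rw [← sq, key]; simp
    · rw [key]; simp

theorem hasSqrtFactor (P : Polynomial ℂ) : HasSqrtFactor P := by
  rw [(IsAlgClosed.splits P).eq_prod_roots]
  refine (hasSqrtFactor_C _).mul ?_
  induction P.roots using Multiset.induction_on with
  | empty => simpa using hasSqrtFactor_C 1
  | cons a s ih => simpa using (hasSqrtFactor_X_sub_C a).mul ih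

theorem pMean_two_mul_eq {p : ℝ} {v g : ℂ → ℂ}
    (h : ∀ z ∈ ball (0 : ℂ) 1, (v z) ^ 2 = g z) {r : ℝ} (hr : r ∈ Ioo (0 : ℝ) 1) :
    pMean (2 * p) v r = pMean p g r := by
  refine circleAverage_congr_sphere fun z hz => ?_
  show ‖v z‖ ^ (2 * p) = ‖g z‖ ^ p
  rw [← h z (mem_ball_of_mem_sphere hr hz), norm_pow, Real.rpow_mul (norm_nonneg _)]
  norm_num

/-- A function in the Hardy space is a product of two functions in the space of doubled exponent. -/
theorem exists_factorization {p : ℝ} (hp : 1 ≤ p) {f : ℂ → ℂ}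
    (hf : DifferentiableOn ℂ f (ball 0 1)) {K : ℝ} (hK : ∀ r ∈ Ioo (0 : ℝ) 1, pMean p f r ≤ K) :
    ∃ (x y : ℂ → ℂ) (K' : ℝ), DifferentiableOn ℂ x (ball 0 1) ∧ DifferentiableOn ℂ y (ball 0 1) ∧
      (∀ z ∈ ball (0 : ℂ) 1, f z = x z * y z) ∧
      (∀ r ∈ Ioo (0 : ℝ) 1, pMean (2 * p) x r ≤ K') ∧
      ∀ r ∈ Ioo (0 : ℝ) 1, pMean (2 * p) y r ≤ K' := by
  have hp0 : 0 < p := by linarith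
  have hp2 : 1 ≤ 2 * p := by linarith
  have hK0 : 0 ≤ K := (pMean_nonneg _ _).trans (hK (1 / 2) ⟨by norm_num, by norm_num⟩)
  set s : ℕ → ℝ := fun n => 1 - 1 / ((n : ℝ) + 2) with hs
  have hsm : ∀ n, s n ∈ Ioo (0 : ℝ) 1 := one_sub_mem_Ioo
  have hP : ∀ n : ℕ, ∃ P : Polynomial ℂ, ∀ z ∈ closedBall (0 : ℂ) 1,
      ‖f (s n * z) - P.eval z‖ ≤ 1 / ((n : ℝ) + 1) := fun n =>
    exists_poly_near (one_lt_one_div_of_mem (hsm n)) (differentiableOn_dilate hf (hsm n))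
      (by positivity)
  choose P hP using hP
  set K' : ℝ := (K ^ (1 / p) + 1) ^ p with hK'
  have hPK : ∀ n, pMean p (fun z => (P n).eval z) 1 ≤ K' := fun n => by
    have hd := differentiableOn_dilate' hf (hsm n)
    have hPd : DifferentiableOn ℂ (fun z => (P n).eval z) (ball 0 1) :=
      (P n).differentiable.differentiableOn
    refine le_of_tendsto (pMean_one_eq_of_continuous hp (P n).continuous)
      (Filter.Eventually.of_forall fun m => ?_)
    have hr := one_sub_mem_Ioo m
    refine pMean_le_of_root_le hp ((pMean_add_root' hp hd (hPd.sub hd) (fun z => by simp) hr).trans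
      (add_le_add ?_ ?_))
    · exact Real.rpow_le_rpow (pMean_nonneg _ _)
        ((pMean_dilate_le hp hf (hsm n) hr).trans (hK _ hr)) (by positivity)
    · refine root_le_of_le hp (pMean_nonneg _ _) zero_le_one ?_
      refine pMean_le_of_norm_le hp (fun z hz => ?_) (continuousOn_sphere (hPd.sub hd) hr)
      have := hP n z (ball_subset_closedBall (mem_ball_of_mem_sphere hr hz))
      rw [norm_sub_rev] at this
      refine this.trans ?_
      rw [div_le_one (by positivity)]
      linarith [(Nat.cast_nonneg n : (0 : ℝ) ≤ n)]
  choose g u v hu hv h1 h2 using fun n => hasSqrtFactor (P n)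
  have hvK : ∀ n, ∀ r ∈ Ioo (0 : ℝ) 1, pMean (2 * p) (v n) r ≤ K' := fun n r hr => by
    rw [pMean_two_mul_eq (g := fun z => (g n).eval z) (fun z hz => (h1 n z hz).2.1) hr]
    refine (pMean_le_pMean_one hp (g n).differentiable hr).trans (le_of_eq_of_le ?_ (hPK n))
    refine circleAverage_congr_sphere fun z hz => ?_
    rw [mem_sphere_zero_iff_norm, abs_one] at hz
    simp only [h2 n z hz]
  have huK : ∀ n, ∀ r ∈ Ioo (0 : ℝ) 1, pMean (2 * p) (u n) r ≤ K' := fun n r hr => by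
    refine le_trans (circleAverage_mono (circleIntegrable_pow hp2 (hu n) hr)
      (circleIntegrable_pow hp2 (hv n) hr) fun z hz => ?_) (hvK n r hr)
    exact Real.rpow_le_rpow (norm_nonneg _) (h1 n z (mem_ball_of_mem_sphere hr hz)).2.2
      (by linarith)
  have loc : ∀ w : ℕ → ℂ → ℂ, (∀ n, DifferentiableOn ℂ (w n) (ball 0 1)) →
      (∀ n, ∀ r ∈ Ioo (0 : ℝ) 1, pMean (2 * p) (w n) r ≤ K') →
      ∀ ρ ∈ Ioo (0 : ℝ) 1, ∃ C, ∀ n z, ‖z‖ ≤ ρ → ‖w n z‖ ≤ C := by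
    intro w hw hwK ρ hρ
    refine ⟨(4 / (1 - ρ) * K') ^ (1 / (2 * p)), fun n z hz => ?_⟩
    have hK'0 : 0 ≤ K' := by positivity
    have h4 : 0 ≤ 4 / (1 - ρ) := div_nonneg (by norm_num) (by linarith [hρ.2])
    have := norm_rpow_le_of_pMean_le hp2 (hw n) (hwK n) (hz.trans_lt hρ.2)
    have h5 : 4 / (1 - ‖z‖) * K' ≤ 4 / (1 - ρ) * K' := by
      have : 0 < 1 - ρ := by linarith [hρ.2]
      gcongr
    refine (Real.rpow_le_rpow_iff (norm_nonneg _) (by positivity)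
      (by linarith : 0 < 2 * p)).mp (this.trans (h5.trans_eq ?_))
    rw [← Real.rpow_mul (by positivity), one_div_mul_cancel (by linarith), Real.rpow_one]
  have lim : ∀ (w : ℕ → ℂ → ℂ) (x : ℂ → ℂ), (∀ n, DifferentiableOn ℂ (w n) (ball 0 1)) →
      (∀ n, ∀ r ∈ Ioo (0 : ℝ) 1, pMean (2 * p) (w n) r ≤ K') →
      (∀ z ∈ ball (0 : ℂ) 1, Filter.Tendsto (fun n => w n z) Filter.atTop (nhds (x z))) →
      ∀ r ∈ Ioo (0 : ℝ) 1, pMean (2 * p) x r ≤ K' := by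
    intro w x hw hwK hx r hr
    obtain ⟨C, hC⟩ := loc w hw hwK r hr
    refine le_of_tendsto (tendsto_pMean_of_bound hp2 (C := C)
      (fun n => continuousOn_sphere (hw n) hr) (fun n z hz => hC n z ?_)
      fun z hz => hx z (mem_ball_of_mem_sphere hr hz)) (Filter.Eventually.of_forall fun n => hwK n r hr)
    rw [mem_sphere_zero_iff_norm, abs_of_pos hr.1] at hz
    exact hz.le
  obtain ⟨φ, x, hφ, hx, hxl⟩ := exists_subseq_tendsto hu (loc u hu huK)
  obtain ⟨ψ, y, hψ, hy, hyl⟩ := exists_subseq_tendsto (fun n => hv (φ n))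
    (loc (fun n => v (φ n)) (fun n => hv _) fun n => hvK _)
  refine ⟨x, y, K', hx, hy, fun z hz => ?_, lim _ x (fun n => hu (φ n)) (fun n => huK _) hxl,
    lim _ y (fun n => hv (φ (ψ n))) (fun n => hvK _) hyl⟩
  have l1 : Filter.Tendsto (fun n => (P n).eval z) Filter.atTop (nhds (f z)) := by
    have l2 := tendsto_dilate hf hz
    have l3 : Filter.Tendsto (fun n => f (s n * z) - (P n).eval z) Filter.atTop (nhds 0) :=
      squeeze_zero_norm (fun n => hP n z (ball_subset_closedBall hz))
        tendsto_one_div_add_atTop_nhds_zero_nat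
    have := l2.sub l3
    rw [sub_zero] at this
    exact this.congr fun n => sub_sub_cancel _ _
  have l4 := l1.comp (hφ.comp hψ).tendsto_atTop
  have l5 := ((hxl z hz).comp hψ.tendsto_atTop).mul (hyl z hz)
  refine tendsto_nhds_unique l4 (l5.congr fun n => ?_)
  exact ((h1 (φ (ψ n)) z hz).1).symm

theorem pMean_mul_le {p : ℝ} (hp : 1 ≤ p) {a b : ℂ → ℂ} (ha : DifferentiableOn ℂ a (ball 0 1))
    (hb : DifferentiableOn ℂ b (ball 0 1)) {r : ℝ} (hr : r ∈ Ioo (0 : ℝ) 1) {α β : ℝ} (hα : 0 < α)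
    (hβ : 0 < β) (h1 : pMean (2 * p) a r ≤ α ^ (2 * p)) (h2 : pMean (2 * p) b r ≤ β ^ (2 * p)) :
    pMean p (fun z => a z * b z) r ≤ (α * β) ^ p := by
  have hp2 : 1 ≤ 2 * p := by linarith
  have i1 := circleIntegrable_pow hp2 ha hr
  have i2 := circleIntegrable_pow hp2 hb hr
  have dbl : ∀ x : ℝ, 0 ≤ x → x ^ (2 * p) = (x ^ p) ^ 2 := fun x hx => by
    rw [mul_comm, Real.rpow_mul hx]; norm_num
  set t := (β / α) ^ p with ht
  have ht0 : 0 < t := by positivity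
  have key : pMean p (fun z => a z * b z) r ≤
      circleAverage (fun z => (t / 2) • ‖a z‖ ^ (2 * p) + (t⁻¹ / 2) • ‖b z‖ ^ (2 * p)) 0 r := by
    refine circleAverage_mono (circleIntegrable_pow hp (ha.mul hb) hr)
      ((i1.const_smul).add (i2.const_smul)) fun z _ => ?_
    rw [norm_mul, Real.mul_rpow (norm_nonneg _) (norm_nonneg _), dbl _ (norm_nonneg _),
      dbl _ (norm_nonneg _), smul_eq_mul, smul_eq_mul]
    set A := ‖a z‖ ^ p
    set B := ‖b z‖ ^ p
    have : 0 ≤ t⁻¹ * (t * A - B) ^ 2 := by positivity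
    have e : t⁻¹ * (t * A - B) ^ 2 = t * A ^ 2 - 2 * A * B + t⁻¹ * B ^ 2 := by
      field_simp; ring
    linarith
  have j1 : CircleIntegrable (fun z => (t / 2) • ‖a z‖ ^ (2 * p)) 0 r := i1.const_smul
  have j2 : CircleIntegrable (fun z => (t⁻¹ / 2) • ‖b z‖ ^ (2 * p)) 0 r := i2.const_smul
  rw [circleAverage_fun_add j1 j2, circleAverage_fun_smul, circleAverage_fun_smul] at key
  refine key.trans ?_
  have h3 : (t / 2) • circleAverage (fun z => ‖a z‖ ^ (2 * p)) 0 r ≤ (t / 2) * α ^ (2 * p) :=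
    mul_le_mul_of_nonneg_left h1 (by positivity)
  have h4 : (t⁻¹ / 2) • circleAverage (fun z => ‖b z‖ ^ (2 * p)) 0 r ≤ (t⁻¹ / 2) * β ^ (2 * p) :=
    mul_le_mul_of_nonneg_left h2 (by positivity)
  refine (add_le_add h3 h4).trans_eq ?_
  rw [ht, Real.div_rpow hβ.le hα.le, dbl _ hα.le, dbl _ hβ.le, Real.mul_rpow hα.le hβ.le]
  have : 0 < α ^ p := by positivity
  have : 0 < β ^ p := by positivity
  field_simp
  ring

theorem exists_poly_pMean_near {p : ℝ} (hp : 1 ≤ p) {f : ℂ → ℂ}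
    (hf : DifferentiableOn ℂ f (ball 0 1)) {K : ℝ} (hK : ∀ r ∈ Ioo (0 : ℝ) 1, pMean p f r ≤ K)
    {ε : ℝ} (hε : 0 < ε) :
    ∃ P : Polynomial ℂ, ∀ r ∈ Ioo (0 : ℝ) 1,
      (pMean p (fun z => f z - P.eval z) r) ^ (1 / p) ≤ ε := by
  obtain ⟨x, y, K', hx, hy, hxy, hxK, hyK⟩ := exists_factorization hp hf hK
  have hp2 : 2 ≤ 2 * p := by linarith
  have hp1 : 1 ≤ 2 * p := by linarith
  have hp0 : 0 < 2 * p := by linarith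
  have hK0 : 0 ≤ K' := (pMean_nonneg _ _).trans (hxK (1 / 2) ⟨by norm_num, by norm_num⟩)
  set β := K' ^ (1 / (2 * p)) + 1 with hβ
  have hβ0 : 0 < β := by positivity
  have hyβ : ∀ r ∈ Ioo (0 : ℝ) 1, (pMean (2 * p) y r) ^ (1 / (2 * p)) ≤ β := fun r hr => by
    have := Real.rpow_le_rpow (pMean_nonneg _ _) (hyK r hr) (by positivity : 0 ≤ 1 / (2 * p))
    linarith
  have hxβ : ∀ r ∈ Ioo (0 : ℝ) 1, (pMean (2 * p) x r) ^ (1 / (2 * p)) ≤ K' ^ (1 / (2 * p)) :=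
    fun r hr => Real.rpow_le_rpow (pMean_nonneg _ _) (hxK r hr) (by positivity)
  obtain ⟨δ, hδ⟩ : ∃ δ, δ = min 1 (ε / 2 / β) := ⟨_, rfl⟩
  have hδ0 : 0 < δ := by rw [hδ]; positivity
  have hδ1 : δ ≤ 1 := by rw [hδ]; exact min_le_left _ _
  have hδβ : δ * β ≤ ε / 2 := by
    rw [← le_div_iff₀ hβ0, hδ]; exact min_le_right _ _
  obtain ⟨X, hX⟩ := exists_poly_pMean_near_of_two_le hp2 hx hxK hδ0
  obtain ⟨Y, hY⟩ := exists_poly_pMean_near_of_two_le hp2 hy hyK hδ0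
  have hXd : DifferentiableOn ℂ (fun z => X.eval z) (ball 0 1) := X.differentiable.differentiableOn
  have hYd : DifferentiableOn ℂ (fun z => Y.eval z) (ball 0 1) := Y.differentiable.differentiableOn
  have hXβ : ∀ r ∈ Ioo (0 : ℝ) 1, (pMean (2 * p) (fun z => X.eval z) r) ^ (1 / (2 * p)) ≤ β := by
    intro r hr
    have h1 := pMean_add_root' hp1 hx (hXd.sub hx) (h := fun z => X.eval z) (fun z => by simp) hr
    have h2 := hX r hr
    have h3 : pMean (2 * p) (fun z => X.eval z - x z) r =
        pMean (2 * p) (fun z => x z - X.eval z) r := by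
      simp only [pMean, norm_sub_rev]
    have h4 := hxβ r hr
    change _ ≤ _ + (pMean (2 * p) (fun z => X.eval z - x z) r) ^ (1 / (2 * p)) at h1
    rw [h3] at h1
    linarith
  refine ⟨X * Y, fun r hr => ?_⟩
  have e : pMean p (fun z => f z - (X * Y).eval z) r =
      pMean p (fun z => (x z - X.eval z) * y z + X.eval z * (y z - Y.eval z)) r :=
    pMean_congr (fun z hz => by rw [hxy z hz, Polynomial.eval_mul]; ring) hr
  rw [e]
  refine (pMean_add_root' hp ((hx.sub hXd).mul hy) (hXd.mul (hy.sub hYd)) (fun z => rfl) hr).trans ?_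
  have c1 := pMean_mul_le hp (hx.sub hXd) hy hr hδ0 hβ0 (pMean_le_of_root_le hp1 (hX r hr))
    (pMean_le_of_root_le hp1 (hyβ r hr))
  have c2 := pMean_mul_le hp hXd (hy.sub hYd) hr hβ0 hδ0 (pMean_le_of_root_le hp1 (hXβ r hr))
    (pMean_le_of_root_le hp1 (hY r hr))
  have d1 := root_le_of_le hp (pMean_nonneg _ _) (by positivity) c1
  have d2 := root_le_of_le hp (pMean_nonneg _ _) (by positivity) c2
  refine (add_le_add d1 d2).trans ?_
  linarith [mul_comm δ β]

theorem Hp.denseRange_ofPoly (p : ℝ) [hp : Fact (1 ≤ p)] : DenseRange (Hp.ofPoly p) := by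
  intro f
  rw [Metric.mem_closure_range_iff]
  intro ε hε
  obtain ⟨P, hP⟩ := exists_poly_pMean_near hp.out f.differentiableOn (fun r hr => f.pMean_le hr)
    (half_pos hε)
  refine ⟨P, ?_⟩
  rw [dist_eq_norm]
  refine lt_of_le_of_lt (hpNorm_le hp.out (half_pos hε).le fun r hr => ?_) (half_lt_self hε)
  refine le_of_eq_of_le ?_ (hP r hr)
  congr 1
  exact pMean_congr (fun z hz => by
    show f z - Hp.ofPoly p P z = _
    rw [Hp.ofPoly_apply P hz]) hr

namespace DiscAut

theorem inv_inv (φ : DiscAut) : φ.inv.inv = φ := by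
  have hl := φ.lam_mul_conj
  refine DiscAut.ext ?_ ?_
  · simp [DiscAut.inv]
  · simp only [DiscAut.inv]
    linear_combination φ.a * hl

theorem apply_inv_apply (φ : DiscAut) {z : ℂ} (hz : ‖z‖ < 1) : φ (φ.inv z) = z := by
  have := φ.inv.inv_apply_apply hz
  rwa [inv_inv] at this

theorem norm_deriv (φ : DiscAut) {z : ℂ} (hz : ‖z‖ < 1) :
    ‖deriv φ z‖ = (1 - ‖φ.a‖ ^ 2) / ‖1 - conj φ.a * z‖ ^ 2 := by
  have h := congrArg norm (φ.conj_lam_mul_deriv hz)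
  have ha : 0 ≤ 1 - ‖φ.a‖ ^ 2 := by nlinarith [norm_nonneg φ.a, φ.norm_a]
  rw [norm_mul, Complex.norm_conj, φ.norm_lam, one_mul, norm_mul, norm_pow, norm_inv,
    Complex.norm_real, Real.norm_of_nonneg ha] at h
  rw [h, div_eq_mul_inv, inv_pow]

theorem norm_deriv_of_comp {φ ψ χ : DiscAut} (h : ∀ z : ℂ, ‖z‖ < 1 → χ z = ψ (φ z)) {z : ℂ}
    (hz : ‖z‖ < 1) : ‖deriv χ z‖ = ‖deriv φ z‖ * ‖deriv ψ (φ z)‖ := by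
  have hb : ball (0 : ℂ) 1 ∈ nhds z := isOpen_ball.mem_nhds (mem_ball_zero_iff.mpr hz)
  have hb' : ball (0 : ℂ) 1 ∈ nhds (φ z) :=
    isOpen_ball.mem_nhds (mem_ball_zero_iff.mpr (φ.norm_apply_lt hz))
  have e : χ.toFun =ᶠ[nhds z] ψ.toFun ∘ φ.toFun :=
    Filter.eventuallyEq_of_mem hb fun w hw => h w (mem_ball_zero_iff.mp hw)
  rw [e.deriv_eq, deriv_comp _ (ψ.differentiableOn.differentiableAt hb')
    (φ.differentiableOn.differentiableAt hb), norm_mul, mul_comm]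

end DiscAut

section weight

variable {p : ℝ} [hp : Fact (1 ≤ p)]

theorem weight_apply (φ : DiscAut) (z : ℂ) :
    (weight p φ).toFun z = (conj φ.lam * deriv φ z) ^ ((1 / p : ℝ) : ℂ) := rfl

theorem norm_weight (φ : DiscAut) (z : ℂ) :
    ‖(weight p φ).toFun z‖ = ‖deriv φ z‖ ^ (1 / p) := by
  rw [weight_apply, Complex.norm_cpow_real, norm_mul, Complex.norm_conj, φ.norm_lam, one_mul]

theorem norm_weight_rpow (φ : DiscAut) (z : ℂ) :
    ‖(weight p φ).toFun z‖ ^ p = ‖deriv φ z‖ := by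
  rw [norm_weight, ← Real.rpow_mul (norm_nonneg _), one_div_mul_cancel (Hp.p_pos p).ne',
    Real.rpow_one]

theorem weight_ne_zero (φ : DiscAut) {z : ℂ} (hz : ‖z‖ < 1) : (weight p φ).toFun z ≠ 0 := by
  rw [weight_apply, Complex.cpow_ne_zero_iff]
  exact Or.inl (slitPlane_ne_zero (mem_slitPlane_weight φ hz))

theorem eq_const_of_norm_eq_one {f : ℂ → ℂ} (hf : DifferentiableOn ℂ f (ball 0 1))
    (h : ∀ z ∈ ball (0 : ℂ) 1, ‖f z‖ = 1) : ∀ z ∈ ball (0 : ℂ) 1, f z = f 0 := by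
  intro z hz
  have h0 : (0 : ℂ) ∈ ball (0 : ℂ) 1 := mem_ball_self one_pos
  exact Complex.eqOn_of_isPreconnected_of_isMaxOn_norm (convex_ball _ _).isPreconnected isOpen_ball
    hf h0 (fun w hw => by simp only [Function.comp_apply, mem_ofPred_eq]; rw [h w hw, h 0 h0]) hz

/-- The weights form a cocycle up to a unimodular constant. -/
theorem exists_weight_mul {φ ψ χ : DiscAut} (h : ∀ z : ℂ, ‖z‖ < 1 → χ z = ψ (φ z)) :
    ∃ c : ℂ, ‖c‖ = 1 ∧ ∀ z : ℂ, ‖z‖ < 1 →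
      (weight p φ).toFun z * (weight p ψ).toFun (φ z) = c * (weight p χ).toFun z := by
  set F : ℂ → ℂ := fun z => (weight p φ).toFun z * (weight p ψ).toFun (φ z) / (weight p χ).toFun z
    with hF
  have hd : DifferentiableOn ℂ F (ball 0 1) :=
    ((weight p φ).differentiableOn.mul ((weight p ψ).differentiableOn.comp φ.differentiableOn
      φ.mapsTo)).div (weight p χ).differentiableOn fun z hz =>
        weight_ne_zero χ (mem_ball_zero_iff.mp hz)
  have hn : ∀ z ∈ ball (0 : ℂ) 1, ‖F z‖ = 1 := fun z hz => by
    have hz' := mem_ball_zero_iff.mp hz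
    have h1 := norm_ne_zero_iff.mpr (weight_ne_zero (p := p) χ hz')
    rw [hF, norm_div, norm_mul, div_eq_one_iff_eq h1, norm_weight, norm_weight, norm_weight,
      DiscAut.norm_deriv_of_comp h hz', Real.mul_rpow (norm_nonneg _) (norm_nonneg _)]
  refine ⟨F 0, hn 0 (mem_ball_self one_pos), fun z hz => ?_⟩
  have := eq_const_of_norm_eq_one hd hn z (mem_ball_zero_iff.mpr hz)
  rw [← this, hF]
  exact (div_mul_cancel₀ _ (weight_ne_zero χ hz)).symm

end weight

namespace Hp

variable {p : ℝ} [hp : Fact (1 ≤ p)]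

theorem U_apply' (φ : DiscAut) (f : Hp p) {z : ℂ} (hz : z ∈ ball (0 : ℂ) 1) :
    U p φ f z = (weight p φ).toFun z * f (φ z) := U_apply p φ f hz

theorem exists_U_comp {φ ψ χ : DiscAut} (h : ∀ z : ℂ, ‖z‖ < 1 → χ z = ψ (φ z)) :
    ∃ c : ℂ, ‖c‖ = 1 ∧ U p φ ∘L U p ψ = c • U p χ := by
  obtain ⟨c, hc, h1⟩ := exists_weight_mul (p := p) h
  refine ⟨c, hc, ContinuousLinearMap.ext fun f => ext fun z hz => ?_⟩
  have hz' := mem_ball_zero_iff.mp hz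
  show U p φ (U p ψ f) z = c * U p χ f z
  rw [U_apply' _ _ hz, U_apply' _ _ (φ.mapsTo hz), U_apply' _ _ hz, ← mul_assoc, ← mul_assoc,
    h1 z hz', h z hz']

theorem weight_mul_weight_inv_zero (η : DiscAut) :
    (weight p η).toFun 0 * (weight p η.inv).toFun (η 0) = 1 := by
  have h0 : ‖(0 : ℂ)‖ < 1 := by simp
  have ha : 0 < 1 - ‖η.a‖ ^ 2 := by nlinarith [norm_nonneg η.a, η.norm_a]
  have e0 : η 0 = -(η.lam * η.a) := by simp [DiscAut.apply_def]
  have hn : ‖η.inv.a‖ = ‖η.a‖ := by simp [DiscAut.inv, η.norm_lam]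
  have e1 : 1 - conj η.inv.a * η 0 = ((1 - ‖η.a‖ ^ 2 : ℝ) : ℂ) := by
    rw [e0]
    have : conj η.inv.a * -(η.lam * η.a) = (η.lam * conj η.lam) * (η.a * conj η.a) := by
      simp only [DiscAut.inv, map_neg, map_mul]; ring
    rw [this, η.lam_mul_conj, Complex.mul_conj, Complex.normSq_eq_norm_sq]
    push_cast; ring
  rw [weight_apply, weight_apply, η.conj_lam_mul_deriv h0,
    η.inv.conj_lam_mul_deriv (η.norm_apply_lt h0), e1, hn]
  have e2 : ((1 - ‖η.a‖ ^ 2 : ℝ) : ℂ) * ((1 - conj η.a * 0)⁻¹) ^ 2 = ((1 - ‖η.a‖ ^ 2 : ℝ) : ℂ) := by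
    simp
  have e3 : ((1 - ‖η.a‖ ^ 2 : ℝ) : ℂ) * (((1 - ‖η.a‖ ^ 2 : ℝ) : ℂ)⁻¹) ^ 2 =
      (((1 - ‖η.a‖ ^ 2)⁻¹ : ℝ) : ℂ) := by
    rw [Complex.ofReal_inv]
    have : ((1 - ‖η.a‖ ^ 2 : ℝ) : ℂ) ≠ 0 := Complex.ofReal_ne_zero.mpr ha.ne'
    field_simp
  rw [e2, e3, ← Complex.ofReal_cpow ha.le, ← Complex.ofReal_cpow (by positivity),
    ← Complex.ofReal_mul, ← Real.mul_rpow ha.le (by positivity), mul_inv_cancel₀ ha.ne',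
    Real.one_rpow, Complex.ofReal_one]

theorem U_comp_U_inv (η : DiscAut) : U p η ∘L U p η.inv = 1 := by
  have h : ∀ z : ℂ, ‖z‖ < 1 → DiscAut.id z = η.inv (η z) := fun z hz => by
    rw [η.inv_apply_apply hz, DiscAut.id_apply]
  obtain ⟨c, -, h1⟩ := exists_weight_mul (p := p) h
  have h0 : ‖(0 : ℂ)‖ < 1 := by simp
  have hw : ∀ z : ℂ, ‖z‖ < 1 → (weight p DiscAut.id).toFun z = 1 := fun z hz => by
    rw [weight_apply, DiscAut.conj_lam_mul_deriv _ hz]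
    simp [DiscAut.id]
  have hc : c = 1 := by
    have := h1 0 h0
    rw [weight_mul_weight_inv_zero, hw 0 h0, mul_one] at this
    exact this.symm
  refine ContinuousLinearMap.ext fun f => ext fun z hz => ?_
  have hz' := mem_ball_zero_iff.mp hz
  show U p η (U p η.inv f) z = f z
  rw [U_apply' _ _ hz, U_apply' _ _ (η.mapsTo hz), ← mul_assoc, h1 z hz', hc, hw z hz',
    η.inv_apply_apply hz', one_mul, one_mul]

theorem U_inv_comp_U (η : DiscAut) : U p η.inv ∘L U p η = 1 := by
  have := U_comp_U_inv (p := p) η.inv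
  rwa [DiscAut.inv_inv] at this

open Filter Topology in
theorem pMean_U_le (φ : DiscAut) (f : Hp p) {r : ℝ} (hr : r ∈ Ioo (0 : ℝ) 1) :
    pMean p (U p φ f) r ≤
      (1 + ‖φ ((r ^ 2 : ℝ) * φ.a)‖) / (1 - ‖φ ((r ^ 2 : ℝ) * φ.a)‖) * ‖f‖ ^ p := by
  have hr0 := hr.1
  have ha := φ.norm_a
  have ha0 : 0 < 1 - ‖φ.a‖ ^ 2 := by nlinarith [norm_nonneg φ.a]
  have hsub : closedBall (0 : ℂ) r ⊆ ball 0 1 := closedBall_subset_ball hr.2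
  have hss : sphere (0 : ℂ) |r| ⊆ closedBall 0 r := by
    rw [abs_of_pos hr0]; exact sphere_subset_closedBall
  set w : ℂ := (r ^ 2 : ℝ) * φ.a with hw
  have hwr : ‖w‖ < r := by
    rw [hw, norm_mul, Complex.norm_real, Real.norm_of_nonneg (by positivity)]
    nlinarith [norm_nonneg φ.a, hr.2]
  have hwb : w ∈ ball (0 : ℂ) r := mem_ball_zero_iff.mpr hwr
  obtain ⟨z₀, hz₀, hmax⟩ := (isCompact_closedBall (0 : ℂ) r).exists_isMaxOn
    ⟨0, mem_closedBall_self hr0.le⟩ (φ.differentiableOn.continuousOn.mono hsub).norm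
  have hq1 : ‖φ z₀‖ < 1 := φ.norm_apply_lt (mem_ball_zero_iff.mp (hsub hz₀))
  have hx : ‖φ w‖ < 1 := φ.norm_apply_lt (hwr.trans hr.2)
  have hP : ∀ z ∈ sphere (0 : ℂ) |r|, ‖deriv φ z‖ ≤ poissonKernel 0 w z ∧ 0 ≤ poissonKernel 0 w z := by
    intro z hz
    rw [mem_sphere_zero_iff_norm, abs_of_pos hr0] at hz
    rw [φ.norm_deriv (hz.trans_lt hr.2)]
    have e1 : ‖z - w‖ = r * ‖1 - conj φ.a * z‖ := by
      have h1 : (‖z - w‖) ^ 2 = (r * ‖1 - conj φ.a * z‖) ^ 2 := by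
        have h2 : z.re * z.re + z.im * z.im = r ^ 2 := by
          rw [← hz, ← Complex.normSq_eq_norm_sq, Complex.normSq_apply]
        rw [mul_pow, hw]
        simp only [← Complex.normSq_eq_norm_sq, Complex.normSq_apply, Complex.sub_re,
          Complex.sub_im, Complex.mul_re, Complex.mul_im, Complex.conj_re, Complex.conj_im,
          Complex.one_re, Complex.one_im, Complex.ofReal_re, Complex.ofReal_im]
        linear_combination (1 - r ^ 2 * (φ.a.re ^ 2 + φ.a.im ^ 2)) * h2
      exact (sq_eq_sq₀ (norm_nonneg _) (by positivity)).mp h1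
    have hne : 0 < ‖1 - conj φ.a * z‖ :=
      norm_pos_iff.mpr (DiscAut.one_sub_ne_zero ha (hz.trans_lt hr.2))
    have e2 : ‖w‖ ^ 2 = r ^ 4 * ‖φ.a‖ ^ 2 := by
      rw [hw, norm_mul, Complex.norm_real, Real.norm_of_nonneg (by positivity)]; ring
    have e3 : poissonKernel 0 w z = (1 - r ^ 2 * ‖φ.a‖ ^ 2) / ‖1 - conj φ.a * z‖ ^ 2 := by
      simp only [poissonKernel, sub_zero, hz, e1, e2]
      field_simp
    have h5 : 1 - ‖φ.a‖ ^ 2 ≤ 1 - r ^ 2 * ‖φ.a‖ ^ 2 := by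
      have : r ^ 2 ≤ 1 := by nlinarith [hr.2]
      nlinarith [sq_nonneg ‖φ.a‖]
    rw [e3]
    constructor
    · gcongr
    · exact div_nonneg (by linarith) (by positivity)
  have main : ∀ R ∈ Ioo (0 : ℝ) 1, ‖φ z₀‖ < R →
      pMean p (U p φ f) r ≤ (R + ‖φ w‖) / (R - ‖φ w‖) * ‖f‖ ^ p := by
    intro R hR hqR
    have hball : ∀ z ∈ closedBall (0 : ℂ) r, φ z ∈ ball (0 : ℂ) R := fun z hz => by
      rw [mem_ball_zero_iff]; exact (hmax hz).trans_lt hqR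
    obtain ⟨G, hG, h1, h2⟩ := exists_re_majorant hp.out f.differentiableOn hR
    have hGφ : DifferentiableOn ℂ (fun z => G (φ z)) (closedBall 0 r) :=
      hG.comp (φ.differentiableOn.mono hsub) hball
    have hdc : DiffContOnCl ℂ (fun z => G (φ z)) (ball 0 r) := by
      refine DifferentiableOn.diffContOnCl ?_
      rwa [closure_ball _ hr0.ne']
    have hPc : ContinuousOn (poissonKernel 0 w) (sphere 0 |r|) := by
      rw [poissonKernel_eq_re_herglotzRieszKernel]
      exact Complex.continuous_re.comp_continuousOn (continuousOn_herglotzRieszKernel_sphere hwb)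
    have hGc := hGφ.continuousOn.mono hss
    have ci : CircleIntegrable (poissonKernel 0 w • fun z => G (φ z)) 0 r :=
      ContinuousOn.circleIntegrable' (hPc.smul hGc)
    have hav := Complex.reCLM.circleAverage_comp_comm ci
    rw [hdc.circleAverage_poissonKernel_smul hwb] at hav
    have hφw : φ w ∈ ball (0 : ℂ) R := hball w (ball_subset_closedBall hwb)
    calc pMean p (U p φ f) r
        ≤ circleAverage (Complex.reCLM ∘ (poissonKernel 0 w • fun z => G (φ z))) 0 r := by
          refine circleAverage_mono (circleIntegrable_pow hp.out (U p φ f).differentiableOn hr)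
            (Complex.continuous_re.comp_continuousOn (hPc.smul hGc)).circleIntegrable'
            fun z hz => ?_
          have hzb := hsub (hss hz)
          rw [U_apply' _ _ hzb, norm_mul, Real.mul_rpow (norm_nonneg _) (norm_nonneg _),
            norm_weight_rpow]
          simp only [Function.comp_apply, Pi.smul_apply', Complex.reCLM_apply, Complex.smul_re,
            smul_eq_mul]
          exact mul_le_mul (hP z hz).1 (h1 _ (hball z (hss hz))) (by positivity) (hP z hz).2
      _ = (G (φ w)).re := hav
      _ ≤ _ := (h2 _ hφw).trans (mul_le_mul_of_nonneg_left (f.pMean_le hR) (by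
          rw [mem_ball_zero_iff] at hφw
          exact div_nonneg (by linarith [norm_nonneg (φ w), hR.1]) (by linarith)))
  have hlim : Tendsto (fun n : ℕ => ((1 - 1 / ((n : ℝ) + 2)) + ‖φ w‖) /
      ((1 - 1 / ((n : ℝ) + 2)) - ‖φ w‖) * ‖f‖ ^ p) atTop
      (𝓝 ((1 + ‖φ w‖) / (1 - ‖φ w‖) * ‖f‖ ^ p)) :=
    ((tendsto_one_sub.add_const _).div (tendsto_one_sub.sub_const _)
      (sub_pos.mpr hx).ne').mul_const _
  refine ge_of_tendsto hlim ?_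
  filter_upwards [tendsto_one_sub.eventually (lt_mem_nhds hq1)] with n hn
  exact main _ (one_sub_mem_Ioo n) hn

open Filter Topology in
theorem norm_U_le (φ : DiscAut) (f : Hp p) : ‖U p φ f‖ ≤ ‖f‖ := by
  refine norm_le_of_rpow_le (norm_nonneg _) (norm_rpow_le _ fun r hr => ?_)
  have h1 : Tendsto (fun n : ℕ => (((1 - 1 / ((n : ℝ) + 2)) ^ 2 : ℝ) : ℂ) * φ.a) atTop
      (𝓝 φ.a) := by
    have := ((Complex.continuous_ofReal.tendsto _).comp (tendsto_one_sub.pow 2)).mul_const φ.a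
    simpa [Function.comp_def] using this
  have h2 : Tendsto (fun n : ℕ => ‖φ ((((1 - 1 / ((n : ℝ) + 2)) ^ 2 : ℝ) : ℂ) * φ.a)‖) atTop
      (𝓝 0) := by
    have h3 := ((φ.differentiableOn.continuousOn.continuousAt (isOpen_ball.mem_nhds
      (mem_ball_zero_iff.mpr φ.norm_a))).tendsto.comp h1).norm
    have h4 : φ φ.a = 0 := by simp [DiscAut.apply_def]
    rwa [h4, norm_zero] at h3
  have h5 : Tendsto (fun n : ℕ => (1 + ‖φ ((((1 - 1 / ((n : ℝ) + 2)) ^ 2 : ℝ) : ℂ) * φ.a)‖) /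
      (1 - ‖φ ((((1 - 1 / ((n : ℝ) + 2)) ^ 2 : ℝ) : ℂ) * φ.a)‖) * ‖f‖ ^ p) atTop
      (𝓝 (‖f‖ ^ p)) := by
    have := ((h2.const_add 1).div (h2.const_sub 1) (by norm_num)).mul_const (‖f‖ ^ p)
    simpa using this
  refine ge_of_tendsto h5 ?_
  filter_upwards [tendsto_one_sub.eventually (lt_mem_nhds hr.2)] with n hn
  exact (pMean_mono hp.out (U p φ f).differentiableOn hr.1 hn.le (one_sub_mem_Ioo n).2).trans
    (pMean_U_le φ f (one_sub_mem_Ioo n))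

theorem U_U_inv_apply (η : DiscAut) (f : Hp p) : U p η (U p η.inv f) = f :=
  congrArg (fun T : Hp p →L[ℂ] Hp p => T f) (U_comp_U_inv η)

theorem U_inv_U_apply (η : DiscAut) (f : Hp p) : U p η.inv (U p η f) = f :=
  congrArg (fun T : Hp p →L[ℂ] Hp p => T f) (U_inv_comp_U η)

theorem norm_U (φ : DiscAut) (f : Hp p) : ‖U p φ f‖ = ‖f‖ := by
  refine le_antisymm (norm_U_le φ f) ?_
  conv_lhs => rw [← U_inv_U_apply φ f]
  exact norm_U_le _ _

/-- `U_η` as an isometry of the Hardy space onto itself. -/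
noncomputable def UEquiv (η : DiscAut) : Hp p ≃ₗᵢ[ℂ] Hp p where
  toFun := U p η
  invFun := U p η.inv
  left_inv := U_inv_U_apply η
  right_inv := U_U_inv_apply η
  map_add' := map_add _
  map_smul' := map_smul _
  norm_map' := norm_U η

end Hp

theorem one_sub_sq_norm_div {a z : ℂ} (ha : ‖a‖ < 1) (hz : ‖z‖ < 1) :
    1 - ‖(z - a) / (1 - conj a * z)‖ ^ 2 =
      (1 - ‖a‖ ^ 2) * (1 - ‖z‖ ^ 2) / ‖1 - conj a * z‖ ^ 2 := by
  have h0 : 0 < ‖1 - conj a * z‖ := norm_pos_iff.mpr (DiscAut.one_sub_ne_zero ha hz)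
  have e : ‖1 - conj a * z‖ ^ 2 - ‖z - a‖ ^ 2 = (1 - ‖a‖ ^ 2) * (1 - ‖z‖ ^ 2) := by
    simp only [← Complex.normSq_eq_norm_sq, Complex.normSq_apply, Complex.sub_re, Complex.sub_im,
      Complex.mul_re, Complex.mul_im, Complex.conj_re, Complex.conj_im, Complex.one_re,
      Complex.one_im]
    ring
  rw [norm_div, div_pow, ← e, sub_div, div_self (by positivity)]

theorem norm_sub_div_lt_one {a z : ℂ} (ha : ‖a‖ < 1) (hz : ‖z‖ < 1) :
    ‖(z - a) / (1 - conj a * z)‖ < 1 := by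
  have h0 : 0 < ‖1 - conj a * z‖ := norm_pos_iff.mpr (DiscAut.one_sub_ne_zero ha hz)
  have h1 : 0 < 1 - ‖a‖ ^ 2 := by nlinarith [norm_nonneg a]
  have h2 : 0 < 1 - ‖z‖ ^ 2 := by nlinarith [norm_nonneg z]
  have h := one_sub_sq_norm_div ha hz
  have : 0 < (1 - ‖a‖ ^ 2) * (1 - ‖z‖ ^ 2) / ‖1 - conj a * z‖ ^ 2 := by positivity
  nlinarith [norm_nonneg ((z - a) / (1 - conj a * z))]

theorem one_sub_norm_div_le {a z : ℂ} (ha : ‖a‖ < 1) (hz : ‖z‖ < 1) :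
    1 - ‖(z - a) / (1 - conj a * z)‖ ≤ 1 / (1 - ‖a‖) ^ 2 * (1 - ‖z‖ ^ 2) := by
  have hlt := norm_sub_div_lt_one ha hz
  have h := one_sub_sq_norm_div ha hz
  have ha' : 0 < 1 - ‖a‖ := by linarith
  have h1 : 0 ≤ 1 - ‖a‖ ^ 2 := by nlinarith [norm_nonneg a]
  have h2 : 0 ≤ 1 - ‖z‖ ^ 2 := by nlinarith [norm_nonneg z]
  have h3 : 1 - ‖a‖ ≤ ‖1 - conj a * z‖ := by
    have h4 := norm_sub_norm_le (1 : ℂ) (conj a * z)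
    rw [norm_one, norm_mul, Complex.norm_conj] at h4
    nlinarith [norm_nonneg a, norm_nonneg z]
  have h5 : (1 - ‖a‖ ^ 2) * (1 - ‖z‖ ^ 2) / ‖1 - conj a * z‖ ^ 2 ≤
      1 * (1 - ‖z‖ ^ 2) / (1 - ‖a‖) ^ 2 := by
    gcongr
    nlinarith [sq_nonneg ‖a‖]
  have h6 : 1 / (1 - ‖a‖) ^ 2 * (1 - ‖z‖ ^ 2) = 1 * (1 - ‖z‖ ^ 2) / (1 - ‖a‖) ^ 2 := by ring
  rw [h6]
  nlinarith [norm_nonneg ((z - a) / (1 - conj a * z))]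

theorem one_sub_prod_le {ι : Type*} (s : Finset ι) (x : ι → ℝ) (h : ∀ i ∈ s, 0 ≤ x i ∧ x i ≤ 1) :
    1 - ∏ i ∈ s, x i ≤ ∑ i ∈ s, (1 - x i) := by
  classical
  induction s using Finset.induction_on with
  | empty => simp
  | insert a s ha ih =>
    rw [Finset.prod_insert ha, Finset.sum_insert ha]
    have h1 := h a (Finset.mem_insert_self _ _)
    have h2 := ih fun i hi => h i (Finset.mem_insert_of_mem hi)
    have h3 : ∏ i ∈ s, x i ≤ 1 :=
      Finset.prod_le_one (fun i hi => (h i (Finset.mem_insert_of_mem hi)).1)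
        fun i hi => (h i (Finset.mem_insert_of_mem hi)).2
    nlinarith

namespace HInf.IsBlaschke

variable {d : ℕ} {Ψ : HInf}

theorem norm_le_one (h : Ψ.IsBlaschke d) {z : ℂ} (hz : z ∈ ball (0 : ℂ) 1) : ‖Ψ.toFun z‖ ≤ 1 := by
  obtain ⟨c, a, hc, ha, hΨ⟩ := h
  rw [hΨ z hz, norm_mul, hc, one_mul, norm_prod]
  exact Finset.prod_le_one (fun _ _ => norm_nonneg _) fun i _ =>
    (norm_sub_div_lt_one (ha i) (mem_ball_zero_iff.mp hz)).le

theorem norm_lt_one (h : Ψ.IsBlaschke d) (hd : 1 ≤ d) {z : ℂ} (hz : z ∈ ball (0 : ℂ) 1) :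
    ‖Ψ.toFun z‖ < 1 := by
  obtain ⟨c, a, hc, ha, hΨ⟩ := h
  rw [hΨ z hz, norm_mul, hc, one_mul, norm_prod]
  obtain ⟨n, rfl⟩ : ∃ n, d = n + 1 := ⟨d - 1, by omega⟩
  rw [Fin.prod_univ_succ]
  have hz' := mem_ball_zero_iff.mp hz
  refine (mul_le_of_le_one_right (norm_nonneg _) (Finset.prod_le_one (fun _ _ => norm_nonneg _)
    fun i _ => (norm_sub_div_lt_one (ha _) hz').le)).trans_lt (norm_sub_div_lt_one (ha 0) hz')

theorem exists_one_sub_norm_le (h : Ψ.IsBlaschke d) :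
    ∃ C : ℝ, 0 ≤ C ∧ ∀ z ∈ ball (0 : ℂ) 1, 1 - ‖Ψ.toFun z‖ ≤ C * (1 - ‖z‖ ^ 2) := by
  obtain ⟨c, a, hc, ha, hΨ⟩ := h
  refine ⟨∑ i, 1 / (1 - ‖a i‖) ^ 2, Finset.sum_nonneg fun i _ => by positivity, fun z hz => ?_⟩
  have hz' := mem_ball_zero_iff.mp hz
  rw [hΨ z hz, norm_mul, hc, one_mul, norm_prod, Finset.sum_mul]
  refine (one_sub_prod_le _ _ fun i _ => ⟨norm_nonneg _, (norm_sub_div_lt_one (ha i) hz').le⟩).trans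
    (Finset.sum_le_sum fun i _ => one_sub_norm_div_le (ha i) hz')

theorem finite_zeros (h : Ψ.IsBlaschke d) :
    {z ∈ ball (0 : ℂ) 1 | Ψ.toFun z = 0}.Finite := by
  obtain ⟨c, a, hc, ha, hΨ⟩ := h
  refine (Set.finite_range a).subset fun z hz => ?_
  obtain ⟨hz, h0⟩ := hz
  have hc0 : c ≠ 0 := by rintro rfl; simp at hc
  rw [hΨ z hz, mul_eq_zero, Finset.prod_eq_zero_iff] at h0
  obtain ⟨i, -, hi⟩ := h0.resolve_left hc0
  rw [div_eq_zero_iff] at hi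
  exact ⟨i, (sub_eq_zero.mp (hi.resolve_right
    (DiscAut.one_sub_ne_zero (ha i) (mem_ball_zero_iff.mp hz)))).symm⟩

variable {p : ℝ} [hp : Fact (1 ≤ p)]

open Filter Topology in
theorem norm_mulOp (h : Ψ.IsBlaschke d) (f : Hp p) : ‖Hp.mulOp Ψ f‖ = ‖f‖ := by
  have hp0 := Hp.p_pos p
  refine le_antisymm (Hp.norm_le_of_rpow_le (norm_nonneg _) (Hp.norm_rpow_le _ fun r hr => ?_))
    (Hp.norm_le_of_rpow_le (norm_nonneg _) (Hp.norm_rpow_le _ fun r hr => ?_))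
  · refine le_trans (circleAverage_mono (circleIntegrable_pow hp.out
      (Hp.mulOp Ψ f).differentiableOn hr) (circleIntegrable_pow hp.out f.differentiableOn hr)
      fun z hz => ?_) (f.pMean_le hr)
    refine Real.rpow_le_rpow (norm_nonneg _) ?_ hp0.le
    rw [Hp.mulOp_apply, norm_mul]
    exact mul_le_of_le_one_left (norm_nonneg _) (h.norm_le_one (mem_ball_of_mem_sphere hr hz))
  · obtain ⟨C, hC0, hC⟩ := h.exists_one_sub_norm_le
    have key : ∀ s ∈ Ioo (0 : ℝ) 1, 0 ≤ 1 - C * (1 - s ^ 2) →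
        (1 - C * (1 - s ^ 2)) ^ p * pMean p f s ≤ ‖Hp.mulOp Ψ f‖ ^ p := by
      intro s hs h0
      refine le_trans ?_ ((Hp.mulOp Ψ f).pMean_le hs)
      have e := pMean_smul (p := p) ((1 - C * (1 - s ^ 2) : ℝ) : ℂ) f s
      rw [Complex.norm_real, Real.norm_of_nonneg h0] at e
      rw [← e]
      refine circleAverage_mono (circleIntegrable_pow hp.out (f.differentiableOn.const_smul _) hs)
        (circleIntegrable_pow hp.out (Hp.mulOp Ψ f).differentiableOn hs) fun z hz => ?_
      refine Real.rpow_le_rpow (norm_nonneg _) ?_ hp0.le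
      have hzb := mem_ball_of_mem_sphere hs hz
      rw [mem_sphere_zero_iff_norm, abs_of_pos hs.1] at hz
      have := hC z hzb
      rw [hz] at this
      rw [Hp.mulOp_apply, norm_mul, Pi.smul_apply, norm_smul, Complex.norm_real,
        Real.norm_of_nonneg h0]
      exact mul_le_mul_of_nonneg_right (by linarith) (norm_nonneg _)
    have l1 : Tendsto (fun n : ℕ => 1 - C * (1 - (1 - 1 / ((n : ℝ) + 2)) ^ 2)) atTop (𝓝 1) := by
      have := (((tendsto_one_sub.pow 2).const_sub 1).const_mul C).const_sub 1
      simpa using this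
    have l2 : Tendsto (fun n : ℕ => (1 - C * (1 - (1 - 1 / ((n : ℝ) + 2)) ^ 2)) ^ p * pMean p f r)
        atTop (𝓝 (pMean p f r)) := by
      have := (l1.rpow_const (p := p) (Or.inr hp0.le)).mul_const (pMean p f r)
      simpa using this
    refine le_of_tendsto l2 ?_
    filter_upwards [tendsto_one_sub.eventually (lt_mem_nhds hr.2),
      l1.eventually (lt_mem_nhds one_pos)] with n hn hn'
    exact (mul_le_mul_of_nonneg_left (pMean_mono hp.out f.differentiableOn hr.1 hn.le
      (one_sub_mem_Ioo n).2) (by positivity)).trans (key _ (one_sub_mem_Ioo n) hn'.le)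

end HInf.IsBlaschke

namespace Hp

variable {p : ℝ} [hp : Fact (1 ≤ p)]

theorem U_comp_mulOp (η : DiscAut) (Ψ : HInf) :
    U p η ∘L mulOp Ψ = mulOp (Ψ.comp η) ∘L U p η := by
  refine ContinuousLinearMap.ext fun f => ext fun z hz => ?_
  show U p η (mulOp Ψ f) z = mulOp (Ψ.comp η) (U p η f) z
  rw [U_apply' _ _ hz, mulOp_apply, mulOp_apply, U_apply' _ _ hz]
  show _ = Ψ.toFun (η z) * _
  ring

theorem exists_rho (φ η : DiscAut) : ∃ c : ℂ, ‖c‖ = 1 ∧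
    U p η ∘L U p φ ∘L U p η.inv = c • U p (η.inv.comp (φ.comp η)) := by
  obtain ⟨c₁, h1, e1⟩ := exists_U_comp (p := p) (φ := φ) (ψ := η.inv) (χ := η.inv.comp φ)
    fun z hz => DiscAut.comp_apply _ _ hz
  obtain ⟨c₂, h2, e2⟩ := exists_U_comp (p := p) (φ := η) (ψ := η.inv.comp φ)
    (χ := η.inv.comp (φ.comp η)) fun z hz => by
      rw [DiscAut.comp_apply _ _ hz, DiscAut.comp_apply _ _ hz,
        DiscAut.comp_apply _ _ (η.norm_apply_lt hz)]
  refine ⟨c₁ * c₂, by rw [norm_mul, h1, h2, one_mul], ?_⟩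
  rw [e1, ContinuousLinearMap.comp_smul, e2, smul_smul]

/-- The iterates of `M_Ψ U_φ`. -/
theorem pow_apply (Ψ : HInf) (φ : DiscAut) (n : ℕ) (f : Hp p) {z : ℂ} (hz : z ∈ ball (0 : ℂ) 1) :
    ((mulOp Ψ ∘L U p φ) ^ n) f z =
      (∏ k ∈ Finset.range n, Ψ.toFun (φ.toFun^[k] z)) * ((U p φ) ^ n) f z := by
  induction n generalizing z with
  | zero => simp
  | succ n ih =>
    rw [pow_succ', pow_succ' (U p φ)]
    show mulOp Ψ (U p φ (((mulOp Ψ ∘L U p φ) ^ n) f)) z = _ * (U p φ (((U p φ) ^ n) f)) z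
    rw [mulOp_apply, U_apply' _ _ hz, ih (φ.mapsTo hz), U_apply' _ _ hz,
      Finset.prod_range_succ']
    simp only [Function.iterate_succ_apply, Function.iterate_zero, id_eq]
    ring

theorem norm_U_pow (φ : DiscAut) (n : ℕ) (f : Hp p) : ‖((U p φ) ^ n) f‖ = ‖f‖ := by
  induction n with
  | zero => simp
  | succ n ih => rw [pow_succ', mul_apply_eq_comp, norm_U, ih]

theorem norm_pow_apply {Ψ : HInf} {d : ℕ} (hΨ : Ψ.IsBlaschke d) (φ : DiscAut) (n : ℕ) (f : Hp p) :
    ‖((mulOp Ψ ∘L U p φ) ^ n) f‖ = ‖f‖ := by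
  induction n with
  | zero => simp
  | succ n ih =>
    rw [pow_succ', mul_apply_eq_comp, ContinuousLinearMap.comp_apply, hΨ.norm_mulOp,
      norm_U, ih]

end Hp

namespace DiscAut

theorem mapsTo_iterate (φ : DiscAut) (n : ℕ) : MapsTo φ.toFun^[n] (ball 0 1) (ball 0 1) :=
  φ.mapsTo.iterate n

theorem differentiableOn_iterate (φ : DiscAut) (n : ℕ) :
    DifferentiableOn ℂ φ.toFun^[n] (ball 0 1) := by
  induction n with
  | zero => exact differentiableOn_id
  | succ n ih => rw [Function.iterate_succ]; exact ih.comp φ.differentiableOn φ.mapsTo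

theorem injOn (φ : DiscAut) : InjOn φ.toFun (ball 0 1) := fun z hz w hw h => by
  rw [← φ.inv_apply_apply (mem_ball_zero_iff.mp hz), ← φ.inv_apply_apply (mem_ball_zero_iff.mp hw), h]

/-- An automorphism fixing `z₀` maps each pseudohyperbolic disc around `z₀` into itself. -/
theorem norm_apply_le_of_fixed {φ : DiscAut} {z₀ : ℂ} (h₀ : ‖z₀‖ < 1) (hfix : φ z₀ = z₀) {b : DiscAut}
    (hb : b z₀ = 0) {z : ℂ} (hz : ‖z‖ < 1) : ‖b (φ z)‖ ≤ ‖b z‖ := by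
  have hinv : b.inv 0 = z₀ := by rw [← hb, b.inv_apply_apply h₀]
  have hd : DifferentiableOn ℂ (fun w => b (φ (b.inv w))) (ball 0 1) :=
    b.differentiableOn.comp (φ.differentiableOn.comp b.inv.differentiableOn b.inv.mapsTo)
      (φ.mapsTo.comp b.inv.mapsTo)
  have hm : MapsTo (fun w => b (φ (b.inv w))) (ball 0 1) (closedBall 0 1) := fun w hw =>
    ball_subset_closedBall (b.mapsTo (φ.mapsTo (b.inv.mapsTo hw)))
  have := Complex.norm_le_norm_of_mapsTo_ball hd hm (by rw [hinv, hfix, hb]) (b.norm_apply_lt hz)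
  simpa only [b.inv_apply_apply hz] using this

end DiscAut

namespace Hp

variable {p : ℝ} [hp : Fact (1 ≤ p)]

open Filter Topology in
theorem iInter_range_pow_eq_of_fixed {Ψ : HInf} {d : ℕ} (hd : 1 ≤ d) (hΨ : Ψ.IsBlaschke d)
    {φ : DiscAut} {z₀ : ℂ} (h₀ : ‖z₀‖ < 1) (hfix : φ z₀ = z₀) :
    (⋂ n : ℕ, Set.range ((mulOp (p := p) Ψ ∘L U p φ) ^ n)) = {0} := by
  refine Set.eq_singleton_iff_unique_mem.mpr ⟨Set.mem_iInter.mpr fun n => ⟨0, map_zero _⟩, ?_⟩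
  intro f hf
  rw [Set.mem_iInter] at hf
  refine ext fun z hz => ?_
  rw [zero_apply]
  have hz' := mem_ball_zero_iff.mp hz
  set b : DiscAut := ⟨1, z₀, by simp, h₀⟩ with hbdef
  have hb : b z₀ = 0 := by simp [DiscAut.apply_def, hbdef]
  have hbz := b.norm_apply_lt hz'
  have hK : ∀ k, φ.toFun^[k] z ∈ b.inv.toFun '' closedBall 0 ‖b z‖ := by
    have hk : ∀ k, ‖b (φ.toFun^[k] z)‖ ≤ ‖b z‖ := by
      intro k
      induction k with
      | zero => exact le_rfl
      | succ k ih =>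
        rw [Function.iterate_succ_apply']
        exact (DiscAut.norm_apply_le_of_fixed h₀ hfix hb
          (mem_ball_zero_iff.mp (φ.mapsTo_iterate k hz))).trans ih
    exact fun k => ⟨b (φ.toFun^[k] z), mem_closedBall_zero_iff.mpr (hk k),
      b.inv_apply_apply (mem_ball_zero_iff.mp (φ.mapsTo_iterate k hz))⟩
  have hsub : closedBall (0 : ℂ) ‖b z‖ ⊆ ball 0 1 := closedBall_subset_ball hbz
  have hKsub : b.inv.toFun '' closedBall 0 ‖b z‖ ⊆ ball 0 1 := by
    rintro _ ⟨w, hw, rfl⟩; exact b.inv.mapsTo (hsub hw)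
  have hcomp : IsCompact (b.inv.toFun '' closedBall 0 ‖b z‖) :=
    (isCompact_closedBall _ _).image_of_continuousOn (b.inv.differentiableOn.continuousOn.mono hsub)
  obtain ⟨w, hw, hmax⟩ := hcomp.exists_isMaxOn ⟨_, hK 0⟩
    (Ψ.differentiableOn.continuousOn.mono hKsub).norm
  have hq := hΨ.norm_lt_one hd (hKsub hw)
  have hbound : ∀ n : ℕ, ‖f z‖ ≤ ‖Ψ.toFun w‖ ^ n * ((4 / (1 - ‖z‖)) ^ (1 / p) * ‖f‖) := by
    intro n
    obtain ⟨g, hg⟩ := hf n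
    have hn : ‖((U p φ) ^ n) g‖ = ‖f‖ := by
      rw [norm_U_pow, ← norm_pow_apply hΨ φ n g, hg]
    have h1 := pow_apply Ψ φ n g hz
    rw [hg] at h1
    rw [h1, norm_mul, norm_prod, ← hn]
    refine mul_le_mul ?_ (norm_apply_le _ hz') (norm_nonneg _) (by positivity)
    refine (Finset.prod_le_prod (fun _ _ => norm_nonneg _) fun k _ => hmax (hK k)).trans_eq ?_
    rw [Finset.prod_const, Finset.card_range]
  have hlim := (tendsto_pow_atTop_nhds_zero_of_lt_one (norm_nonneg _) hq).mul_const
    ((4 / (1 - ‖z‖)) ^ (1 / p) * ‖f‖)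
  rw [zero_mul] at hlim
  exact norm_le_zero_iff.mp (ge_of_tendsto' hlim hbound)

end Hp

namespace DiscAut

/-- Coefficients of a matrix of determinant one representing the automorphism. -/
theorem exists_matrix (φ : DiscAut) : ∃ α β : ℂ, ‖α‖ ^ 2 - ‖β‖ ^ 2 = 1 ∧
    ∀ z : ℂ, ‖z‖ < 1 → φ z * (conj β * z + conj α) = α * z + β := by
  have ha : 0 < 1 - ‖φ.a‖ ^ 2 := by nlinarith [norm_nonneg φ.a, φ.norm_a]
  set N : ℝ := √(1 - ‖φ.a‖ ^ 2) with hN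
  have hN0 : 0 < N := Real.sqrt_pos.mpr ha
  have hN2 : N ^ 2 = 1 - ‖φ.a‖ ^ 2 := Real.sq_sqrt ha.le
  set s : ℂ := φ.lam ^ (1 / 2 : ℂ) with hs
  have hs2 : s ^ 2 = φ.lam := cpow_half_sq _
  have hsn : ‖s‖ = 1 := by
    have := congrArg norm hs2
    rw [norm_pow, φ.norm_lam] at this
    nlinarith [norm_nonneg s]
  have hsc : s * conj s = 1 := by
    rw [Complex.mul_conj, Complex.normSq_eq_norm_sq, hsn]; simp
  refine ⟨s / N, -(s * φ.a) / N, ?_, fun z hz => ?_⟩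
  · rw [norm_div, norm_div, norm_neg, norm_mul, hsn, Complex.norm_real, Real.norm_of_nonneg hN0.le]
    field_simp
    rw [hN2]
  · have h0 := one_sub_ne_zero φ.norm_a hz
    have hNc : (N : ℂ) ≠ 0 := Complex.ofReal_ne_zero.mpr hN0.ne'
    have hw : φ z * (1 - conj φ.a * z) = s ^ 2 * (z - φ.a) := by
      rw [hs2]; exact div_mul_cancel₀ _ h0
    have e : conj (-(s * φ.a) / N) * z + conj (s / N) = conj s * (1 - conj φ.a * z) / N := by
      simp only [map_div₀, map_neg, map_mul, Complex.conj_ofReal]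
      ring
    rw [e]
    calc φ z * (conj s * (1 - conj φ.a * z) / N) = φ z * (1 - conj φ.a * z) * conj s / N := by ring
      _ = s * conj s * (s * (z - φ.a)) / N := by rw [hw]; ring
      _ = _ := by rw [hsc]; ring

theorem one_le_abs_re_of_no_fixed {φ : DiscAut} {α β : ℂ} (hdet : ‖α‖ ^ 2 - ‖β‖ ^ 2 = 1)
    (hφ : ∀ z : ℂ, ‖z‖ < 1 → φ z * (conj β * z + conj α) = α * z + β)
    (hno : ∀ z : ℂ, ‖z‖ < 1 → φ z ≠ z) : 1 ≤ |α.re| := by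
  by_contra hlt
  rw [not_le] at hlt
  have hx : α.re ^ 2 < 1 := by
    rw [← sq_abs]; nlinarith [abs_nonneg α.re]
  have hα : ‖α‖ ^ 2 = α.re ^ 2 + α.im ^ 2 := by
    rw [← Complex.normSq_eq_norm_sq, Complex.normSq_apply]; ring
  obtain ⟨w, hw2, hwy⟩ : ∃ w : ℝ, w ^ 2 = 1 - α.re ^ 2 ∧ 0 < α.im * w := by
    have h1 : 0 < √(1 - α.re ^ 2) := Real.sqrt_pos.mpr (by linarith)
    have h2 : √(1 - α.re ^ 2) ^ 2 = 1 - α.re ^ 2 := Real.sq_sqrt (by linarith)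
    rcases lt_trichotomy α.im 0 with h | h | h
    · exact ⟨-√(1 - α.re ^ 2), by rw [neg_sq, h2], by nlinarith⟩
    · rw [h] at hα; nlinarith [sq_nonneg ‖β‖]
    · exact ⟨_, h2, by positivity⟩
  set S : ℝ := α.im + w with hS
  have hβ2 : ‖β‖ ^ 2 = (α.im - w) * S := by rw [hS]; nlinarith
  have hS0 : S ≠ 0 := by
    intro h
    have : α.im = -w := by linarith
    rw [this] at hwy
    nlinarith [sq_nonneg w]
  have hSβ : ‖β‖ ^ 2 < S ^ 2 := by
    rw [hβ2, hS]; nlinarith [sq_nonneg w]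
  have hz : ‖Complex.I * β / (S : ℂ)‖ < 1 := by
    rw [norm_div, norm_mul, Complex.norm_I, one_mul, Complex.norm_real, Real.norm_eq_abs,
      div_lt_one (abs_pos.mpr hS0)]
    exact lt_of_pow_lt_pow_left₀ 2 (abs_nonneg _) (by rwa [sq_abs])
  set z : ℂ := Complex.I * β / (S : ℂ) with hzdef
  refine hno z hz ?_
  have hβc : β * conj β = (((α.im - w) * S : ℝ) : ℂ) := by
    rw [Complex.mul_conj, Complex.normSq_eq_norm_sq, hβ2]
  have hαc : α - conj α = 2 * Complex.I * α.im := by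
    apply Complex.ext <;> simp; ring
  have hSc : (S : ℂ) ≠ 0 := Complex.ofReal_ne_zero.mpr hS0
  have hzS : z * S = Complex.I * β := div_mul_cancel₀ _ hSc
  have hfix : z * (conj β * z + conj α) = α * z + β := by
    have e : z * conj β * z - (α - conj α) * z - β = 0 := by
      have h1 : (z * conj β * z - (α - conj α) * z - β) * S = 0 := by
        have h2 : z * conj β * z * S = z * (Complex.I * (((α.im - w) * S : ℝ) : ℂ)) := by
          rw [← hβc]; linear_combination z * conj β * hzS
        have h3 : z * conj β * z * S = Complex.I * (Complex.I * β) * ((α.im - w : ℝ) : ℂ) := by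
          rw [h2, ← hzS]; push_cast; ring
        have hSe : (S : ℂ) = α.im + w := by rw [hS]; push_cast; ring
        rw [hαc, sub_mul, sub_mul, h3, mul_assoc _ z, hzS, hSe]
        push_cast
        linear_combination (-(β * ((α.im : ℂ) + w))) * Complex.I_sq
      exact (mul_eq_zero.mp h1).resolve_right hSc
    linear_combination e
  have hden : conj β * z + conj α ≠ 0 := by
    intro h
    rw [h, mul_zero] at hfix
    have h1 : ‖conj β * z‖ = ‖conj α‖ := by rw [eq_neg_of_add_eq_zero_left h, norm_neg]
    rw [norm_mul, Complex.norm_conj, Complex.norm_conj] at h1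
    have h2 : ‖β‖ < ‖α‖ := by nlinarith [norm_nonneg β, norm_nonneg α]
    nlinarith [norm_nonneg β, norm_nonneg z]
  exact mul_right_cancel₀ hden ((hφ z hz).trans hfix.symm)

/-- Without fixed points the orbits tend to the circle at a summable rate. -/
theorem exists_one_sub_norm_iterate_le {φ : DiscAut} (hno : ∀ z : ℂ, ‖z‖ < 1 → φ z ≠ z) {z : ℂ}
    (hz : ‖z‖ < 1) :
    ∃ C : ℝ, 0 ≤ C ∧ ∀ k : ℕ, 1 - ‖φ.toFun^[k + 1] z‖ ^ 2 ≤ C * (1 / ((k : ℝ) + 1) ^ 2) := by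
  obtain ⟨α, β, hdet, hφ⟩ := φ.exists_matrix
  have hre := one_le_abs_re_of_no_fixed hdet hφ hno
  have hβ0 : 0 < ‖β‖ := by
    rw [norm_pos_iff]
    rintro rfl
    refine hno 0 (by simp) ?_
    have h := hφ 0 (by simp)
    have hα : conj α ≠ 0 := by
      rw [map_ne_zero]; rintro rfl; simp at hdet
    simpa [hα] using h
  set t : ℝ := 2 * α.re with ht
  have ht2 : 2 ≤ |t| := by rw [ht, abs_mul, abs_two]; linarith
  have htc : (t : ℂ) = α + conj α := by
    rw [Complex.add_conj, ht]; 
  have hdetc : α * conj α - β * conj β = 1 := by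
    rw [Complex.mul_conj, Complex.mul_conj, Complex.normSq_eq_norm_sq, Complex.normSq_eq_norm_sq,
      ← Complex.ofReal_sub, hdet, Complex.ofReal_one]
  have key : ∀ k : ℕ, ∃ x y : ℝ, x ^ 2 - t * x * y + y ^ 2 = 1 ∧ (k : ℝ) + 1 ≤ |x| ∧
      |y| + 1 ≤ |x| ∧
      φ.toFun^[k + 1] z * (conj β * x * z + (conj α * x - y)) = (α * x - y) * z + β * x := by
    intro k
    induction k with
    | zero =>
      refine ⟨1, 0, by ring, by simp, by simp, ?_⟩
      simpa using hφ z hz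
    | succ k ih =>
      obtain ⟨x, y, h1, h2, h3, h4⟩ := ih
      have h5 : |x| + 1 ≤ |t * x - y| := by
        have h6 := abs_sub_abs_le_abs_sub (t * x) y
        rw [abs_mul] at h6
        nlinarith [abs_nonneg x]
      refine ⟨t * x - y, x, by linarith, by push_cast; linarith, h5, ?_⟩
      rw [Function.iterate_succ_apply']
      have hw := hφ (φ.toFun^[k + 1] z)
        (mem_ball_zero_iff.mp (φ.mapsTo_iterate (k + 1) (mem_ball_zero_iff.mpr hz)))
      set w := φ.toFun^[k + 1] z
      push_cast
      rw [htc]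
      linear_combination (conj β * x * z + (conj α * x - y)) * hw + (α - φ w * conj β) * h4 +
        (x : ℂ) * (φ w - z) * hdetc
  set m : ℝ := ‖β‖ * (1 - ‖z‖) with hm
  have hm0 : 0 < m := mul_pos hβ0 (by linarith)
  have hz2 : 0 ≤ 1 - ‖z‖ ^ 2 := by nlinarith [norm_nonneg z]
  refine ⟨(1 - ‖z‖ ^ 2) / m ^ 2, by positivity, fun k => ?_⟩
  obtain ⟨x, y, h1, h2, -, h4⟩ := key k
  set w := φ.toFun^[k + 1] z
  set D := conj β * x * z + (conj α * x - y) with hD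
  have hα2 := Complex.normSq_eq_norm_sq α
  have hβ2 := Complex.normSq_eq_norm_sq β
  rw [Complex.normSq_apply] at hα2 hβ2
  have hu : ‖conj α * x - y‖ ^ 2 = ‖β‖ ^ 2 * x ^ 2 + 1 := by
    rw [← Complex.normSq_eq_norm_sq, Complex.normSq_apply]
    simp
    rw [ht] at h1
    linear_combination x ^ 2 * hα2 + x ^ 2 * hdet + h1
  have hDw : ‖D‖ ^ 2 - ‖(α * x - y) * z + β * x‖ ^ 2 = 1 - ‖z‖ ^ 2 := by
    have h7 : ‖D‖ ^ 2 - ‖(α * x - y) * z + β * x‖ ^ 2 =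
        (‖conj α * x - y‖ ^ 2 - ‖β‖ ^ 2 * x ^ 2) * (1 - ‖z‖ ^ 2) := by
      rw [hD]
      simp only [← Complex.normSq_eq_norm_sq, Complex.normSq_apply, Complex.add_re, Complex.add_im,
        Complex.sub_re, Complex.sub_im, Complex.mul_re, Complex.mul_im, Complex.conj_re,
        Complex.conj_im, Complex.ofReal_re, Complex.ofReal_im]
      ring
    rw [h7, hu]; ring
  have hDm : m * (k + 1) ≤ ‖D‖ := by
    have h8 : ‖β‖ * |x| ≤ ‖conj α * x - y‖ := by
      refine le_of_sq_le_sq ?_ (norm_nonneg _)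
      rw [hu, mul_pow, sq_abs]; linarith
    have h9 := norm_sub_le_norm_add (conj α * x - y) (conj β * x * z)
    rw [norm_mul, norm_mul, Complex.norm_conj, Complex.norm_real, Real.norm_eq_abs,
      add_comm] at h9
    calc m * (k + 1) ≤ m * |x| := mul_le_mul_of_nonneg_left h2 hm0.le
      _ = ‖β‖ * |x| - ‖β‖ * |x| * ‖z‖ := by rw [hm]; ring
      _ ≤ _ := by linarith
  have hk : (0 : ℝ) < (k : ℝ) + 1 := by positivity
  have hD0 : 0 < ‖D‖ := lt_of_lt_of_le (by positivity) hDm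
  rw [← h4, norm_mul, mul_pow] at hDw
  have h10 : (1 - ‖w‖ ^ 2) = (1 - ‖z‖ ^ 2) / ‖D‖ ^ 2 := by
    rw [eq_div_iff (by positivity)]; linarith
  rw [h10, div_mul_div_comm, mul_one, ← mul_pow]
  gcongr

end DiscAut

namespace Hp

variable {p : ℝ} [hp : Fact (1 ≤ p)]

theorem exists_forall_iterate_ne_zero {Ψ : HInf} {d : ℕ} (hΨ : Ψ.IsBlaschke d) (φ : DiscAut) :
    ∃ z ∈ ball (0 : ℂ) 1, ∀ k, Ψ.toFun (φ.toFun^[k] z) ≠ 0 := by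
  by_contra! hcon
  have hc : ∀ k, {z ∈ ball (0 : ℂ) 1 | Ψ.toFun (φ.toFun^[k] z) = 0}.Countable := fun k => by
    refine MapsTo.countable_of_injOn (f := φ.toFun^[k]) (t := {z ∈ ball (0 : ℂ) 1 | Ψ.toFun z = 0})
      (fun z hz => ⟨φ.mapsTo_iterate k hz.1, hz.2⟩) ?_ hΨ.finite_zeros.countable
    exact (φ.injOn.iterate φ.mapsTo k).mono fun z hz => hz.1
  have h1 : (ball (0 : ℂ) 1).Countable := by
    refine (Set.countable_iUnion hc).mono fun z hz => ?_
    obtain ⟨k, hk⟩ := hcon z hz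
    exact mem_iUnion.mpr ⟨k, hz, hk⟩
  exact (measure_ball_pos volume (0 : ℂ) one_pos).ne' (h1.measure_zero volume)

theorem exists_le_prod_norm {a : ℕ → ℝ} (ha0 : ∀ k, 0 < a k) (ha1 : ∀ k, a k ≤ 1)
    (hs : Summable fun k => 1 - a k) :
    ∃ δ > 0, ∀ n, δ ≤ ∏ k ∈ Finset.range n, a k := by
  have ht := _root_.tendsto_sum_nat_add fun k => 1 - a k
  obtain ⟨N, hN⟩ := (ht.eventually (gt_mem_nhds (by norm_num : (0 : ℝ) < 1 / 2))).exists
  have hN0 : 0 < ∏ k ∈ Finset.range N, a k := Finset.prod_pos fun k _ => ha0 k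
  have key : ∀ n, (∏ k ∈ Finset.range N, a k) * (1 / 2) ≤ ∏ k ∈ Finset.range (N + n), a k := by
    intro n
    rw [Finset.prod_range_add]
    refine mul_le_mul_of_nonneg_left ?_ hN0.le
    have h1 := one_sub_prod_le (Finset.range n) (fun k => a (N + k)) fun k _ => ⟨(ha0 _).le, ha1 _⟩
    have h2 : ∑ k ∈ Finset.range n, (1 - a (N + k)) ≤ ∑' k, (1 - a (k + N)) := by
      simp_rw [add_comm N]
      exact ((summable_nat_add_iff N).mpr hs).sum_le_tsum _ fun k _ => by linarith [ha1 (k + N)]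
    linarith
  refine ⟨_, by positivity, fun n => (key n).trans ?_⟩
  rw [add_comm, Finset.prod_range_add]
  exact mul_le_of_le_one_right (Finset.prod_nonneg fun k _ => (ha0 k).le)
    (Finset.prod_le_one (fun k _ => (ha0 _).le) fun k _ => ha1 _)

open Filter Topology in
theorem iInter_range_pow_ne_of_no_fixed {Ψ : HInf} {d : ℕ} (hΨ : Ψ.IsBlaschke d)
    {φ : DiscAut} (hno : ∀ z : ℂ, ‖z‖ < 1 → φ z ≠ z) :
    (⋂ n : ℕ, Set.range ((mulOp (p := p) Ψ ∘L U p φ) ^ n)) ≠ {0} := by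
  obtain ⟨z₁, hz₁, hne⟩ := exists_forall_iterate_ne_zero hΨ φ
  obtain ⟨C, hC0, hC⟩ := hΨ.exists_one_sub_norm_le
  obtain ⟨C', hC0', hC'⟩ := φ.exists_one_sub_norm_iterate_le hno (mem_ball_zero_iff.mp hz₁)
  have hsum : Summable fun k => 1 - ‖Ψ.toFun (φ.toFun^[k] z₁)‖ := by
    rw [← summable_nat_add_iff 1]
    have h1 : Summable fun k : ℕ => C * (C' * (1 / ((k : ℝ) + 1) ^ 2)) := by
      have := (summable_nat_add_iff 1).mpr (Real.summable_one_div_nat_pow.mpr one_lt_two)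
      push_cast at this
      exact (this.mul_left _).mul_left _
    refine h1.of_nonneg_of_le (fun k => ?_) fun k => ?_
    · linarith [hΨ.norm_le_one (φ.mapsTo_iterate (k + 1) hz₁)]
    · exact (hC _ (φ.mapsTo_iterate (k + 1) hz₁)).trans (mul_le_mul_of_nonneg_left (hC' k) hC0)
  obtain ⟨δ, hδ, hprod⟩ := exists_le_prod_norm (fun k => norm_pos_iff.mpr (hne k))
    (fun k => hΨ.norm_le_one (φ.mapsTo_iterate k hz₁)) hsum
  set P : ℕ → ℂ → ℂ := fun n z => ∏ k ∈ Finset.range n, Ψ.toFun (φ.toFun^[k] z) with hP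
  have hPd : ∀ n, DifferentiableOn ℂ (P n) (ball 0 1) := fun n =>
    DifferentiableOn.fun_finsetProd fun k _ =>
      Ψ.differentiableOn.comp (φ.differentiableOn_iterate k) (φ.mapsTo_iterate k)
  have hP1 : ∀ n, ∀ z ∈ ball (0 : ℂ) 1, ‖P n z‖ ≤ 1 := fun n z hz => by
    rw [hP, norm_prod]
    exact Finset.prod_le_one (fun _ _ => norm_nonneg _) fun k _ =>
      hΨ.norm_le_one (φ.mapsTo_iterate k hz)
  have montel : ∀ σ : ℕ → ℕ, ∃ (τ : ℕ → ℕ) (g : ℂ → ℂ), StrictMono τ ∧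
      DifferentiableOn ℂ g (ball 0 1) ∧
      ∀ z ∈ ball (0 : ℂ) 1, Tendsto (fun n => P (σ (τ n)) z) atTop (𝓝 (g z)) := fun σ =>
    exists_subseq_tendsto (f := fun n => P (σ n)) (fun n => hPd _) fun ρ hρ =>
      ⟨1, fun n z hz => hP1 _ z (mem_ball_zero_iff.mpr (hz.trans_lt hρ.2))⟩
  have hle : ∀ {σ : ℕ → ℕ} {g : ℂ → ℂ},
      (∀ z ∈ ball (0 : ℂ) 1, Tendsto (fun n => P (σ n) z) atTop (𝓝 (g z))) →
      ∀ z ∈ ball (0 : ℂ) 1, ‖g z‖ ≤ 1 := fun h z hz =>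
    le_of_tendsto' (h z hz).norm fun n => hP1 _ z hz
  obtain ⟨σ, g, hσ, hgd, hg⟩ := montel id
  have hg1 := hle hg
  set f : Hp p := ofFun g hgd ⟨_, fun r hr => (exists_pMean_le_of_bound hgd hg1 hr)⟩ with hf
  have hfne : f ≠ 0 := by
    intro h0
    have h1 : δ ≤ ‖g z₁‖ := ge_of_tendsto' (hg z₁ hz₁).norm fun n => by
      rw [hP, norm_prod]; exact hprod _
    have h2 : f z₁ = g z₁ := ofFun_apply _ _ hz₁
    rw [h0, zero_apply] at h2
    rw [← h2, norm_zero] at h1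
    exact absurd h1 (not_le.mpr hδ)
  intro heq
  refine hfne ?_
  rw [← Set.mem_singleton_iff, ← heq, Set.mem_iInter]
  intro n
  obtain ⟨τ, h, hτ, hhd, hh⟩ := montel fun j => σ j - n
  have hh1 := hle hh
  have hd' : DifferentiableOn ℂ (fun z => h (φ.toFun^[n] z)) (ball 0 1) :=
    hhd.comp (φ.differentiableOn_iterate n) (φ.mapsTo_iterate n)
  set G : Hp p := ofFun _ hd' ⟨_, fun r hr => exists_pMean_le_of_bound hd'
    (fun z hz => hh1 _ (φ.mapsTo_iterate n hz)) hr⟩ with hG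
  refine ⟨((U p φ.inv) ^ n) G, ext fun z hz => ?_⟩
  have h1 : ((U p φ) ^ n) (((U p φ.inv) ^ n) G) = G := by
    have := pow_mul_pow_eq_one n (show U p φ * U p φ.inv = 1 from U_comp_U_inv φ)
    exact congrArg (fun T : Hp p →L[ℂ] Hp p => T G) this
  rw [pow_apply _ _ _ _ hz, h1, hG, ofFun_apply _ _ hz, hf, ofFun_apply _ _ hz]
  have l1 : Tendsto (fun j => P n z * P (σ (τ j) - n) (φ.toFun^[n] z)) atTop
      (𝓝 (P n z * h (φ.toFun^[n] z))) :=
    (hh _ (φ.mapsTo_iterate n hz)).const_mul _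
  refine tendsto_nhds_unique l1 (((hg z hz).comp hτ.tendsto_atTop).congr' ?_)
  filter_upwards [(hσ.comp hτ).tendsto_atTop.eventually_ge_atTop n] with j hj
  have hj' : σ (τ j) = n + (σ (τ j) - n) := (Nat.add_sub_cancel' hj).symm
  show P (σ (τ j)) z = _
  rw [hP]
  conv_lhs => rw [hj']
  simp only [Finset.prod_range_add]
  congr 1
  refine Finset.prod_congr rfl fun k _ => ?_
  rw [add_comm, Function.iterate_add_apply]

/-- The isometry `M_Ψ U_φ` is pure exactly when `φ` is elliptic or the identity. -/
theorem iInter_range_pow_eq_iff {Ψ : HInf} {d : ℕ} (hd : 1 ≤ d) (hΨ : Ψ.IsBlaschke d)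
    (φ : DiscAut) : (⋂ n : ℕ, Set.range ((mulOp (p := p) Ψ ∘L U p φ) ^ n)) = {0} ↔
      φ = DiscAut.id ∨ φ.IsElliptic := by
  constructor
  · intro h
    by_contra hcon
    rw [not_or] at hcon
    refine iInter_range_pow_ne_of_no_fixed hΨ (φ := φ) (fun z hz hfix => ?_) h
    exact hcon.2 ⟨hcon.1, z, hz, hfix⟩
  · rintro (rfl | ⟨-, z, hz, hfix⟩)
    · exact iInter_range_pow_eq_of_fixed hd hΨ (z₀ := 0) (by simp) (DiscAut.id_apply 0)
    · exact iInter_range_pow_eq_of_fixed hd hΨ hz hfix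

end Hp

/-! ### Uniqueness for Riesz type potentials of finite measures on the plane -/

namespace RieszPotential

variable {q : ℝ}

/-- The Lévy kernel integral `∫ (1 - cos ⟪x, ξ⟫) |ξ| ^ (-2 - q) dξ`. -/
noncomputable def levy (q : ℝ) (x : ℂ) : ENNReal :=
  ∫⁻ ξ : ℂ, ENNReal.ofReal ((1 - Real.cos (inner ℝ x ξ)) * ‖ξ‖ ^ (-2 - q))

theorem det_mulLeft (c : ℂ) : LinearMap.det (LinearMap.mulLeft ℝ c) = ‖c‖ ^ 2 := by
  have h := Algebra.norm_apply ℝ c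
  rw [Algebra.norm_complex_apply] at h
  rw [← Complex.normSq_eq_norm_sq, Complex.normSq_apply]
  have h2 : LinearMap.det (LinearMap.mulLeft ℝ c) = LinearMap.det (Algebra.lmul ℝ ℂ c) := rfl
  rw [h2, ← h]; simp [Complex.normSq_apply]

theorem levy_eq (hq : 0 < q) (x : ℂ) : levy q x = levy q 1 * ENNReal.ofReal (‖x‖ ^ q) := by
  by_cases hx : x = 0
  · simp [levy, hx, Real.zero_rpow hq.ne']
  have hx0 : 0 < ‖x‖ := norm_pos_iff.mpr hx
  set T : ℂ →ₗ[ℝ] ℂ := LinearMap.mulLeft ℝ (conj x) with hT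
  have hdet : LinearMap.det T = ‖x‖ ^ 2 := by rw [hT, det_mulLeft, Complex.norm_conj]
  have hmap := Measure.map_linearMap_addHaar_eq_smul_addHaar (volume : Measure ℂ) (f := T)
    (by rw [hdet]; positivity)
  set h : ℂ → ENNReal := fun ξ =>
    ENNReal.ofReal ((1 - Real.cos (inner ℝ 1 ξ)) * ‖ξ‖ ^ (-2 - q)) with hh
  have hm : Measurable h := by fun_prop
  have hTm : Measurable T := (LinearMap.continuous_of_finiteDimensional T).measurable
  have e1 : ∫⁻ ξ, h (T ξ) = ENNReal.ofReal ((‖x‖ ^ 2)⁻¹) * levy q 1 := by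
    rw [← lintegral_map hm hTm, hmap, lintegral_smul_measure, hdet, abs_of_pos (by positivity)]
    rfl
  have e2 : ∫⁻ ξ, h (T ξ) = ENNReal.ofReal (‖x‖ ^ (-2 - q)) * levy q x := by
    rw [levy, ← lintegral_const_mul _ (by fun_prop)]
    refine lintegral_congr fun ξ => ?_
    rw [hh, ← ENNReal.ofReal_mul (by positivity)]
    have : inner ℝ 1 (T ξ) = inner ℝ x ξ := by
      simp [hT, Complex.inner]
      ring
    simp only [this]
    rw [show T ξ = conj x * ξ from rfl, norm_mul, Complex.norm_conj,
      Real.mul_rpow hx0.le (norm_nonneg _)]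
    congr 1; ring
  have e3 := e1.symm.trans e2
  have e4 : ENNReal.ofReal (‖x‖ ^ (2 + q)) * ENNReal.ofReal (‖x‖ ^ (-2 - q)) = 1 := by
    rw [← ENNReal.ofReal_mul (by positivity), ← Real.rpow_add hx0]; simp
  have e5 : ENNReal.ofReal (‖x‖ ^ (2 + q)) * ENNReal.ofReal ((‖x‖ ^ 2)⁻¹) =
      ENNReal.ofReal (‖x‖ ^ q) := by
    rw [← ENNReal.ofReal_mul (by positivity), Real.rpow_add hx0, Real.rpow_two]
    congr 1; field_simp
  calc levy q x = ENNReal.ofReal (‖x‖ ^ (2 + q)) * (ENNReal.ofReal (‖x‖ ^ (-2 - q)) * levy q x) := by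
        rw [← mul_assoc, e4, one_mul]
    _ = ENNReal.ofReal (‖x‖ ^ (2 + q)) * ENNReal.ofReal ((‖x‖ ^ 2)⁻¹) * levy q 1 := by
        rw [← e3, mul_assoc]
    _ = _ := by rw [e5, mul_comm]

theorem levy_one_ne_top (hq : 0 < q) (hq2 : q < 2) : levy q 1 ≠ ⊤ := by
  have hint : Integrable (fun ξ : ℂ => (fun r : ℝ => min 2 (r ^ 2) * r ^ (-2 - q)) ‖ξ‖) := by
    refine (integrable_fun_norm_addHaar volume
      (f := fun r : ℝ => min 2 (r ^ 2) * r ^ (-2 - q))).mpr ?_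
    rw [← Ioc_union_Ioi_eq_Ioi (zero_le_one' ℝ)]
    refine IntegrableOn.union ?_ ?_
    · have h1 : IntegrableOn (fun r : ℝ => r ^ (1 - q)) (Ioc 0 1) := by
        have := intervalIntegral.intervalIntegrable_rpow' (a := 0) (b := 1) (r := 1 - q)
          (by linarith)
        rwa [intervalIntegrable_iff_integrableOn_Ioc_of_le zero_le_one] at this
      refine h1.congr_fun (fun r hr => ?_) measurableSet_Ioc
      have hr0 : 0 < r := hr.1
      have : min 2 (r ^ 2) = r ^ 2 := min_eq_right (by nlinarith [hr.2])
      simp only [this, Complex.finrank_real_complex, smul_eq_mul]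
      rw [show (1 - q) = 1 + 2 + (-2 - q) by ring, Real.rpow_add hr0, Real.rpow_add hr0,
        Real.rpow_one, Real.rpow_two]
      ring
    · have h1 : IntegrableOn (fun r : ℝ => 2 * r ^ (-1 - q)) (Ioi 1) :=
        (integrableOn_Ioi_rpow_of_lt (by linarith) one_pos).const_mul 2
      refine Integrable.mono' h1 (by fun_prop) ?_
      filter_upwards [ae_restrict_mem measurableSet_Ioi] with r hr
      have hr0 : 0 < r := one_pos.trans hr
      simp only [Complex.finrank_real_complex, smul_eq_mul]
      rw [Real.norm_of_nonneg (by positivity)]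
      have e : r ^ (-1 - q) = r ^ (2 - 1) * r ^ (-2 - q) := by
        rw [show (-1 - q) = 1 + (-2 - q) by ring, Real.rpow_add hr0, Real.rpow_one]; norm_num
      rw [e]
      have := min_le_left 2 (r ^ 2)
      have h3 : 0 ≤ r ^ (2 - 1) * r ^ (-2 - q) := by positivity
      nlinarith
  refine (lt_of_le_of_lt (lintegral_mono fun ξ => ?_) hint.lintegral_lt_top).ne
  refine ENNReal.ofReal_le_ofReal (mul_le_mul_of_nonneg_right (le_min ?_ ?_) (by positivity))
  · linarith [Real.neg_one_le_cos (inner ℝ 1 ξ)]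
  · have h1 := Real.one_sub_sq_div_two_le_cos (x := inner ℝ 1 ξ)
    have h2 := abs_real_inner_le_norm (1 : ℂ) ξ
    rw [norm_one, one_mul] at h2
    have h3 : (inner ℝ 1 ξ : ℝ) ^ 2 ≤ ‖ξ‖ ^ 2 := by
      rw [← sq_abs]; gcongr
    nlinarith [sq_nonneg ‖ξ‖]

theorem lintegral_cos_mul_cos (x w : ℂ) :
    (∫⁻ ξ : ℂ, ENNReal.ofReal (2 * (1 - Real.cos (inner ℝ x ξ)) * (1 + Real.cos (inner ℝ w ξ)) *
      ‖ξ‖ ^ (-2 - q))) + (levy q w + levy q w) =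
      levy q (x + w) + levy q (x - w) + (levy q x + levy q x) := by
  simp only [levy]
  rw [← lintegral_add_left (by fun_prop), ← lintegral_add_left (by fun_prop),
    ← lintegral_add_left (by fun_prop), ← lintegral_add_left (by fun_prop),
    ← lintegral_add_left (by fun_prop)]
  refine lintegral_congr fun ξ => ?_
  have h : ∀ t : ℝ, 0 ≤ 1 - Real.cos t := fun t => by linarith [Real.cos_le_one t]
  have h' : ∀ t : ℝ, 0 ≤ 1 + Real.cos t := fun t => by linarith [Real.neg_one_le_cos t]
  have hk : 0 ≤ ‖ξ‖ ^ (-2 - q) := by positivity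
  have h1 : ∀ t : ℝ, 0 ≤ (1 - Real.cos t) * ‖ξ‖ ^ (-2 - q) := fun t => mul_nonneg (h t) hk
  rw [← ENNReal.ofReal_add (h1 _) (h1 _), ← ENNReal.ofReal_add (h1 _) (h1 _),
    ← ENNReal.ofReal_add (h1 _) (h1 _), ← ENNReal.ofReal_add _ (add_nonneg (h1 _) (h1 _)),
    ← ENNReal.ofReal_add (add_nonneg (h1 _) (h1 _)) (add_nonneg (h1 _) (h1 _))]
  · congr 1
    rw [inner_add_left, inner_sub_left, Real.cos_add, Real.cos_sub]
    ring
  · exact mul_nonneg (mul_nonneg (mul_nonneg zero_le_two (h _)) (h' _)) hk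

/-- The density `(σ(ℂ) - Re charFun σ ξ) |ξ| ^ (-2 - q)`. -/
noncomputable def dens (q : ℝ) (σ : Measure ℂ) (ξ : ℂ) : ENNReal :=
  (∫⁻ x, ENNReal.ofReal (1 - Real.cos (inner ℝ x ξ)) ∂σ) * ENNReal.ofReal (‖ξ‖ ^ (-2 - q))

theorem measurable_dens (σ : Measure ℂ) [SFinite σ] : Measurable (dens q σ) := by
  refine Measurable.mul ?_ (by fun_prop)
  exact Measurable.lintegral_prod_right' (f := fun z : ℂ × ℂ =>
    ENNReal.ofReal (1 - Real.cos (inner ℝ z.2 z.1))) (by fun_prop)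

theorem dens_neg (σ : Measure ℂ) (ξ : ℂ) : dens q σ (-ξ) = dens q σ ξ := by
  simp only [dens, inner_neg_right, Real.cos_neg, norm_neg]

theorem lintegral_dens_mul (hq : 0 < q) (σ : Measure ℂ) [IsFiniteMeasure σ] (w : ℂ) :
    (∫⁻ ξ, dens q σ ξ * ENNReal.ofReal (2 * (1 + Real.cos (inner ℝ w ξ)))) +
      (levy q w + levy q w) * σ univ =
    levy q 1 * ((∫⁻ x, ENNReal.ofReal (‖x + w‖ ^ q) ∂σ) + (∫⁻ x, ENNReal.ofReal (‖x - w‖ ^ q) ∂σ) +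
      ((∫⁻ x, ENNReal.ofReal (‖x‖ ^ q) ∂σ) + ∫⁻ x, ENNReal.ofReal (‖x‖ ^ q) ∂σ)) := by
  have e1 : (∫⁻ ξ, dens q σ ξ * ENNReal.ofReal (2 * (1 + Real.cos (inner ℝ w ξ)))) =
      ∫⁻ x, (∫⁻ ξ : ℂ, ENNReal.ofReal (2 * (1 - Real.cos (inner ℝ x ξ)) *
        (1 + Real.cos (inner ℝ w ξ)) * ‖ξ‖ ^ (-2 - q))) ∂σ := by
    rw [lintegral_lintegral_swap (by fun_prop)]
    refine lintegral_congr fun ξ => ?_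
    rw [dens, mul_assoc, ← lintegral_mul_const _ (by fun_prop)]
    refine lintegral_congr fun x => ?_
    have h : 0 ≤ 1 - Real.cos (inner ℝ x ξ) := by linarith [Real.cos_le_one (inner ℝ x ξ)]
    rw [← ENNReal.ofReal_mul (by positivity), ← ENNReal.ofReal_mul h]
    congr 1; ring
  have e2 : (levy q w + levy q w) * σ univ = ∫⁻ _, (levy q w + levy q w) ∂σ := by
    rw [lintegral_const]
  rw [e1, e2, ← lintegral_add_right _ measurable_const]
  simp_rw [lintegral_cos_mul_cos, levy_eq hq (_ + w), levy_eq hq (_ - w)]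
  have e3 : ∀ x : ℂ, levy q x = levy q 1 * ENNReal.ofReal (‖x‖ ^ q) := levy_eq hq
  rw [lintegral_add_left (by fun_prop), lintegral_add_left (by fun_prop),
    lintegral_congr fun x => congrArg₂ (· + ·) (e3 x) (e3 x), lintegral_add_left (by fun_prop),
    lintegral_const_mul _ (by fun_prop), lintegral_const_mul _ (by fun_prop),
    lintegral_const_mul _ (by fun_prop)]
  ring

variable {σ τ : Measure ℂ} [IsFiniteMeasure σ] [IsFiniteMeasure τ]

theorem lintegral_dens_ne_top (hq : 0 < q) (hq2 : q < 2)
    (hfin : ∀ w : ℂ, ∫⁻ x, ENNReal.ofReal (‖x + w‖ ^ q) ∂σ ≠ ⊤) (w : ℂ) :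
    (∫⁻ ξ, dens q σ ξ * ENNReal.ofReal (2 * (1 + Real.cos (inner ℝ w ξ)))) ≠ ⊤ := by
  have h := lintegral_dens_mul hq σ w
  have h0 := hfin 0
  have h1 := hfin (-w)
  simp only [add_zero, ← sub_eq_add_neg] at h0 h1
  refine ne_top_of_le_ne_top ?_ (h ▸ le_self_add)
  exact ENNReal.mul_ne_top (levy_one_ne_top hq hq2) (by simp [hfin w, h0, h1])

theorem lintegral_dens_eq (hq : 0 < q) (hq2 : q < 2) (hmass : σ univ = τ univ)
    (h : ∀ w : ℂ, ∫⁻ x, ENNReal.ofReal (‖x + w‖ ^ q) ∂σ = ∫⁻ x, ENNReal.ofReal (‖x + w‖ ^ q) ∂τ)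
    (w : ℂ) :
    (∫⁻ ξ, dens q σ ξ * ENNReal.ofReal (2 * (1 + Real.cos (inner ℝ w ξ)))) =
      ∫⁻ ξ, dens q τ ξ * ENNReal.ofReal (2 * (1 + Real.cos (inner ℝ w ξ))) := by
  have h1 := lintegral_dens_mul hq σ w
  have h2 := lintegral_dens_mul hq τ w
  have h0 := h 0
  have h3 := h (-w)
  simp only [add_zero, ← sub_eq_add_neg] at h0 h3
  rw [h w, h3, h0, ← h2, hmass] at h1
  refine (ENNReal.add_left_inj ?_).mp h1
  have : levy q w ≠ ⊤ := by
    rw [levy_eq hq]; exact ENNReal.mul_ne_top (levy_one_ne_top hq hq2) ENNReal.ofReal_ne_top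
  exact ENNReal.mul_ne_top (by simp [this]) (measure_ne_top _ _)

theorem integrable_cos_inner (σ : Measure ℂ) [IsFiniteMeasure σ] (ξ : ℂ) :
    Integrable (fun x : ℂ => Real.cos (inner ℝ x ξ)) σ :=
  (integrable_const (1 : ℝ)).mono' (by fun_prop)
    (Filter.Eventually.of_forall fun x => Real.abs_cos_le_one _)

theorem re_charFun (σ : Measure ℂ) [IsFiniteMeasure σ] (ξ : ℂ) :
    (charFun σ ξ).re = ∫ x, Real.cos (inner ℝ x ξ) ∂σ := by
  have hi : Integrable (fun x : ℂ => cexp ((inner ℝ x ξ : ℝ) * Complex.I)) σ := by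
    refine (integrable_const (1 : ℝ)).mono' (by fun_prop) (Filter.Eventually.of_forall fun x => ?_)
    rw [Complex.norm_exp_ofReal_mul_I]
  rw [charFun_apply, ← RCLike.re_eq_complex_re, ← integral_re hi]
  refine integral_congr_ae (Filter.Eventually.of_forall fun x => ?_)
  simp only [RCLike.re_eq_complex_re]
  rw [Complex.exp_ofReal_mul_I_re]

theorem lintegral_one_sub_cos (σ : Measure ℂ) [IsFiniteMeasure σ] (ξ : ℂ) :
    ∫⁻ x, ENNReal.ofReal (1 - Real.cos (inner ℝ x ξ)) ∂σ =
      ENNReal.ofReal (σ.real univ - (charFun σ ξ).re) ∧ 0 ≤ σ.real univ - (charFun σ ξ).re := by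
  have hc := integrable_cos_inner σ ξ
  have e : σ.real univ - (charFun σ ξ).re = ∫ x, (1 - Real.cos (inner ℝ x ξ)) ∂σ := by
    rw [integral_sub (integrable_const _) hc, re_charFun]; simp
  have h0 : ∀ x : ℂ, 0 ≤ 1 - Real.cos (inner ℝ x ξ) := fun x => by
    linarith [Real.cos_le_one (inner ℝ x ξ)]
  rw [e]
  exact ⟨(ofReal_integral_eq_lintegral_ofReal ((integrable_const _).sub hc)
    (Filter.Eventually.of_forall h0)).symm, integral_nonneg h0⟩

theorem charFun_re_eq (hq : 0 < q) (hq2 : q < 2) (hmass : σ univ = τ univ)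
    (hfin : ∀ w : ℂ, ∫⁻ x, ENNReal.ofReal (‖x + w‖ ^ q) ∂σ ≠ ⊤)
    (h : ∀ w : ℂ, ∫⁻ x, ENNReal.ofReal (‖x + w‖ ^ q) ∂σ = ∫⁻ x, ENNReal.ofReal (‖x + w‖ ^ q) ∂τ)
    (ξ : ℂ) : (charFun σ ξ).re = (charFun τ ξ).re := by
  have hfin' : ∀ w : ℂ, ∫⁻ x, ENNReal.ofReal (‖x + w‖ ^ q) ∂τ ≠ ⊤ := fun w => h w ▸ hfin w
  have hle : ∀ (σ : Measure ℂ) [IsFiniteMeasure σ],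
      ((∫⁻ ξ, dens q σ ξ * ENNReal.ofReal (2 * (1 + Real.cos (inner ℝ 0 ξ)))) ≠ ⊤) →
      ∫⁻ ξ, dens q σ ξ ≠ ⊤ := by
    intro σ _ hne
    refine ne_top_of_le_ne_top hne (lintegral_mono fun ξ => ?_)
    refine le_mul_of_one_le_right (zero_le) ?_
    rw [inner_zero_left, Real.cos_zero, ENNReal.one_le_ofReal]; norm_num
  have fσ := hle σ (lintegral_dens_ne_top hq hq2 hfin 0)
  have fτ := hle τ (lintegral_dens_ne_top hq hq2 hfin' 0)
  set ρ : Measure ℂ := volume.withDensity (dens q σ) with hρ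
  set ρ' : Measure ℂ := volume.withDensity (dens q τ) with hρ'
  have iρ : IsFiniteMeasure ρ := isFiniteMeasure_withDensity fσ
  have iρ' : IsFiniteMeasure ρ' := isFiniteMeasure_withDensity fτ
  have hcos : ∀ w : ℂ, ∫ ξ, 2 * (1 + Real.cos (inner ℝ w ξ)) ∂ρ =
      ∫ ξ, 2 * (1 + Real.cos (inner ℝ w ξ)) ∂ρ' := by
    intro w
    have h0 : ∀ x : ℂ, 0 ≤ 2 * (1 + Real.cos (inner ℝ w x)) := fun x => by
      linarith [Real.neg_one_le_cos (inner ℝ w x)]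
    rw [integral_eq_lintegral_of_nonneg_ae (Filter.Eventually.of_forall h0) (by fun_prop),
      integral_eq_lintegral_of_nonneg_ae (Filter.Eventually.of_forall h0) (by fun_prop),
      hρ, hρ', lintegral_withDensity_eq_lintegral_mul _ (measurable_dens σ) (by fun_prop),
      lintegral_withDensity_eq_lintegral_mul _ (measurable_dens τ) (by fun_prop)]
    exact congrArg ENNReal.toReal (lintegral_dens_eq hq hq2 hmass h w)
  have expand : ∀ (μ : Measure ℂ) [IsFiniteMeasure μ] (w : ℂ),
      ∫ ξ, 2 * (1 + Real.cos (inner ℝ w ξ)) ∂μ = 2 * μ.real univ + 2 * (charFun μ w).re := by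
    intro μ _ w
    have hc := integrable_cos_inner μ w
    simp_rw [real_inner_comm _ w]
    rw [integral_const_mul, integral_add (integrable_const _) hc, re_charFun]
    simp [mul_add]
  have him : ∀ (σ : Measure ℂ) [IsFiniteMeasure σ] (hf : ∫⁻ ξ, dens q σ ξ ≠ ⊤) (w : ℂ),
      (charFun (volume.withDensity (dens q σ)) w).im = 0 := by
    intro σ _ hf w
    have e : charFun (volume.withDensity (dens q σ)) (-w) =
        charFun (volume.withDensity (dens q σ)) w := by
      rw [charFun_apply, charFun_apply, integral_withDensity_eq_integral_toReal_smul
        (measurable_dens σ) (ae_lt_top (measurable_dens σ) hf),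
        integral_withDensity_eq_integral_toReal_smul
        (measurable_dens σ) (ae_lt_top (measurable_dens σ) hf), ← integral_neg_eq_self]
      refine integral_congr_ae (Filter.Eventually.of_forall fun ξ => ?_)
      simp only [dens_neg, inner_neg_neg]
    rw [charFun_neg] at e
    have := congrArg Complex.im e
    rw [Complex.conj_im] at this
    linarith
  have hmassρ : ρ.real univ = ρ'.real univ := by
    have h0 := hcos 0
    rw [expand ρ 0, expand ρ' 0] at h0
    simp only [charFun_zero, Complex.ofReal_re] at h0
    linarith
  have hchar : charFun ρ = charFun ρ' := by
    funext w
    refine Complex.ext ?_ ?_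
    · have h0 := hcos w
      rw [expand ρ w, expand ρ' w] at h0
      linarith
    · rw [him σ fσ w, him τ fτ w]
  have hae := (withDensity_eq_iff (measurable_dens σ).aemeasurable (measurable_dens τ).aemeasurable
    fσ).mp (Measure.ext_of_charFun hchar)
  have hre : (fun ξ => (charFun σ ξ).re) =ᵐ[volume] fun ξ => (charFun τ ξ).re := by
    have hne : ∀ᵐ ξ : ℂ, ξ ≠ 0 := Measure.ae_ne volume 0
    filter_upwards [hae, hne] with ξ h1 h2
    obtain ⟨a1, b1⟩ := lintegral_one_sub_cos σ ξ
    obtain ⟨a2, b2⟩ := lintegral_one_sub_cos τ ξ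
    have hk : 0 < ‖ξ‖ ^ (-2 - q) := Real.rpow_pos_of_pos (norm_pos_iff.mpr h2) _
    rw [dens, dens, ENNReal.mul_left_inj (ENNReal.ofReal_pos.mpr hk).ne' ENNReal.ofReal_ne_top,
      a1, a2, ENNReal.ofReal_eq_ofReal_iff b1 b2, measureReal_def, measureReal_def, hmass] at h1
    linarith
  exact congrFun ((Continuous.ae_eq_iff_eq volume (Complex.continuous_re.comp continuous_charFun)
    (Complex.continuous_re.comp continuous_charFun)).mp hre) ξ

end RieszPotential

open RieszPotential in
/-- A finite measure on the plane is determined by its mass and its `q`-th power potential. -/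
theorem measure_eq_of_lintegral_norm_add_rpow {q : ℝ} (hq : 0 < q) (hq2 : q < 2)
    {σ τ : Measure ℂ} [IsFiniteMeasure σ] [IsFiniteMeasure τ] (hmass : σ univ = τ univ)
    (hfin : ∀ w : ℂ, ∫⁻ x, ENNReal.ofReal (‖x + w‖ ^ q) ∂σ ≠ ⊤)
    (h : ∀ w : ℂ, ∫⁻ x, ENNReal.ofReal (‖x + w‖ ^ q) ∂σ = ∫⁻ x, ENNReal.ofReal (‖x + w‖ ^ q) ∂τ) :
    σ = τ := by
  refine Measure.ext_of_charFun (funext fun ξ => ?_)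
  have hre := charFun_re_eq hq hq2 hmass hfin h ξ
  refine Complex.ext hre ?_
  by_cases hξ : ξ = 0
  · subst hξ
    simp
  obtain ⟨r, hr⟩ : ∃ r : ℂ, (inner ℝ r ξ : ℝ) = π / 2 := by
    refine ⟨(π / 2 / ‖ξ‖ ^ 2 : ℝ) • ξ, ?_⟩
    rw [real_inner_smul_left, real_inner_self_eq_norm_sq,
      div_mul_cancel₀ _ (by positivity)]
  have hs : ∀ (μ : Measure ℂ) (w : ℂ), ∫⁻ x, ENNReal.ofReal (‖x + w‖ ^ q) ∂(μ.map (· + r)) =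
      ∫⁻ x, ENNReal.ofReal (‖x + (r + w)‖ ^ q) ∂μ := fun μ w => by
    rw [lintegral_map (by fun_prop) (by fun_prop)]
    simp only [add_assoc]
  have := charFun_re_eq (σ := σ.map (· + r)) (τ := τ.map (· + r)) hq hq2
    (by rw [Measure.map_apply (by fun_prop) MeasurableSet.univ,
      Measure.map_apply (by fun_prop) MeasurableSet.univ]; exact hmass)
    (fun w => by rw [hs]; exact hfin _) (fun w => by rw [hs, hs]; exact h _) ξ
  rw [charFun_map_add_const, charFun_map_add_const, hr] at this
  have e : cexp (((π / 2 : ℝ) : ℂ) * Complex.I) = Complex.I := by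
    push_cast; exact Complex.exp_pi_div_two_mul_I
  rw [e] at this
  simpa using this

theorem exists_rpow_taylor_two (a : ℝ) : ∃ K > 0, ∃ ε ∈ Ioo (0 : ℝ) 1, ∀ y : ℝ, |y| ≤ ε →
    |(1 + y) ^ a - (1 + a * y + a * (a - 1) / 2 * y ^ 2)| ≤ K * |y| ^ 3 := by
  have h := (Real.one_add_rpow_hasFPowerSeriesAt_zero (a := a)).isBigO_sub_partialSum_pow 3
  obtain ⟨K, hK, hb⟩ := h.exists_pos
  rw [Asymptotics.isBigOWith_iff, Metric.eventually_nhds_iff] at hb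
  obtain ⟨ε, hε, hb⟩ := hb
  refine ⟨K, hK, min (ε / 2) (1 / 2), ⟨by positivity, by
    exact (min_le_right _ _).trans_lt (by norm_num)⟩, fun y hy => ?_⟩
  have hy' : dist y 0 < ε := by
    rw [Real.dist_0_eq_abs]; have := min_le_left (ε / 2) (1 / 2 : ℝ); linarith
  have h1 := hb hy'
  have hc : Ring.choose a 2 = a * (a - 1) / 2 := by
    rw [Ring.choose_eq_smul]
    simp [descPochhammer_succ_right, Polynomial.smeval_mul, Polynomial.smeval_sub,
      Polynomial.smeval_X, Nat.factorial]
    ring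
  have e : (binomialSeries ℝ a).partialSum 3 y = 1 + a * y + a * (a - 1) / 2 * y ^ 2 := by
    simp [FormalMultilinearSeries.partialSum, binomialSeries, Finset.sum_range_succ, hc]
    ring
  rw [zero_add, e, norm_pow, Real.norm_eq_abs, Real.norm_eq_abs, Real.norm_eq_abs, abs_abs] at h1
  exact h1

/-- The second symmetric difference of `|·| ^ q` over the fourth roots of unity. -/
noncomputable def fourDiff (q : ℝ) (a b : ℂ) : ℝ :=
  ‖a + b‖ ^ q + ‖a + (-1 : ℂ) * b‖ ^ q + ‖a + Complex.I * b‖ ^ q + ‖a + (-Complex.I) * b‖ ^ q -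
    4 * ‖a‖ ^ q

theorem fourDiff_smul {q : ℝ} (a z : ℂ) : fourDiff q a (a * z) = ‖a‖ ^ q * fourDiff q 1 z := by
  have h : ∀ c : ℂ, ‖a + c * (a * z)‖ ^ q = ‖a‖ ^ q * ‖1 + c * z‖ ^ q := fun c => by
    rw [← Real.mul_rpow (norm_nonneg _) (norm_nonneg _), ← norm_mul]; congr 2; ring
  have h1 := h 1
  rw [one_mul, one_mul] at h1
  rw [fourDiff, fourDiff, h1, h, h, h, norm_one, Real.one_rpow]
  ring

theorem exists_fourDiff_one_near {q : ℝ} : ∃ K > 0, ∃ δ ∈ Ioo (0 : ℝ) 1, ∀ z : ℂ, ‖z‖ ≤ δ →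
    |fourDiff q 1 z - q ^ 2 * ‖z‖ ^ 2| ≤ K * ‖z‖ ^ 3 := by
  obtain ⟨K, hK, ε, hε, hb⟩ := exists_rpow_taylor_two (q / 2)
  set c : ℝ := q / 2 * (q / 2 - 1) / 2 with hc
  refine ⟨4 * (K * 3 ^ 3) + 4 * |c|, by positivity, ε / 3, ⟨by linarith [hε.1], by linarith [hε.2]⟩,
    fun z hz => ?_⟩
  have hz1 : ‖z‖ ≤ 1 := by linarith [hε.2]
  have hn : ∀ w : ℂ, ‖1 + w‖ ^ q = (1 + (2 * w.re + ‖w‖ ^ 2)) ^ (q / 2) := fun w => by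
    have : 1 + (2 * w.re + ‖w‖ ^ 2) = ‖1 + w‖ ^ 2 := by
      rw [← Complex.normSq_eq_norm_sq, ← Complex.normSq_eq_norm_sq, Complex.normSq_apply,
        Complex.normSq_apply]; simp; ring
    rw [this, ← Real.rpow_natCast, ← Real.rpow_mul (norm_nonneg _)]; congr 1; push_cast; ring
  have hw : ∀ w : ℂ, ‖w‖ = ‖z‖ → |‖1 + w‖ ^ q - (1 + q / 2 * (2 * w.re + ‖z‖ ^ 2) +
      c * (2 * w.re + ‖z‖ ^ 2) ^ 2)| ≤ K * 3 ^ 3 * ‖z‖ ^ 3 := fun w hw => by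
    have h3 : |2 * w.re + ‖z‖ ^ 2| ≤ 3 * ‖z‖ := by
      have h4 := Complex.abs_re_le_norm w
      rw [hw] at h4
      rw [abs_le] at h4 ⊢
      constructor <;> nlinarith [norm_nonneg z]
    rw [hn, hw, mul_assoc, ← mul_pow]
    exact (hb _ (h3.trans (by linarith))).trans (by gcongr)
  have h1 := hw z rfl
  have h2 := hw (-1 * z) (by simp)
  have h3 := hw (Complex.I * z) (by simp)
  have h4 := hw (-Complex.I * z) (by simp)
  have hre := Complex.normSq_eq_norm_sq z
  rw [Complex.normSq_apply] at hre
  have hz3 : ‖z‖ ^ 4 ≤ ‖z‖ ^ 3 := pow_le_pow_of_le_one (norm_nonneg _) hz1 (by norm_num)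
  have hc4 : |4 * c * ‖z‖ ^ 4| ≤ 4 * |c| * ‖z‖ ^ 3 := by
    rw [abs_mul, abs_mul, abs_of_pos (by norm_num : (0 : ℝ) < 4),
      abs_of_nonneg (by positivity : 0 ≤ ‖z‖ ^ 4)]
    gcongr
  have e : fourDiff q 1 z - q ^ 2 * ‖z‖ ^ 2 =
      (‖1 + z‖ ^ q - (1 + q / 2 * (2 * z.re + ‖z‖ ^ 2) + c * (2 * z.re + ‖z‖ ^ 2) ^ 2)) +
      (‖1 + -1 * z‖ ^ q - (1 + q / 2 * (2 * (-1 * z).re + ‖z‖ ^ 2) +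
        c * (2 * (-1 * z).re + ‖z‖ ^ 2) ^ 2)) +
      (‖1 + Complex.I * z‖ ^ q - (1 + q / 2 * (2 * (Complex.I * z).re + ‖z‖ ^ 2) +
        c * (2 * (Complex.I * z).re + ‖z‖ ^ 2) ^ 2)) +
      (‖1 + -Complex.I * z‖ ^ q - (1 + q / 2 * (2 * (-Complex.I * z).re + ‖z‖ ^ 2) +
        c * (2 * (-Complex.I * z).re + ‖z‖ ^ 2) ^ 2)) + 4 * c * ‖z‖ ^ 4 := by
    rw [fourDiff, norm_one, Real.one_rpow]
    simp
    rw [hc]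
    linear_combination (q ^ 2 - 2 * q) * hre
  rw [e]
  refine (abs_add_le _ _).trans ?_
  refine (add_le_add ((abs_add_le _ _).trans (add_le_add ((abs_add_le _ _).trans (add_le_add
    ((abs_add_le _ _).trans (add_le_add h1 h2)) h3)) h4)) hc4).trans (le_of_eq ?_)
  ring

theorem exists_abs_fourDiff_le {q : ℝ} (hq : 2 ≤ q) : ∃ C > 0, ∀ a b : ℂ,
    |fourDiff q a b| ≤ C * (‖a‖ ^ (q - 2) * ‖b‖ ^ 2 + ‖b‖ ^ q) := by
  obtain ⟨K, hK, δ, hδ, hb⟩ := exists_fourDiff_one_near (q := q)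
  have hδ0 := hδ.1
  have hq0 : 0 ≤ q := by linarith
  have h1 : ∃ C ≥ 4, ∀ z : ℂ, |fourDiff q 1 z| ≤ C * (‖z‖ ^ 2 + ‖z‖ ^ q) := by
    refine ⟨K + q ^ 2 + (8 * (1 / δ + 1) ^ q + 4), by
      have : 0 ≤ 8 * (1 / δ + 1) ^ q := by positivity
      nlinarith [sq_nonneg q], fun z => ?_⟩
    have hz0 := norm_nonneg z
    by_cases hz : ‖z‖ ≤ δ
    · have h2 := hb z hz
      have h3 : ‖z‖ ^ 3 ≤ ‖z‖ ^ 2 := pow_le_pow_of_le_one hz0 (by linarith [hδ.2]) (by norm_num)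
      have h4 : |fourDiff q 1 z| ≤ K * ‖z‖ ^ 3 + q ^ 2 * ‖z‖ ^ 2 := by
        rw [abs_le] at h2 ⊢
        have : 0 ≤ q ^ 2 * ‖z‖ ^ 2 := by positivity
        constructor <;> linarith [h2.1, h2.2]
      have h5 : 0 ≤ ‖z‖ ^ q := by positivity
      have h6 : 0 ≤ 8 * (1 / δ + 1) ^ q + 4 := by positivity
      nlinarith [mul_nonneg h6 (sq_nonneg ‖z‖), mul_nonneg h6 h5, mul_nonneg hK.le h5,
        mul_nonneg (sq_nonneg q) h5, mul_le_mul_of_nonneg_left h3 hK.le]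
    · rw [not_le] at hz
      have h2 : ∀ w : ℂ, ‖w‖ ≤ 1 → ‖1 + w * z‖ ^ q ≤ (1 / δ + 1) ^ q * ‖z‖ ^ q := fun w hw => by
        rw [← Real.mul_rpow (by positivity) hz0]
        refine Real.rpow_le_rpow (norm_nonneg _) ?_ hq0
        refine (norm_add_le _ _).trans ?_
        rw [norm_one, norm_mul]
        have h3 : 1 ≤ 1 / δ * ‖z‖ := by
          rw [div_mul_eq_mul_div, one_mul, le_div_iff₀ hδ0]; linarith
        nlinarith
      have a1 := h2 1 (by simp)
      have a2 := h2 (-1) (by simp)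
      have a3 := h2 Complex.I (by simp)
      have a4 := h2 (-Complex.I) (by simp)
      rw [one_mul] at a1
      have a5 : 1 ≤ (1 / δ + 1) ^ q * ‖z‖ ^ q := by
        rw [← Real.mul_rpow (by positivity) hz0]
        refine Real.one_le_rpow ?_ hq0
        have h3 : 1 ≤ 1 / δ * ‖z‖ := by
          rw [div_mul_eq_mul_div, one_mul, le_div_iff₀ hδ0]; linarith
        nlinarith
      have h3 : |fourDiff q 1 z| ≤ 8 * (1 / δ + 1) ^ q * ‖z‖ ^ q := by
        rw [fourDiff, norm_one, Real.one_rpow, abs_le]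
        have b : ∀ w : ℂ, 0 ≤ ‖1 + w‖ ^ q := fun w => by positivity
        constructor <;> linarith [b z, b (-1 * z), b (Complex.I * z), b (-Complex.I * z)]
      refine h3.trans ?_
      have h5 : 0 ≤ ‖z‖ ^ q := by positivity
      have h6 : 0 ≤ (1 / δ + 1) ^ q := by positivity
      nlinarith [mul_nonneg hK.le h5, mul_nonneg (sq_nonneg q) h5, sq_nonneg ‖z‖,
        mul_nonneg hK.le (sq_nonneg ‖z‖), mul_nonneg (sq_nonneg q) (sq_nonneg ‖z‖),
        mul_nonneg h6 (sq_nonneg ‖z‖)]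
  obtain ⟨C, hC, h1⟩ := h1
  refine ⟨C, by linarith, fun a b => ?_⟩
  by_cases ha : a = 0
  · subst ha
    have e : fourDiff q 0 b = 4 * ‖b‖ ^ q := by
      rw [fourDiff]; simp [Real.zero_rpow (by linarith : q ≠ 0)]; ring
    rw [e, abs_of_nonneg (by positivity)]
    have : 0 ≤ ‖(0 : ℂ)‖ ^ (q - 2) * ‖b‖ ^ 2 := by positivity
    have : 0 ≤ ‖b‖ ^ q := by positivity
    nlinarith
  · have ha0 : 0 < ‖a‖ := norm_pos_iff.mpr ha
    obtain ⟨z, rfl⟩ : ∃ z, b = a * z := ⟨b / a, by field_simp⟩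
    rw [fourDiff_smul, abs_mul, abs_of_nonneg (by positivity), norm_mul,
      Real.mul_rpow ha0.le (norm_nonneg _), mul_pow]
    have e : ‖a‖ ^ q = ‖a‖ ^ (q - 2) * ‖a‖ ^ 2 := by
      rw [← Real.rpow_natCast, ← Real.rpow_add ha0]; congr 1; push_cast; ring
    calc ‖a‖ ^ q * |fourDiff q 1 z| ≤ ‖a‖ ^ q * (C * (‖z‖ ^ 2 + ‖z‖ ^ q)) := by gcongr; exact h1 z
      _ = C * (‖a‖ ^ q * ‖z‖ ^ 2 + ‖a‖ ^ q * ‖z‖ ^ q) := by ring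
      _ = _ := by rw [e]; ring

open Filter Topology in
theorem tendsto_fourDiff {q : ℝ} (hq : 2 ≤ q) (a b : ℂ) :
    Tendsto (fun n : ℕ => fourDiff q a ((1 / ((n : ℝ) + 1) : ℝ) * b) * ((n : ℝ) + 1) ^ 2) atTop
      (𝓝 (q ^ 2 * (‖a‖ ^ (q - 2) * ‖b‖ ^ 2))) := by
  have hlim := tendsto_one_div_add_atTop_nhds_zero_nat (𝕜 := ℝ)
  by_cases ha : a = 0
  · subst ha
    have e : ∀ n : ℕ, fourDiff q 0 ((1 / ((n : ℝ) + 1) : ℝ) * b) * ((n : ℝ) + 1) ^ 2 =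
        4 * ‖b‖ ^ q * (1 / ((n : ℝ) + 1)) ^ (q - 2) := fun n => by
      have hn : (0 : ℝ) < 1 / ((n : ℝ) + 1) := by positivity
      have e1 : (1 / ((n : ℝ) + 1)) ^ q = (1 / ((n : ℝ) + 1)) ^ (q - 2) * (1 / ((n : ℝ) + 1)) ^ 2 := by
        rw [← Real.rpow_natCast (1 / ((n : ℝ) + 1)) 2, ← Real.rpow_add hn]; congr 1; push_cast; ring
      have e2 : fourDiff q 0 ((1 / ((n : ℝ) + 1) : ℝ) * b) =
          4 * ((1 / ((n : ℝ) + 1)) ^ q * ‖b‖ ^ q) := by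
        rw [← Real.mul_rpow hn.le (norm_nonneg _), fourDiff]
        have : ‖((1 / ((n : ℝ) + 1) : ℝ) : ℂ)‖ = 1 / ((n : ℝ) + 1) := by
          rw [Complex.norm_real, Real.norm_of_nonneg hn.le]
        simp only [zero_add, one_mul, norm_mul, norm_neg, norm_one, Complex.norm_I, this, norm_zero,
          Real.zero_rpow (by linarith : q ≠ 0)]
        ring
      rw [e2, e1]
      have : (n : ℝ) + 1 ≠ 0 := by positivity
      field_simp
    simp_rw [e]
    rcases hq.eq_or_lt with rfl | h2
    · simp
      norm_num
    · have := (hlim.rpow_const (p := q - 2) (Or.inr (by linarith))).const_mul (4 * ‖b‖ ^ q)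
      rw [Real.zero_rpow (by linarith)] at this
      simpa [Real.zero_rpow (by linarith : q - 2 ≠ 0)] using this
  · have ha0 : 0 < ‖a‖ := norm_pos_iff.mpr ha
    obtain ⟨z, rfl⟩ : ∃ z, b = a * z := ⟨b / a, by field_simp⟩
    obtain ⟨K, hK, δ, hδ, hb⟩ := exists_fourDiff_one_near (q := q)
    have hlz : Tendsto (fun n : ℕ => K * ‖z‖ ^ 3 * (1 / ((n : ℝ) + 1))) atTop (𝓝 0) := by
      simpa using hlim.const_mul (K * ‖z‖ ^ 3)
    have hnear : Tendsto (fun n : ℕ => fourDiff q 1 ((1 / ((n : ℝ) + 1) : ℝ) * z) *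
        ((n : ℝ) + 1) ^ 2) atTop (𝓝 (q ^ 2 * ‖z‖ ^ 2)) := by
      rw [tendsto_iff_dist_tendsto_zero]
      have hsm : Tendsto (fun n : ℕ => ‖z‖ * (1 / ((n : ℝ) + 1))) atTop (𝓝 0) := by
        simpa using hlim.const_mul ‖z‖
      refine squeeze_zero' (Eventually.of_forall fun _ => dist_nonneg) ?_ hlz
      filter_upwards [hsm.eventually (gt_mem_nhds hδ.1)] with n hn
      have hn0 : (0 : ℝ) < (n : ℝ) + 1 := by positivity
      have e : ‖((1 / ((n : ℝ) + 1) : ℝ) : ℂ) * z‖ = ‖z‖ * (1 / ((n : ℝ) + 1)) := by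
        rw [norm_mul, Complex.norm_real, Real.norm_of_nonneg (by positivity), mul_comm]
      have h1 := hb _ (e.le.trans hn.le)
      rw [e] at h1
      have e2 : fourDiff q 1 ((1 / ((n : ℝ) + 1) : ℝ) * z) * ((n : ℝ) + 1) ^ 2 - q ^ 2 * ‖z‖ ^ 2 =
          (fourDiff q 1 ((1 / ((n : ℝ) + 1) : ℝ) * z) -
            q ^ 2 * (‖z‖ * (1 / ((n : ℝ) + 1))) ^ 2) * ((n : ℝ) + 1) ^ 2 := by
        field_simp
      rw [Real.dist_eq, e2, abs_mul, abs_of_pos (by positivity : 0 < ((n : ℝ) + 1) ^ 2)]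
      refine (mul_le_mul_of_nonneg_right h1 (by positivity)).trans (le_of_eq ?_)
      field_simp
    have e : q ^ 2 * (‖a‖ ^ (q - 2) * ‖a * z‖ ^ 2) = ‖a‖ ^ q * (q ^ 2 * ‖z‖ ^ 2) := by
      have : ‖a‖ ^ q = ‖a‖ ^ (q - 2) * ‖a‖ ^ 2 := by
        rw [← Real.rpow_natCast, ← Real.rpow_add ha0]; congr 1; push_cast; ring
      rw [this, norm_mul]; ring
    rw [e]
    refine (hnear.const_mul (‖a‖ ^ q)).congr fun n => ?_
    rw [mul_left_comm _ a, fourDiff_smul]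
    ring

variable {X : Type*} [MeasurableSpace X] {μ : Measure X}

theorem integrable_norm_rpow_add {q : ℝ} (hq : 2 ≤ q) {F G : X → ℂ}
    (hF : AEStronglyMeasurable F μ) (hG : AEStronglyMeasurable G μ)
    (hFi : Integrable (fun x => ‖F x‖ ^ q) μ) (hGi : Integrable (fun x => ‖G x‖ ^ q) μ) (c : ℂ) :
    Integrable (fun x => ‖F x + c * G x‖ ^ q) μ := by
  have hq0 : ENNReal.ofReal q ≠ 0 := by
    rw [Ne, ENNReal.ofReal_eq_zero]; linarith
  have key : ∀ {H : X → ℂ}, AEStronglyMeasurable H μ →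
      (Integrable (fun x => ‖H x‖ ^ q) μ ↔ MemLp H (ENNReal.ofReal q) μ) := fun hH => by
    have := integrable_norm_rpow_iff hH hq0 ENNReal.ofReal_ne_top
    rwa [ENNReal.toReal_ofReal (by linarith)] at this
  exact (key (hF.add (hG.const_mul c))).mpr
    (((key hF).mp hFi).add (((key hG).mp hGi).const_mul c))

theorem integrable_norm_rpow_mul_sq {q : ℝ} (hq : 2 ≤ q) {F G : X → ℂ}
    (hF : AEStronglyMeasurable F μ) (hG : AEStronglyMeasurable G μ)
    (hFi : Integrable (fun x => ‖F x‖ ^ q) μ) (hGi : Integrable (fun x => ‖G x‖ ^ q) μ) :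
    Integrable (fun x => ‖F x‖ ^ (q - 2) * ‖G x‖ ^ 2) μ := by
  refine (hFi.add hGi).mono' (((hF.norm.aemeasurable.pow_const _).aestronglyMeasurable).mul
    (hG.norm.pow 2)) (Filter.Eventually.of_forall fun x => ?_)
  rw [Real.norm_of_nonneg (by positivity)]
  have h : ∀ t : ℝ, 0 ≤ t → t ^ q = t ^ (q - 2) * t ^ 2 := fun t ht => by
    rw [← Real.rpow_natCast, ← Real.rpow_add' ht (by push_cast; linarith)]
    congr 1; push_cast; ring
  show _ ≤ ‖F x‖ ^ q + ‖G x‖ ^ q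
  rcases le_total ‖F x‖ ‖G x‖ with hle | hle
  · have h1 : ‖F x‖ ^ (q - 2) * ‖G x‖ ^ 2 ≤ ‖G x‖ ^ q := by
      rw [h _ (norm_nonneg (G x))]
      gcongr
    have h2 : 0 ≤ ‖F x‖ ^ q := by positivity
    linarith
  · have h1 : ‖F x‖ ^ (q - 2) * ‖G x‖ ^ 2 ≤ ‖F x‖ ^ q := by
      rw [h _ (norm_nonneg (F x))]
      gcongr
    have h2 : 0 ≤ ‖G x‖ ^ q := by positivity
    linarith

open Filter Topology in
theorem tendsto_integral_fourDiff {q : ℝ} (hq : 2 ≤ q) {F G : X → ℂ}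
    (hF : AEStronglyMeasurable F μ) (hG : AEStronglyMeasurable G μ)
    (hFi : Integrable (fun x => ‖F x‖ ^ q) μ) (hGi : Integrable (fun x => ‖G x‖ ^ q) μ) :
    Tendsto (fun n : ℕ => (∫ x, fourDiff q (F x) ((1 / ((n : ℝ) + 1) : ℝ) * G x) ∂μ) *
      ((n : ℝ) + 1) ^ 2) atTop (𝓝 (q ^ 2 * ∫ x, ‖F x‖ ^ (q - 2) * ‖G x‖ ^ 2 ∂μ)) := by
  obtain ⟨C, hC, hb⟩ := exists_abs_fourDiff_le hq
  simp_rw [← integral_mul_const, ← integral_const_mul]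
  refine tendsto_integral_of_dominated_convergence
    (fun x => C * (‖F x‖ ^ (q - 2) * ‖G x‖ ^ 2 + ‖G x‖ ^ q)) (fun n => ?_)
    (((integrable_norm_rpow_mul_sq hq hF hG hFi hGi).add hGi).const_mul C) (fun n => ?_)
    (Eventually.of_forall fun x => tendsto_fourDiff hq (F x) (G x))
  · have hF' := hF.aemeasurable
    have hG' := hG.aemeasurable
    simp only [fourDiff]
    exact AEMeasurable.aestronglyMeasurable (by fun_prop)
  · refine Eventually.of_forall fun x => ?_
    have hn : (0 : ℝ) < (n : ℝ) + 1 := by positivity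
    have hn1 : 1 / ((n : ℝ) + 1) ≤ 1 := by
      rw [div_le_one hn]; linarith [(Nat.cast_nonneg n : (0 : ℝ) ≤ n)]
    have h1 := hb (F x) ((1 / ((n : ℝ) + 1) : ℝ) * G x)
    rw [norm_mul, Complex.norm_real, Real.norm_of_nonneg (by positivity),
      Real.mul_rpow (by positivity) (norm_nonneg _)] at h1
    have h2 : (1 / ((n : ℝ) + 1)) ^ q ≤ (1 / ((n : ℝ) + 1)) ^ 2 := by
      rw [← Real.rpow_two]
      exact Real.rpow_le_rpow_of_exponent_ge (by positivity) hn1 hq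
    rw [norm_mul, Real.norm_eq_abs, Real.norm_of_nonneg (by positivity)]
    calc |fourDiff q (F x) ((1 / ((n : ℝ) + 1) : ℝ) * G x)| * ((n : ℝ) + 1) ^ 2
        ≤ C * (‖F x‖ ^ (q - 2) * (1 / ((n : ℝ) + 1) * ‖G x‖) ^ 2 +
          (1 / ((n : ℝ) + 1)) ^ 2 * ‖G x‖ ^ q) * ((n : ℝ) + 1) ^ 2 := by
          gcongr
          refine h1.trans ?_
          gcongr
      _ = _ := by field_simp

theorem integral_fourDiff {q : ℝ} (hq : 2 ≤ q) {F G : X → ℂ}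
    (hF : AEStronglyMeasurable F μ) (hG : AEStronglyMeasurable G μ)
    (hFi : Integrable (fun x => ‖F x‖ ^ q) μ) (hGi : Integrable (fun x => ‖G x‖ ^ q) μ) (r : ℂ) :
    ∫ x, fourDiff q (F x) (r * G x) ∂μ = (∫ x, ‖F x + r * G x‖ ^ q ∂μ) +
      (∫ x, ‖F x + (-1 * r) * G x‖ ^ q ∂μ) + (∫ x, ‖F x + (Complex.I * r) * G x‖ ^ q ∂μ) +
      (∫ x, ‖F x + (-Complex.I * r) * G x‖ ^ q ∂μ) - 4 * ∫ x, ‖F x + 0 * G x‖ ^ q ∂μ := by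
  have hi := integrable_norm_rpow_add hq hF hG hFi hGi
  have i2 := (hi r).add (hi (-1 * r))
  have i3 := i2.add (hi (Complex.I * r))
  have i4 := i3.add (hi (-Complex.I * r))
  rw [← integral_const_mul, ← integral_add (hi _) (hi _)]
  refine Eq.trans ?_ ((integral_sub i4 ((hi 0).const_mul 4)).trans (congrArg (· - _)
    ((integral_add i3 (hi _)).trans (congrArg (· + _) (integral_add i2 (hi _))))))
  refine integral_congr_ae (Filter.Eventually.of_forall fun x => ?_)
  simp only [fourDiff, zero_mul, add_zero, mul_assoc]
  rfl

/-- Isometric families for the exponent `q ≥ 2` are isometric for a weighted exponent `2`. -/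
theorem integral_norm_rpow_mul_sq_eq {Y : Type*} [MeasurableSpace Y] {ν : Measure Y} {q : ℝ}
    (hq : 2 ≤ q) {F G : X → ℂ} {F' G' : Y → ℂ}
    (hF : AEStronglyMeasurable F μ) (hG : AEStronglyMeasurable G μ)
    (hFi : Integrable (fun x => ‖F x‖ ^ q) μ) (hGi : Integrable (fun x => ‖G x‖ ^ q) μ)
    (hF' : AEStronglyMeasurable F' ν) (hG' : AEStronglyMeasurable G' ν)
    (hFi' : Integrable (fun x => ‖F' x‖ ^ q) ν) (hGi' : Integrable (fun x => ‖G' x‖ ^ q) ν)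
    (h : ∀ t : ℂ, ∫ x, ‖F x + t * G x‖ ^ q ∂μ = ∫ y, ‖F' y + t * G' y‖ ^ q ∂ν) :
    ∫ x, ‖F x‖ ^ (q - 2) * ‖G x‖ ^ 2 ∂μ = ∫ y, ‖F' y‖ ^ (q - 2) * ‖G' y‖ ^ 2 ∂ν := by
  have l1 := tendsto_integral_fourDiff hq hF hG hFi hGi
  have l2 := tendsto_integral_fourDiff hq hF' hG' hFi' hGi'
  have e : ∀ r : ℂ, ∫ x, fourDiff q (F x) (r * G x) ∂μ = ∫ y, fourDiff q (F' y) (r * G' y) ∂ν := by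
    intro r
    rw [integral_fourDiff hq hF hG hFi hGi, integral_fourDiff hq hF' hG' hFi' hGi', h, h, h, h, h]
  simp_rw [e] at l1
  have := tendsto_nhds_unique l1 l2
  exact mul_left_cancel₀ (by positivity) this

/-- Both functions are integrable, with the same integral. -/
structure SameIntegral {X Y : Type*} [MeasurableSpace X] [MeasurableSpace Y] (μ : Measure X)
    (ν : Measure Y) (f : X → ℝ) (g : Y → ℝ) : Prop where
  left : Integrable f μ
  right : Integrable g ν
  eq : ∫ x, f x ∂μ = ∫ y, g y ∂ν

/-- A linear family of functions indexed by an algebra, normalized at `1`. -/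
structure IsLinearFamily {A X : Type*} [CommRing A] [Algebra ℂ A] [MeasurableSpace X]
    (μ : Measure X) (R : A → X → ℂ) : Prop where
  meas : ∀ f, AEStronglyMeasurable (R f) μ
  add_smul : ∀ (f g : A) (c : ℂ), R (f + c • g) =ᵐ[μ] fun x => R f x + c * R g x
  one : R 1 =ᵐ[μ] fun _ => 1

section

variable {X Y : Type*} [MeasurableSpace X] [MeasurableSpace Y] {μ : Measure X} {ν : Measure Y}

namespace SameIntegral

variable {f f' : X → ℝ} {g g' : Y → ℝ}

theorem add (h : SameIntegral μ ν f g) (h' : SameIntegral μ ν f' g') :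
    SameIntegral μ ν (fun x => f x + f' x) (fun y => g y + g' y) :=
  ⟨h.left.add h'.left, h.right.add h'.right, by
    rw [integral_add h.left h'.left, integral_add h.right h'.right, h.eq, h'.eq]⟩

theorem sub (h : SameIntegral μ ν f g) (h' : SameIntegral μ ν f' g') :
    SameIntegral μ ν (fun x => f x - f' x) (fun y => g y - g' y) :=
  ⟨h.left.sub h'.left, h.right.sub h'.right, by
    rw [integral_sub h.left h'.left, integral_sub h.right h'.right, h.eq, h'.eq]⟩

theorem const_mul (h : SameIntegral μ ν f g) (c : ℝ) :
    SameIntegral μ ν (fun x => c * f x) (fun y => c * g y) :=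
  ⟨h.left.const_mul c, h.right.const_mul c, by rw [integral_const_mul, integral_const_mul, h.eq]⟩

theorem congr (h : SameIntegral μ ν f g) (hf : f =ᵐ[μ] f') (hg : g =ᵐ[ν] g') :
    SameIntegral μ ν f' g' :=
  ⟨h.left.congr hf, h.right.congr hg, by
    rw [← integral_congr_ae hf, ← integral_congr_ae hg, h.eq]⟩

end SameIntegral

theorem lintegral_map_norm_add_rpow {q : ℝ} {H : X → ℂ} (hH : AEMeasurable H μ)
    (hi : ∀ w, Integrable (fun x => ‖H x + w‖ ^ q) μ) (w : ℂ) :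
    ∫⁻ x, ENNReal.ofReal (‖x + w‖ ^ q) ∂(μ.map H) = ENNReal.ofReal (∫ x, ‖H x + w‖ ^ q ∂μ) := by
  rw [lintegral_map' (by fun_prop) hH, ofReal_integral_eq_lintegral_ofReal (hi w)
    (Filter.Eventually.of_forall fun x => by positivity)]

theorem AEMeasurable.integrable_norm_pow_of_bound [IsFiniteMeasure μ] {F : X → ℂ}
    (hF : AEMeasurable F μ) (hb : ∃ C, ∀ᵐ x ∂μ, ‖F x‖ ≤ C) (k : ℕ) :
    Integrable (fun x => ‖F x‖ ^ k) μ := by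
  obtain ⟨C, hC⟩ := hb
  refine (integrable_const (C ^ k)).mono' (AEMeasurable.aestronglyMeasurable (by fun_prop)) ?_
  filter_upwards [hC] with x hx
  rw [Real.norm_of_nonneg (by positivity)]
  gcongr

/-- Functions with the same translated `q`-th moments have the same moments. -/
theorem sameIntegral_norm_pow_of_moments [IsFiniteMeasure μ] [IsFiniteMeasure ν] {q : ℝ}
    (hq : 0 < q) (hq2 : q < 2) (hmass : μ.real univ = ν.real univ) {F : X → ℂ} {G : Y → ℂ}
    (hF : AEMeasurable F μ) (hG : AEMeasurable G ν) (hb : ∃ C, ∀ᵐ y ∂ν, ‖G y‖ ≤ C)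
    (h : ∀ w, SameIntegral μ ν (fun x => ‖F x + w‖ ^ q) (fun y => ‖G y + w‖ ^ q)) (k : ℕ) :
    SameIntegral μ ν (fun x => ‖F x‖ ^ k) (fun y => ‖G y‖ ^ k) := by
  have hFw := lintegral_map_norm_add_rpow hF fun w => (h w).left
  have hGw := lintegral_map_norm_add_rpow hG fun w => (h w).right
  have hlaw : μ.map F = ν.map G := by
    refine measure_eq_of_lintegral_norm_add_rpow hq hq2 ?_ (fun w => ?_) fun w => ?_
    · rw [Measure.map_apply_of_aemeasurable hF MeasurableSet.univ,
        Measure.map_apply_of_aemeasurable hG MeasurableSet.univ, preimage_univ, preimage_univ]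
      exact (ENNReal.toReal_eq_toReal_iff' (measure_ne_top _ _) (measure_ne_top _ _)).mp hmass
    · rw [hFw]; exact ENNReal.ofReal_ne_top
    · rw [hFw, hGw, (h w).eq]
  have iG := hG.integrable_norm_pow_of_bound hb k
  have hm : ∀ κ : Measure ℂ, AEStronglyMeasurable (fun z : ℂ => ‖z‖ ^ k) κ := fun κ => by fun_prop
  have iF : Integrable (fun x => ‖F x‖ ^ k) μ := by
    have : Integrable (fun z : ℂ => ‖z‖ ^ k) (ν.map G) := (integrable_map_measure (hm _) hG).mpr iG
    rw [← hlaw] at this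
    exact (integrable_map_measure (hm _) hF).mp this
  refine ⟨iF, iG, ?_⟩
  rw [← integral_map (f := fun z : ℂ => ‖z‖ ^ k) hF (hm _),
    ← integral_map (f := fun z : ℂ => ‖z‖ ^ k) hG (hm _), hlaw]

/-- The measure with density `|g|²`. -/
noncomputable def sqWeight (μ : Measure X) (g : X → ℂ) : Measure X :=
  μ.withDensity fun x => ((‖g x‖₊ ^ 2 : NNReal) : ENNReal)

theorem integrable_sqWeight_iff {g : X → ℂ} (hg : AEMeasurable g μ) {h : X → ℝ} :
    Integrable h (sqWeight μ g) ↔ Integrable (fun x => h x * ‖g x‖ ^ 2) μ := by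
  rw [sqWeight, integrable_withDensity_iff_integrable_smul₀ (by fun_prop)]
  refine integrable_congr (Filter.Eventually.of_forall fun x => ?_)
  simp [NNReal.smul_def, mul_comm]

theorem integral_sqWeight {g : X → ℂ} (hg : AEMeasurable g μ) (h : X → ℝ) :
    ∫ x, h x ∂(sqWeight μ g) = ∫ x, h x * ‖g x‖ ^ 2 ∂μ := by
  rw [sqWeight, integral_withDensity_eq_integral_smul₀ (by fun_prop)]
  refine integral_congr_ae (Filter.Eventually.of_forall fun x => ?_)
  simp [NNReal.smul_def, mul_comm]

theorem sameIntegral_sqWeight_iff {g : X → ℂ} {k : Y → ℂ} (hg : AEMeasurable g μ)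
    (hk : AEMeasurable k ν) {h : X → ℝ} {l : Y → ℝ} :
    SameIntegral (sqWeight μ g) (sqWeight ν k) h l ↔
      SameIntegral μ ν (fun x => h x * ‖g x‖ ^ 2) (fun y => l y * ‖k y‖ ^ 2) := by
  constructor
  · rintro ⟨h1, h2, h3⟩
    rw [integral_sqWeight hg, integral_sqWeight hk] at h3
    exact ⟨(integrable_sqWeight_iff hg).mp h1, (integrable_sqWeight_iff hk).mp h2, h3⟩
  · rintro ⟨h1, h2, h3⟩
    rw [← integral_sqWeight hg, ← integral_sqWeight hk] at h3
    exact ⟨(integrable_sqWeight_iff hg).mpr h1, (integrable_sqWeight_iff hk).mpr h2, h3⟩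

theorem ae_sqWeight {g : X → ℂ} {P : X → Prop} (h : ∀ᵐ x ∂μ, P x) : ∀ᵐ x ∂(sqWeight μ g), P x :=
  (withDensity_absolutelyContinuous _ _).ae_le h

theorem norm_sq_mul_norm_sq (x y : ℂ) : ‖x‖ ^ 2 * ‖y‖ ^ 2 =
    1 / 16 * (‖x + 1 * y‖ ^ 4 + ‖x + (-1) * y‖ ^ 4 + ‖x + Complex.I * y‖ ^ 4 +
      ‖x + (-Complex.I) * y‖ ^ 4 - 4 * (‖x‖ ^ 4 + ‖y‖ ^ 4)) := by
  have h : ∀ z : ℂ, ‖z‖ ^ 4 = (Complex.normSq z) ^ 2 := fun z => by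
    rw [Complex.normSq_eq_norm_sq]; ring
  simp only [h, ← Complex.normSq_eq_norm_sq]
  simp only [Complex.normSq_apply, Complex.add_re, Complex.add_im, Complex.mul_re, Complex.mul_im,
    Complex.neg_re, Complex.neg_im, Complex.I_re, Complex.I_im, Complex.one_re, Complex.one_im]
  ring

theorem norm_mul_sub_mul_sq (x y u v : ℂ) : ‖x * y - u * v‖ ^ 2 =
    ‖x‖ ^ 2 * ‖y‖ ^ 2 + ‖u‖ ^ 2 * ‖v‖ ^ 2 - 1 / 8 *
      ((‖x + 1 * u‖ ^ 2 * ‖y + 1 * v‖ ^ 2 - ‖x + 1 * u‖ ^ 2 * ‖y + (-1) * v‖ ^ 2 -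
        (‖x + (-1) * u‖ ^ 2 * ‖y + 1 * v‖ ^ 2 - ‖x + (-1) * u‖ ^ 2 * ‖y + (-1) * v‖ ^ 2)) -
      (‖x + Complex.I * u‖ ^ 2 * ‖y + Complex.I * v‖ ^ 2 -
        ‖x + Complex.I * u‖ ^ 2 * ‖y + (-Complex.I) * v‖ ^ 2 -
        (‖x + (-Complex.I) * u‖ ^ 2 * ‖y + Complex.I * v‖ ^ 2 -
          ‖x + (-Complex.I) * u‖ ^ 2 * ‖y + (-Complex.I) * v‖ ^ 2))) := by
  simp only [← Complex.normSq_eq_norm_sq]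
  simp only [Complex.normSq_apply, Complex.add_re, Complex.add_im, Complex.sub_re, Complex.sub_im,
    Complex.mul_re, Complex.mul_im,
    Complex.neg_re, Complex.neg_im, Complex.I_re, Complex.I_im, Complex.one_re, Complex.one_im]
  ring

variable {A : Type*} [CommRing A] [Algebra ℂ A] {R : A → X → ℂ} {b : A → Y → ℂ}

theorem sameIntegral_norm_sq_mul_norm_sq [IsFiniteMeasure μ] [IsFiniteMeasure ν]
    (hmass : μ.real univ = ν.real univ) (hR : IsLinearFamily μ R) (hb : IsLinearFamily ν b)
    (hbd : ∀ f, ∃ C, ∀ᵐ y ∂ν, ‖b f y‖ ≤ C) {p : ℝ} (hp : 1 ≤ p) (hp2 : p ≠ 2)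
    (h : ∀ f, SameIntegral μ ν (fun x => ‖R f x‖ ^ p) (fun y => ‖b f y‖ ^ p)) (f g : A) :
    SameIntegral μ ν (fun x => ‖R f x‖ ^ 2 * ‖R g x‖ ^ 2)
      (fun y => ‖b f y‖ ^ 2 * ‖b g y‖ ^ 2) := by
  have hRm := fun f => (hR.meas f).aemeasurable
  have hbm := fun f => (hb.meas f).aemeasurable
  have hRw : ∀ (f : A) (w : ℂ), R (f + w • 1) =ᵐ[μ] fun x => R f x + w := fun f w => by
    filter_upwards [hR.add_smul f 1 w, hR.one] with x h1 h2
    rw [h1, h2, mul_one]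
  have hbw : ∀ (f : A) (w : ℂ), b (f + w • 1) =ᵐ[ν] fun y => b f y + w := fun f w => by
    filter_upwards [hb.add_smul f 1 w, hb.one] with x h1 h2
    rw [h1, h2, mul_one]
  rcases lt_or_gt_of_ne hp2 with hlt | hgt
  · have h4 : ∀ f, SameIntegral μ ν (fun x => ‖R f x‖ ^ 4) (fun y => ‖b f y‖ ^ 4) := fun f => by
      refine sameIntegral_norm_pow_of_moments (by linarith) hlt hmass (hRm f) (hbm f) (hbd f)
        (fun w => (h (f + w • 1)).congr ?_ ?_) 4
      · filter_upwards [hRw f w] with x hx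
        rw [hx]
      · filter_upwards [hbw f w] with x hx
        rw [hx]
    have hc : ∀ c : ℂ, SameIntegral μ ν (fun x => ‖R f x + c * R g x‖ ^ 4)
        (fun y => ‖b f y + c * b g y‖ ^ 4) := fun c => by
      refine (h4 (f + c • g)).congr ?_ ?_
      · filter_upwards [hR.add_smul f g c] with x hx
        rw [hx]
      · filter_upwards [hb.add_smul f g c] with x hx
        rw [hx]
    simp_rw [norm_sq_mul_norm_sq]
    exact (((((hc 1).add (hc (-1))).add (hc Complex.I)).add (hc (-Complex.I))).sub
      (((h4 f).add (h4 g)).const_mul 4)).const_mul (1 / 16)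
  · have hlin : ∀ (f g : A) (t : ℂ), SameIntegral μ ν (fun x => ‖R f x + t * R g x‖ ^ p)
        (fun y => ‖b f y + t * b g y‖ ^ p) := fun f g t => by
      refine (h (f + t • g)).congr ?_ ?_
      · filter_upwards [hR.add_smul f g t] with x hx
        rw [hx]
      · filter_upwards [hb.add_smul f g t] with x hx
        rw [hx]
    have key : ∀ f, SameIntegral μ ν (fun x => ‖R f x‖ ^ (p - 2) * ‖R g x‖ ^ 2)
        (fun y => ‖b f y‖ ^ (p - 2) * ‖b g y‖ ^ 2) := fun f =>
      ⟨integrable_norm_rpow_mul_sq hgt.le (hR.meas f) (hR.meas g) (h f).left (h g).left,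
        integrable_norm_rpow_mul_sq hgt.le (hb.meas f) (hb.meas g) (h f).right (h g).right,
        integral_norm_rpow_mul_sq_eq hgt.le (hR.meas f) (hR.meas g) (h f).left (h g).left
          (hb.meas f) (hb.meas g) (h f).right (h g).right fun t => (hlin f g t).eq⟩
    have key' : ∀ f, SameIntegral (sqWeight μ (R g)) (sqWeight ν (b g))
        (fun x => ‖R f x‖ ^ (p - 2)) (fun y => ‖b f y‖ ^ (p - 2)) := fun f =>
      (sameIntegral_sqWeight_iff (hRm g) (hbm g)).mpr (key f)
    have hRac : ∀ f, AEStronglyMeasurable (R f) (sqWeight μ (R g)) := fun f =>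
      (hR.meas f).mono_ac (withDensity_absolutelyContinuous _ _)
    have hbac : ∀ f, AEStronglyMeasurable (b f) (sqWeight ν (b g)) := fun f =>
      (hb.meas f).mono_ac (withDensity_absolutelyContinuous _ _)
    have hone : SameIntegral (sqWeight μ (R g)) (sqWeight ν (b g)) (fun _ => 1) (fun _ => 1) := by
      refine (key' 1).congr (ae_sqWeight ?_) (ae_sqWeight ?_)
      · filter_upwards [hR.one] with x hx
        rw [hx, norm_one, Real.one_rpow]
      · filter_upwards [hb.one] with x hx
        rw [hx, norm_one, Real.one_rpow]
    have fR : IsFiniteMeasure (sqWeight μ (R g)) :=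
      (integrable_const_iff_isFiniteMeasure one_ne_zero).mp hone.left
    have fb : IsFiniteMeasure (sqWeight ν (b g)) :=
      (integrable_const_iff_isFiniteMeasure one_ne_zero).mp hone.right
    rw [← sameIntegral_sqWeight_iff (hRm g) (hbm g)]
    rcases lt_or_ge (p - 2) 2 with hq | hq
    · refine sameIntegral_norm_pow_of_moments (q := p - 2) (by linarith) hq ?_
        (hRac f).aemeasurable (hbac f).aemeasurable ?_ (fun w => (key' (f + w • 1)).congr
          (ae_sqWeight ?_) (ae_sqWeight ?_)) 2
      · simpa using hone.eq
      · obtain ⟨C, hC⟩ := hbd f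
        exact ⟨C, ae_sqWeight hC⟩
      · filter_upwards [hRw f w] with x hx
        rw [hx]
      · filter_upwards [hbw f w] with x hx
        rw [hx]
    · have hoR : R 1 =ᵐ[sqWeight μ (R g)] fun _ => 1 := ae_sqWeight hR.one
      have hob : b 1 =ᵐ[sqWeight ν (b g)] fun _ => 1 := ae_sqWeight hb.one
      refine SameIntegral.congr (f := fun x => ‖R 1 x‖ ^ (p - 2 - 2) * ‖R f x‖ ^ 2)
        (g := fun y => ‖b 1 y‖ ^ (p - 2 - 2) * ‖b f y‖ ^ 2)
        ⟨integrable_norm_rpow_mul_sq hq (hRac 1) (hRac f) (key' 1).left (key' f).left,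
        integrable_norm_rpow_mul_sq hq (hbac 1) (hbac f) (key' 1).right (key' f).right,
        integral_norm_rpow_mul_sq_eq hq (hRac 1) (hRac f) (key' 1).left (key' f).left
          (hbac 1) (hbac f) (key' 1).right (key' f).right fun t => SameIntegral.eq (?_)⟩ ?_ ?_
      · refine (key' (1 + t • f)).congr (ae_sqWeight ?_) (ae_sqWeight ?_)
        · filter_upwards [hR.add_smul 1 f t] with x hx
          rw [hx]
        · filter_upwards [hb.add_smul 1 f t] with x hx
          rw [hx]
      · filter_upwards [hoR] with x hx
        rw [hx, norm_one, Real.one_rpow, one_mul]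
      · filter_upwards [hob] with x hx
        rw [hx, norm_one, Real.one_rpow, one_mul]

/-- A normalized `L^p`-isometric linear family, `p ≠ 2`, is multiplicative. -/
theorem IsLinearFamily.mul_ae_eq [IsFiniteMeasure μ] [IsFiniteMeasure ν]
    (hmass : μ.real univ = ν.real univ) (hR : IsLinearFamily μ R) (hb : IsLinearFamily ν b)
    (hbd : ∀ f, ∃ C, ∀ᵐ y ∂ν, ‖b f y‖ ≤ C) (hmul : ∀ f g, ∀ᵐ y ∂ν, b (f * g) y = b f y * b g y)
    {p : ℝ} (hp : 1 ≤ p) (hp2 : p ≠ 2)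
    (h : ∀ f, SameIntegral μ ν (fun x => ‖R f x‖ ^ p) (fun y => ‖b f y‖ ^ p)) (f g : A) :
    ∀ᵐ x ∂μ, R (f * g) x = R f x * R g x := by
  have hq := sameIntegral_norm_sq_mul_norm_sq hmass hR hb hbd hp hp2 h
  have hc : ∀ c d : ℂ, SameIntegral μ ν
      (fun x => ‖R f x + c * R (f * g) x‖ ^ 2 * ‖R g x + d * R 1 x‖ ^ 2)
      (fun y => ‖b f y + c * b (f * g) y‖ ^ 2 * ‖b g y + d * b 1 y‖ ^ 2) := fun c d => by
    refine (hq (f + c • (f * g)) (g + d • 1)).congr ?_ ?_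
    · filter_upwards [hR.add_smul f (f * g) c, hR.add_smul g 1 d] with x h1 h2
      rw [h1, h2]
    · filter_upwards [hb.add_smul f (f * g) c, hb.add_smul g 1 d] with x h1 h2
      rw [h1, h2]
  have key : SameIntegral μ ν (fun x => ‖R f x * R g x - R (f * g) x * R 1 x‖ ^ 2)
      (fun y => ‖b f y * b g y - b (f * g) y * b 1 y‖ ^ 2) := by
    simp_rw [norm_mul_sub_mul_sq]
    exact ((hq f g).add (hq (f * g) 1)).sub (((((hc 1 1).sub (hc 1 (-1))).sub
      ((hc (-1) 1).sub (hc (-1) (-1)))).sub (((hc Complex.I Complex.I).sub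
      (hc Complex.I (-Complex.I))).sub ((hc (-Complex.I) Complex.I).sub
      (hc (-Complex.I) (-Complex.I))))).const_mul (1 / 8))
  have h0 : ∫ y, ‖b f y * b g y - b (f * g) y * b 1 y‖ ^ 2 ∂ν = 0 := by
    refine integral_eq_zero_of_ae ?_
    filter_upwards [hmul f g, hb.one] with y h1 h2
    simp [h1, h2]
  have h1 := (integral_eq_zero_iff_of_nonneg (fun x => by positivity) key.left).mp (key.eq.trans h0)
  filter_upwards [h1, hR.one] with x h1 h2
  have h3 : ‖R f x * R g x - R (f * g) x * R 1 x‖ ^ 2 = 0 := h1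
  rw [sq_eq_zero_iff, norm_eq_zero, h2, mul_one, sub_eq_zero] at h3
  exact h3.symm

end

/-- Normalized Lebesgue measure on a period of the circle. -/
noncomputable def circleProb : Measure ℝ :=
  ENNReal.ofReal ((2 * π)⁻¹) • volume.restrict (Ioc 0 (2 * π))

/-- The standard parametrization of the unit circle. -/
noncomputable abbrev circ (θ : ℝ) : ℂ := circleMap 0 1 θ

instance : IsProbabilityMeasure circleProb := ⟨by
  rw [circleProb, Measure.smul_apply, Measure.restrict_apply_univ, Real.volume_Ioc, smul_eq_mul,
    ← ENNReal.ofReal_mul (by positivity), sub_zero, inv_mul_cancel₀ (by positivity),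
    ENNReal.ofReal_one]⟩

theorem continuous_circ : Continuous circ := continuous_circleMap 0 1

theorem norm_circ (θ : ℝ) : ‖circ θ‖ = 1 := by simp [circ]

theorem integral_circleProb (f : ℂ → ℝ) :
    ∫ θ, f (circ θ) ∂circleProb = circleAverage f 0 1 := by
  rw [circleProb, integral_smul_measure, circleAverage_def,
    intervalIntegral.integral_of_le (by positivity), ENNReal.toReal_ofReal (by positivity)]

theorem integrable_circleProb {f : ℂ → ℝ} (hf : CircleIntegrable f 0 1) :
    Integrable (fun θ => f (circ θ)) circleProb := by
  refine Integrable.smul_measure ?_ ENNReal.ofReal_ne_top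
  exact (intervalIntegrable_iff_integrableOn_Ioc_of_le (by positivity)).mp hf

theorem ae_circ_not_root {Q : Polynomial ℂ} (hQ : Q ≠ 0) :
    ∀ᵐ θ ∂circleProb, Q.eval (circ θ) ≠ 0 := by
  have hc : {θ : ℝ | Q.eval (circ θ) = 0}.Countable := by
    have h1 : ({z : ℂ | Q.eval z = 0}).Countable :=
      (Polynomial.finite_setOfPred_isRoot hQ).countable
    exact h1.preimage_circleMap 0 one_ne_zero
  have h0 : ∀ᵐ θ ∂(volume : Measure ℝ), Q.eval (circ θ) ≠ 0 := by
    rw [ae_iff]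
    simpa using hc.measure_zero volume
  exact (Measure.absolutelyContinuous_of_le Measure.restrict_le_self).smul_left _ |>.ae_le h0

theorem continuous_norm_eval_circ (Q : Polynomial ℂ) : Continuous fun θ => ‖Q.eval (circ θ)‖ :=
  (Q.continuous.comp continuous_circ).norm

theorem integrable_of_continuous_circ {f : ℝ → ℝ} (hf : Continuous f) {C : ℝ}
    (hC : ∀ θ, |f θ| ≤ C) : Integrable f circleProb :=
  (integrable_const C).mono' hf.aestronglyMeasurable (Filter.Eventually.of_forall hC)

theorem exists_norm_eval_circ_le (Q : Polynomial ℂ) : ∃ C, ∀ θ, ‖Q.eval (circ θ)‖ ≤ C := by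
  obtain ⟨C, hC⟩ := (isCompact_sphere (0 : ℂ) 1).exists_bound_of_continuousOn
    Q.continuous.continuousOn
  exact ⟨C, fun θ => hC _ (by simp [circ])⟩

theorem integrable_sqrt_norm_eval (Q : Polynomial ℂ) :
    Integrable (fun θ => √‖Q.eval (circ θ)‖) circleProb := by
  obtain ⟨C, hC⟩ := exists_norm_eval_circ_le Q
  refine integrable_of_continuous_circ (continuous_norm_eval_circ Q).sqrt (C := √C) fun θ => ?_
  rw [abs_of_nonneg (Real.sqrt_nonneg _)]
  exact Real.sqrt_le_sqrt (hC θ)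

theorem abs_log_max_min_le {ε : ℝ} (hε : 0 < ε) (hε1 : ε ≤ 1) (x : ℝ) :
    |Real.log (max (min x 1) ε)| ≤ -Real.log ε := by
  have h1 : ε ≤ max (min x 1) ε := le_max_right _ _
  have h2 : max (min x 1) ε ≤ 1 := max_le (min_le_right _ _) hε1
  rw [abs_of_nonpos (Real.log_nonpos (hε.le.trans h1) h2)]
  exact neg_le_neg (Real.log_le_log hε h1)

theorem continuous_log_max_min {ε : ℝ} (hε : 0 < ε) :
    Continuous fun x : ℝ => Real.log (max (min x 1) ε) :=
  Continuous.log (by fun_prop) fun x => (hε.trans_le (le_max_right _ _)).ne'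

theorem log_norm_coeff_zero_le {Q : Polynomial ℂ} (hQ : Q.coeff 0 ≠ 0) {E : Set ℝ}
    (hE : MeasurableSet E) {ε : ℝ} (hε : 0 < ε) (hε1 : ε ≤ 1) :
    Real.log ‖Q.coeff 0‖ ≤ 2 * ∫ θ, √‖Q.eval (circ θ)‖ ∂circleProb +
      ∫ θ in E, Real.log (max (min ‖Q.eval (circ θ)‖ 1) ε) ∂circleProb := by
  have hQ0 : Q ≠ 0 := by rintro rfl; simp at hQ
  have h1 := Q.norm_coeff_le_choose_mul_mahlerMeasure 0
  rw [Nat.choose_zero_right, Nat.cast_one, one_mul, Q.mahlerMeasure_def_of_ne_zero hQ0] at h1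
  have h2 : Real.log ‖Q.coeff 0‖ ≤ Q.logMahlerMeasure := by
    rw [Real.log_le_iff_le_exp (norm_pos_iff.mpr hQ)]; exact h1
  refine h2.trans ?_
  rw [Polynomial.logMahlerMeasure_def,
    ← integral_circleProb (fun x => Real.log ‖Polynomial.eval x Q‖), ← integral_const_mul,
    ← integral_indicator hE, ← integral_add]
  rotate_left
  · exact (integrable_sqrt_norm_eval Q).const_mul 2
  · refine Integrable.indicator ?_ hE
    exact integrable_of_continuous_circ
      ((continuous_log_max_min hε).comp (continuous_norm_eval_circ Q))
      fun θ => abs_log_max_min_le hε hε1 _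
  refine integral_mono_ae (integrable_circleProb (f := fun x => Real.log ‖Polynomial.eval x Q‖)
    Q.intervalIntegrable_mahlerMeasure) ?_ ?_
  · refine ((integrable_sqrt_norm_eval Q).const_mul 2).add (Integrable.indicator ?_ hE)
    exact integrable_of_continuous_circ
      ((continuous_log_max_min hε).comp (continuous_norm_eval_circ Q))
      fun θ => abs_log_max_min_le hε hε1 _
  · filter_upwards [ae_circ_not_root hQ0] with θ hθ
    have hx : 0 < ‖Q.eval (circ θ)‖ := norm_pos_iff.mpr hθ
    set x := ‖Q.eval (circ θ)‖ with hxdef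
    have hs : 0 ≤ √x := Real.sqrt_nonneg _
    have hlog : Real.log x ≤ 2 * √x := by
      have h3 := Real.log_sqrt hx.le
      have h4 := Real.log_le_sub_one_of_pos (Real.sqrt_pos.mpr hx)
      linarith
    by_cases hθE : θ ∈ E
    · rw [indicator_of_mem hθE]
      rcases le_total 1 x with h | h
      · rw [← hxdef, min_eq_right h, max_eq_left hε1, Real.log_one]
        linarith
      · rw [← hxdef, min_eq_left h]
        have := Real.log_le_log hx (le_max_left x ε)
        linarith
    · rw [indicator_of_notMem hθE]
      linarith

open Filter Topology in
theorem tendsto_coeff_zero {Q : ℕ → Polynomial ℂ} {K : ℝ}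
    (hK : ∀ n, ∫ θ, √‖(Q n).eval (circ θ)‖ ∂circleProb ≤ K) {E : Set ℝ} (hE : MeasurableSet E)
    (hE0 : circleProb E ≠ 0)
    (h : ∀ᵐ θ ∂circleProb, θ ∈ E → Tendsto (fun n => (Q n).eval (circ θ)) atTop (𝓝 0)) :
    Tendsto (fun n => (Q n).coeff 0) atTop (𝓝 0) := by
  set m := circleProb.real E with hm
  have hm0 : 0 < m := ENNReal.toReal_pos hE0 (measure_ne_top _ _)
  rw [tendsto_zero_iff_norm_tendsto_zero]
  refine tendsto_order.mpr ⟨fun a ha => Eventually.of_forall fun n => ha.trans_le (norm_nonneg _),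
    fun δ hδ => ?_⟩
  set ε := min 1 (Real.exp ((Real.log δ - 1 - 2 * K) / m)) with hεdef
  have hε : 0 < ε := lt_min one_pos (Real.exp_pos _)
  have hε1 : ε ≤ 1 := min_le_left _ _
  have hmε : m * Real.log ε ≤ Real.log δ - 1 - 2 * K := by
    have h1 : Real.log ε ≤ (Real.log δ - 1 - 2 * K) / m := by
      rw [Real.log_le_iff_le_exp hε]; exact min_le_right _ _
    calc m * Real.log ε ≤ m * ((Real.log δ - 1 - 2 * K) / m) := by gcongr
      _ = _ := by field_simp
  have hlim : Tendsto (fun n => ∫ θ in E, Real.log (max (min ‖(Q n).eval (circ θ)‖ 1) ε)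
      ∂circleProb) atTop (𝓝 (∫ θ in E, Real.log ε ∂circleProb)) := by
    refine tendsto_integral_of_dominated_convergence (fun _ => -Real.log ε) (fun n => ?_)
      (integrable_const _) (fun n => Eventually.of_forall fun θ => abs_log_max_min_le hε hε1 _) ?_
    · exact ((continuous_log_max_min hε).comp (continuous_norm_eval_circ (Q n))).aestronglyMeasurable
    · filter_upwards [ae_restrict_of_ae h, ae_restrict_mem hE] with θ h1 h2
      have h3 := ((continuous_log_max_min hε).tendsto 0).comp
        (tendsto_zero_iff_norm_tendsto_zero.mp (h1 h2))
      rwa [min_eq_left zero_le_one, max_eq_right hε.le] at h3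
  rw [setIntegral_const, smul_eq_mul, ← hm] at hlim
  filter_upwards [hlim.eventually (gt_mem_nhds (lt_add_one (m * Real.log ε)))] with n hn
  by_cases hc : (Q n).coeff 0 = 0
  · rw [hc, norm_zero]; exact hδ
  have h1 := log_norm_coeff_zero_le hc hE hε hε1
  refine (Real.log_lt_log_iff (norm_pos_iff.mpr hc) hδ).mp ?_
  linarith [hK n]

open Filter Topology in
theorem tendsto_coeff {E : Set ℝ} (hE : MeasurableSet E) (hE0 : circleProb E ≠ 0) (k : ℕ) :
    ∀ {Q : ℕ → Polynomial ℂ} {K : ℝ}, (∀ n, ∫ θ, √‖(Q n).eval (circ θ)‖ ∂circleProb ≤ K) →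
    (∀ᵐ θ ∂circleProb, θ ∈ E → Tendsto (fun n => (Q n).eval (circ θ)) atTop (𝓝 0)) →
    Tendsto (fun n => (Q n).coeff k) atTop (𝓝 0) := by
  induction k with
  | zero => exact fun hK h => tendsto_coeff_zero hK hE hE0 h
  | succ k ih =>
    intro Q K hK h
    have h0 := tendsto_coeff_zero hK hE hE0 h
    obtain ⟨C, hC⟩ := h0.norm.bddAbove_range
    have hdiv : ∀ n θ, (Q n).divX.eval (circ θ) * circ θ =
        (Q n).eval (circ θ) - (Q n).coeff 0 := fun n θ => by
      have := congrArg (Polynomial.eval (circ θ)) (Q n).divX_mul_X_add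
      simp only [Polynomial.eval_add, Polynomial.eval_mul, Polynomial.eval_X,
        Polynomial.eval_C] at this
      rw [← this]; ring
    have hcoeff : ∀ n, (Q n).coeff (k + 1) = (Q n).divX.coeff k := fun n =>
      (Polynomial.coeff_divX).symm
    simp_rw [hcoeff]
    refine ih (K := K + √C) (fun n => ?_) ?_
    · have hle : ∀ θ, √‖(Q n).divX.eval (circ θ)‖ ≤ √‖(Q n).eval (circ θ)‖ + √C := fun θ => by
        have e : ‖(Q n).divX.eval (circ θ)‖ = ‖(Q n).eval (circ θ) - (Q n).coeff 0‖ := by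
          rw [← hdiv, norm_mul, norm_circ, mul_one]
        have hCn : ‖(Q n).coeff 0‖ ≤ C := hC ⟨n, rfl⟩
        rw [e]
        refine Real.sqrt_le_iff.mpr ⟨by positivity, (norm_sub_le _ _).trans ?_⟩
        have hC0 := (norm_nonneg _).trans hCn
        have := mul_nonneg (Real.sqrt_nonneg ‖(Q n).eval (circ θ)‖) (Real.sqrt_nonneg C)
        nlinarith [Real.sq_sqrt (norm_nonneg ((Q n).eval (circ θ))), Real.sq_sqrt hC0]
      refine (integral_mono (integrable_sqrt_norm_eval _)
        ((integrable_sqrt_norm_eval _).add (integrable_const _)) hle).trans ?_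
      rw [integral_add' (integrable_sqrt_norm_eval _) (integrable_const _)]
      simpa using hK n
    · filter_upwards [h] with θ hθ hθE
      have h1 := (hθ hθE).sub h0
      rw [sub_zero] at h1
      rw [tendsto_zero_iff_norm_tendsto_zero] at h1 ⊢
      refine h1.congr fun n => ?_
      rw [← hdiv, norm_mul, norm_circ, mul_one]

theorem iteratedDeriv_eval (P : Polynomial ℂ) (k : ℕ) :
    iteratedDeriv k (fun z => P.eval z) = fun z => (Polynomial.derivative^[k] P).eval z := by
  induction k with
  | zero => simp
  | succ k ih =>
    rw [iteratedDeriv_succ, ih, Function.iterate_succ_apply']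
    funext z
    exact Polynomial.deriv _

theorem coeff_eq_iteratedDeriv (P : Polynomial ℂ) (k : ℕ) :
    P.coeff k = (k.factorial : ℂ)⁻¹ * iteratedDeriv k (fun z => P.eval z) 0 := by
  simp only [iteratedDeriv_eval]
  rw [← Polynomial.coeff_zero_eq_eval_zero, Polynomial.coeff_iterate_derivative,
    zero_add, Nat.descFactorial_self, nsmul_eq_mul, inv_mul_cancel_left₀]
  exact_mod_cast k.factorial_ne_zero

open Filter Topology in
/-- A two-constants type uniqueness principle: polynomials converging to zero on a set of positive
measure of the circle, and suitably bounded, converge to zero inside the disc. -/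
theorem tendsto_eval_zero {E : Set ℝ} (hE : MeasurableSet E) (hE0 : circleProb E ≠ 0)
    {Q : ℕ → Polynomial ℂ} {K : ℝ} (hK : ∀ n, ∫ θ, √‖(Q n).eval (circ θ)‖ ∂circleProb ≤ K)
    (h : ∀ᵐ θ ∂circleProb, θ ∈ E → Tendsto (fun n => (Q n).eval (circ θ)) atTop (𝓝 0))
    (hb : ∀ ρ ∈ Ioo (0 : ℝ) 1, ∃ C, ∀ n z, ‖z‖ ≤ ρ → ‖(Q n).eval z‖ ≤ C) {z : ℂ}
    (hz : z ∈ ball (0 : ℂ) 1) : Tendsto (fun n => (Q n).eval z) atTop (𝓝 0) := by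
  obtain ⟨ρ, h1, h2⟩ := exists_between (mem_ball_zero_iff.mp hz)
  have hρ : ρ ∈ Ioo (0 : ℝ) 1 := ⟨(norm_nonneg z).trans_lt h1, h2⟩
  obtain ⟨C, hC⟩ := hb ρ hρ
  have hcoeff : ∀ n k, ‖(Q n).coeff k‖ ≤ C / ρ ^ k := fun n k => by
    have := norm_taylorCoeff_le (Q n).differentiable.differentiableOn hρ (hC n) k
    rwa [← coeff_eq_iteratedDeriv] at this
  have e : ∀ n, (Q n).eval z = ∑' k, (Q n).coeff k * z ^ k := fun n => by
    rw [Polynomial.eval_eq_sum_range, tsum_eq_sum]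
    intro k hk
    rw [Finset.mem_range, not_lt] at hk
    rw [Polynomial.coeff_eq_zero_of_natDegree_lt (by omega), zero_mul]
  simp_rw [e]
  have hlim := tendsto_tsum_of_dominated_convergence (𝓕 := atTop) (f := fun n k => (Q n).coeff k * z ^ k)
    (g := fun _ => (0 : ℂ)) (bound := fun k => C * (‖z‖ / ρ) ^ k) ?_ (fun k => ?_)
    (Eventually.of_forall fun n k => ?_)
  · simpa using hlim
  · exact (summable_geometric_of_lt_one (div_nonneg (norm_nonneg _) hρ.1.le)
      ((div_lt_one hρ.1).mpr h1)).mul_left C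
  · simpa using (tendsto_coeff hE hE0 k hK h).mul_const (z ^ k)
  · rw [norm_mul, norm_pow, div_pow]
    calc _ ≤ C / ρ ^ k * ‖z‖ ^ k := mul_le_mul_of_nonneg_right (hcoeff n k) (by positivity)
      _ = _ := by ring

theorem memLp_eval_circ {q : ENNReal} (P : Polynomial ℂ) :
    MemLp (fun θ => P.eval (circ θ)) q circleProb := by
  obtain ⟨C, hC⟩ := exists_norm_eval_circ_le P
  exact MemLp.of_bound (P.continuous.comp continuous_circ).aestronglyMeasurable C
    (Filter.Eventually.of_forall hC)

namespace Hp

variable {p : ℝ} [hp : Fact (1 ≤ p)]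

instance fact_one_le_ofReal : Fact (1 ≤ ENNReal.ofReal p) :=
  ⟨by rw [ENNReal.one_le_ofReal]; exact hp.out⟩

theorem ofReal_ne_zero : ENNReal.ofReal p ≠ 0 := by
  rw [Ne, ENNReal.ofReal_eq_zero, not_le]; exact p_pos p

theorem toReal_ofReal : (ENNReal.ofReal p).toReal = p := ENNReal.toReal_ofReal (p_pos p).le

theorem integrable_norm_rpow_Lp {X : Type*} [MeasurableSpace X] {μ : Measure X}
    (F : Lp ℂ (ENNReal.ofReal p) μ) : Integrable (fun x => ‖F x‖ ^ p) μ := by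
  have := (integrable_norm_rpow_iff (Lp.aestronglyMeasurable F) (ofReal_ne_zero (p := p))
    ENNReal.ofReal_ne_top).mpr (Lp.memLp F)
  rwa [toReal_ofReal] at this

theorem norm_Lp_rpow {X : Type*} [MeasurableSpace X] {μ : Measure X}
    (F : Lp ℂ (ENNReal.ofReal p) μ) : ‖F‖ ^ p = ∫ x, ‖F x‖ ^ p ∂μ := by
  have hp0 := p_pos p
  have h0 : 0 ≤ ∫ x, ‖F x‖ ^ p ∂μ := integral_nonneg fun x => by positivity
  rw [Lp.norm_def, (Lp.memLp F).eLpNorm_eq_integral_rpow_norm ofReal_ne_zero ENNReal.ofReal_ne_top,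
    toReal_ofReal (p := p), ENNReal.toReal_ofReal (by positivity), ← Real.rpow_mul h0,
    inv_mul_cancel₀ hp0.ne', Real.rpow_one]

/-- Boundary values of polynomials. -/
noncomputable def polyLp (p : ℝ) [Fact (1 ≤ p)] :
    Polynomial ℂ →ₗ[ℂ] Lp ℂ (ENNReal.ofReal p) circleProb where
  toFun P := (memLp_eval_circ P).toLp
  map_add' P Q := by
    rw [← MemLp.toLp_add]
    exact MemLp.toLp_congr _ _ (Filter.Eventually.of_forall fun θ => by simp)
  map_smul' c P := by
    rw [RingHom.id_apply, ← MemLp.toLp_const_smul]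
    exact MemLp.toLp_congr _ _ (Filter.Eventually.of_forall fun θ => by simp)

theorem coeFn_polyLp (P : Polynomial ℂ) :
    polyLp p P =ᵐ[circleProb] fun θ => P.eval (circ θ) := (memLp_eval_circ P).coeFn_toLp

theorem integral_norm_eval_rpow (P : Polynomial ℂ) :
    ∫ θ, ‖P.eval (circ θ)‖ ^ p ∂circleProb = ‖ofPoly p P‖ ^ p := by
  rw [norm_ofPoly_rpow, pMean, ← integral_circleProb]

theorem norm_polyLp (P : Polynomial ℂ) : ‖polyLp p P‖ = ‖ofPoly p P‖ := by
  have h : ‖polyLp p P‖ ^ p = ‖ofPoly p P‖ ^ p := by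
    rw [norm_Lp_rpow, ← integral_norm_eval_rpow]
    refine integral_congr_ae ?_
    filter_upwards [coeFn_polyLp (p := p) P] with θ hθ
    rw [hθ]
  exact (Real.rpow_left_inj (norm_nonneg _) (norm_nonneg _) (p_pos p).ne').mp h

/-- Boundary values of functions in the Hardy space. -/
noncomputable def boundary (p : ℝ) [hp : Fact (1 ≤ p)] :
    Hp p →L[ℂ] Lp ℂ (ENNReal.ofReal p) circleProb :=
  (polyLp p).extendOfNorm (ofPoly p)

theorem boundary_ofPoly (P : Polynomial ℂ) : boundary p (ofPoly p P) = polyLp p P :=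
  LinearMap.extendOfNorm_eq (denseRange_ofPoly p)
    ⟨1, fun P => by rw [one_mul, norm_polyLp]⟩ P

theorem norm_boundary (F : Hp p) : ‖boundary p F‖ = ‖F‖ := by
  refine (denseRange_ofPoly p).induction_on (p := fun F => ‖boundary p F‖ = ‖F‖) F ?_ fun P => ?_
  · exact isClosed_eq (boundary p).continuous.norm continuous_norm
  · rw [boundary_ofPoly, norm_polyLp]

theorem integral_norm_boundary_rpow (F : Hp p) :
    ∫ θ, ‖boundary p F θ‖ ^ p ∂circleProb = ‖F‖ ^ p := by
  rw [← norm_Lp_rpow, norm_boundary]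

open Filter Topology in
theorem exists_poly_seq (F : Hp p) : ∃ P : ℕ → Polynomial ℂ,
    Tendsto (fun n => ofPoly p (P n)) atTop (𝓝 F) ∧
    ∀ᵐ θ ∂circleProb, Tendsto (fun n => (P n).eval (circ θ)) atTop (𝓝 (boundary p F θ)) := by
  obtain ⟨x, hx, hlim⟩ := mem_closure_iff_seq_limit.mp (denseRange_ofPoly p F)
  choose P hP using hx
  have h1 : Tendsto (fun n => ofPoly p (P n)) atTop (𝓝 F) := by simpa only [hP] using hlim
  have h2 := ((boundary p).continuous.tendsto F).comp h1
  obtain ⟨σ, hσ, hae⟩ := (tendstoInMeasure_of_tendsto_Lp h2).exists_seq_tendsto_ae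
  refine ⟨fun n => P (σ n), h1.comp hσ.tendsto_atTop, ?_⟩
  have h3 : ∀ᵐ θ ∂circleProb, ∀ n, polyLp p (P (σ n)) θ = (P (σ n)).eval (circ θ) :=
    ae_all_iff.mpr fun n => coeFn_polyLp _
  filter_upwards [hae, h3] with θ a1 a2
  refine a1.congr fun n => ?_
  simp only [Function.comp, boundary_ofPoly]
  exact a2 n

open Filter Topology in
theorem tendsto_apply {F : ℕ → Hp p} {G : Hp p} (h : Tendsto F atTop (𝓝 G)) {z : ℂ}
    (hz : z ∈ ball (0 : ℂ) 1) : Tendsto (fun n => F n z) atTop (𝓝 (G z)) := by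
  rw [tendsto_iff_dist_tendsto_zero] at h ⊢
  have h1 := h.const_mul ((4 / (1 - ‖z‖)) ^ (1 / p))
  rw [mul_zero] at h1
  refine squeeze_zero (fun _ => dist_nonneg) (fun n => ?_) h1
  rw [dist_eq_norm, dist_eq_norm, ← sub_apply]
  exact norm_apply_le _ (mem_ball_zero_iff.mp hz)

open Filter Topology in
theorem exists_bound_of_tendsto {P : ℕ → Polynomial ℂ} {F : Hp p}
    (h : Tendsto (fun n => ofPoly p (P n)) atTop (𝓝 F)) :
    (∃ K, ∀ n, ∫ θ, ‖(P n).eval (circ θ)‖ ∂circleProb ≤ K) ∧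
    ∀ ρ ∈ Ioo (0 : ℝ) 1, ∃ C, ∀ n z, ‖z‖ ≤ ρ → ‖(P n).eval z‖ ≤ C := by
  have hp0 := p_pos p
  obtain ⟨M, hM⟩ := h.norm.bddAbove_range
  have hM' : ∀ n, ‖ofPoly p (P n)‖ ≤ M := fun n => hM ⟨n, rfl⟩
  constructor
  · refine ⟨1 + M ^ p, fun n => ?_⟩
    obtain ⟨C, hC⟩ := exists_norm_eval_circ_le (P n)
    have i1 : Integrable (fun θ => ‖(P n).eval (circ θ)‖) circleProb :=
      integrable_of_continuous_circ (continuous_norm_eval_circ _) (C := C) fun θ => by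
        rw [abs_of_nonneg (norm_nonneg _)]; exact hC θ
    have i2 : Integrable (fun θ => ‖(P n).eval (circ θ)‖ ^ p) circleProb :=
      integrable_of_continuous_circ ((continuous_norm_eval_circ _).rpow_const
        fun _ => Or.inr hp0.le) (C := C ^ p) fun θ => by
        rw [abs_of_nonneg (by positivity)]
        exact Real.rpow_le_rpow (norm_nonneg _) (hC θ) hp0.le
    calc ∫ θ, ‖(P n).eval (circ θ)‖ ∂circleProb
        ≤ ∫ θ, (1 + ‖(P n).eval (circ θ)‖ ^ p) ∂circleProb := by
          refine integral_mono i1 ((integrable_const _).add i2) fun θ => ?_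
          set x := ‖(P n).eval (circ θ)‖
          have hx : 0 ≤ x := norm_nonneg _
          show x ≤ 1 + x ^ p
          rcases le_total x 1 with h1 | h1
          · have : 0 ≤ x ^ p := by positivity
            linarith
          · have := Real.rpow_le_rpow_of_exponent_le h1 hp.out
            rw [Real.rpow_one] at this
            linarith
      _ = 1 + ‖ofPoly p (P n)‖ ^ p := by
          rw [integral_add (integrable_const _) i2, integral_norm_eval_rpow]; simp
      _ ≤ 1 + M ^ p := by
          gcongr
          exact hM' n
  · intro ρ hρ
    refine ⟨(4 / (1 - ρ)) ^ (1 / p) * M, fun n z hz => ?_⟩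
    have hz1 : ‖z‖ < 1 := hz.trans_lt hρ.2
    have h1 := norm_apply_le (ofPoly p (P n)) hz1
    rw [ofPoly_apply _ (mem_ball_zero_iff.mpr hz1)] at h1
    have h2 : 0 < 1 - ρ := by linarith [hρ.2]
    refine h1.trans ?_
    have h3 : 0 ≤ M := (norm_nonneg _).trans (hM' 0)
    have h4 : 4 / (1 - ‖z‖) ≤ 4 / (1 - ρ) := by gcongr
    have h5 : 0 ≤ 4 / (1 - ‖z‖) := div_nonneg (by norm_num) (by linarith)
    exact mul_le_mul (Real.rpow_le_rpow h5 h4 (by positivity)) (hM' n) (norm_nonneg _)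
      (by positivity)

open Filter Topology in
/-- Boundary identities between products hold inside the disc. -/
theorem mul_eq_mul_of_boundary {F₁ F₂ F₃ F₄ : Hp p} {E : Set ℝ} (hE : MeasurableSet E)
    (hE0 : circleProb E ≠ 0)
    (h : ∀ᵐ θ ∂circleProb, θ ∈ E →
      boundary p F₁ θ * boundary p F₂ θ = boundary p F₃ θ * boundary p F₄ θ) {z : ℂ}
    (hz : z ∈ ball (0 : ℂ) 1) : F₁ z * F₂ z = F₃ z * F₄ z := by
  obtain ⟨P₁, l1, a1⟩ := exists_poly_seq F₁
  obtain ⟨P₂, l2, a2⟩ := exists_poly_seq F₂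
  obtain ⟨P₃, l3, a3⟩ := exists_poly_seq F₃
  obtain ⟨P₄, l4, a4⟩ := exists_poly_seq F₄
  obtain ⟨⟨K₁, k1⟩, b1⟩ := exists_bound_of_tendsto l1
  obtain ⟨⟨K₂, k2⟩, b2⟩ := exists_bound_of_tendsto l2
  obtain ⟨⟨K₃, k3⟩, b3⟩ := exists_bound_of_tendsto l3
  obtain ⟨⟨K₄, k4⟩, b4⟩ := exists_bound_of_tendsto l4
  have key := tendsto_eval_zero (Q := fun n => P₁ n * P₂ n - P₃ n * P₄ n) hE hE0
    (K := K₁ + K₂ + K₃ + K₄) (fun n => ?_) ?_ ?_ hz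
  · have e : ∀ {P : ℕ → Polynomial ℂ} {F : Hp p},
        Tendsto (fun n => ofPoly p (P n)) atTop (𝓝 F) →
        Tendsto (fun n => (P n).eval z) atTop (𝓝 (F z)) := fun h =>
      (tendsto_apply h hz).congr fun n => ofPoly_apply _ hz
    have h2 := ((e l1).mul (e l2)).sub ((e l3).mul (e l4))
    refine sub_eq_zero.mp (tendsto_nhds_unique h2 (key.congr fun n => by simp))
  · have i : ∀ Q : Polynomial ℂ, Integrable (fun θ => ‖Q.eval (circ θ)‖) circleProb := fun Q => by
      obtain ⟨C, hC⟩ := exists_norm_eval_circ_le Q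
      exact integrable_of_continuous_circ (continuous_norm_eval_circ _) (C := C) fun θ => by
        rw [abs_of_nonneg (norm_nonneg _)]; exact hC θ
    calc ∫ θ, √‖(P₁ n * P₂ n - P₃ n * P₄ n).eval (circ θ)‖ ∂circleProb
        ≤ ∫ θ, (‖(P₁ n).eval (circ θ)‖ + ‖(P₂ n).eval (circ θ)‖ + ‖(P₃ n).eval (circ θ)‖ +
            ‖(P₄ n).eval (circ θ)‖) ∂circleProb := by
          refine integral_mono (integrable_sqrt_norm_eval _)
            ((((i _).add (i _)).add (i _)).add (i _)) fun θ => ?_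
          refine Real.sqrt_le_iff.mpr ⟨by positivity, ?_⟩
          rw [Polynomial.eval_sub, Polynomial.eval_mul, Polynomial.eval_mul]
          refine (norm_sub_le _ _).trans ?_
          rw [norm_mul, norm_mul]
          have n1 := norm_nonneg ((P₁ n).eval (circ θ))
          have n2 := norm_nonneg ((P₂ n).eval (circ θ))
          have n3 := norm_nonneg ((P₃ n).eval (circ θ))
          have n4 := norm_nonneg ((P₄ n).eval (circ θ))
          nlinarith [mul_nonneg n1 n2, mul_nonneg n1 n3, mul_nonneg n1 n4, mul_nonneg n2 n3,
            mul_nonneg n2 n4, mul_nonneg n3 n4]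
      _ = _ := by
          exact (integral_add (((i _).add (i _)).add (i _)) (i _)).trans (congrArg (· + _)
            ((integral_add ((i _).add (i _)) (i _)).trans (congrArg (· + _)
              (integral_add (i _) (i _)))))
      _ ≤ K₁ + K₂ + K₃ + K₄ := add_le_add (add_le_add (add_le_add (k1 n) (k2 n)) (k3 n)) (k4 n)
  · filter_upwards [h, a1, a2, a3, a4] with θ h0 h1 h2 h3 h4 hθ
    have := (h1.mul h2).sub (h3.mul h4)
    rw [h0 hθ, sub_self] at this
    exact this.congr fun n => by simp
  · intro ρ hρ
    obtain ⟨C₁, c1⟩ := b1 ρ hρ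
    obtain ⟨C₂, c2⟩ := b2 ρ hρ
    obtain ⟨C₃, c3⟩ := b3 ρ hρ
    obtain ⟨C₄, c4⟩ := b4 ρ hρ
    refine ⟨C₁ * C₂ + C₃ * C₄, fun n z hz => ?_⟩
    rw [Polynomial.eval_sub, Polynomial.eval_mul, Polynomial.eval_mul]
    refine (norm_sub_le _ _).trans ?_
    rw [norm_mul, norm_mul]
    exact add_le_add
      (mul_le_mul (c1 n z hz) (c2 n z hz) (norm_nonneg _) ((norm_nonneg _).trans (c1 n z hz)))
      (mul_le_mul (c3 n z hz) (c4 n z hz) (norm_nonneg _) ((norm_nonneg _).trans (c3 n z hz)))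

/-- Boundary values of a nonzero function are almost everywhere nonzero. -/
theorem ae_boundary_ne_zero {F : Hp p} (hF : F ≠ 0) : ∀ᵐ θ ∂circleProb, boundary p F θ ≠ 0 := by
  by_contra hcon
  have hE : MeasurableSet {θ | boundary p F θ = 0} :=
    (Lp.stronglyMeasurable (boundary p F)).measurable (measurableSet_singleton 0)
  have hE0 : circleProb {θ | boundary p F θ = 0} ≠ 0 := by
    intro h0
    refine hcon (ae_iff.mpr ?_)
    simpa using h0
  refine hF (ext fun z hz => ?_)
  have := mul_eq_mul_of_boundary (F₁ := F) (F₂ := ofPoly p 1) (F₃ := 0) (F₄ := 0) hE hE0 (by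
    rw [map_zero]
    filter_upwards [Lp.coeFn_zero ℂ (ENNReal.ofReal p) circleProb] with θ h1 h2
    rw [h1, show boundary p F θ = 0 from h2]; simp) hz
  rw [ofPoly_apply _ hz, Polynomial.eval_one, mul_one, zero_apply, mul_zero] at this
  rw [this, zero_apply]

end Hp

namespace Hp

variable {p : ℝ} [hp : Fact (1 ≤ p)]

theorem ofPoly_ne_zero {P : Polynomial ℂ} (hP : P ≠ 0) : ofPoly p P ≠ 0 := by
  intro h
  have hinf : (ball (0 : ℂ) 1).Infinite := by
    refine infinite_of_mem_nhds (0 : ℂ) (ball_mem_nhds _ one_pos)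
  refine hP (Polynomial.eq_zero_of_infinite_isRoot P (hinf.mono fun z hz => ?_))
  have := ofPoly_apply (p := p) P hz
  rw [h, zero_apply] at this
  exact this.symm

/-- Isometries of the Hardy space, `p ≠ 2`, are multiplicative after normalization at `1`. -/
theorem isometry_one_mul (hp2 : p ≠ 2) (T : Hp p →ₗᵢ[ℂ] Hp p) (f g : Polynomial ℂ) {z : ℂ}
    (hz : z ∈ ball (0 : ℂ) 1) :
    T (ofPoly p 1) z * T (ofPoly p (f * g)) z = T (ofPoly p f) z * T (ofPoly p g) z := by
  have hp0 := p_pos p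
  set h : ℝ → ℂ := fun θ => boundary p (T (ofPoly p 1)) θ with hh
  have hne : ∀ᵐ θ ∂circleProb, h θ ≠ 0 := ae_boundary_ne_zero
    ((map_ne_zero_iff T T.injective).mpr (ofPoly_ne_zero one_ne_zero))
  have hhm : Measurable h := (Lp.stronglyMeasurable (boundary p (T (ofPoly p 1)))).measurable
  set w : ℝ → NNReal := fun θ => ‖h θ‖₊ ^ p with hw
  have hwm : Measurable w := by fun_prop
  set ν : Measure ℝ := circleProb.withDensity fun θ => (w θ : ENNReal) with hν
  have hac : ν ≪ circleProb := withDensity_absolutelyContinuous _ _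
  set R : Polynomial ℂ → ℝ → ℂ := fun f θ => boundary p (T (ofPoly p f)) θ / h θ with hR
  set b : Polynomial ℂ → ℝ → ℂ := fun f θ => f.eval (circ θ) with hb
  have hnorm : ∀ f : Polynomial ℂ, (fun θ => w θ • ‖R f θ‖ ^ p) =ᵐ[circleProb]
      fun θ => ‖boundary p (T (ofPoly p f)) θ‖ ^ p := fun f => by
    filter_upwards [hne] with θ hθ
    rw [NNReal.smul_def, smul_eq_mul, hw, NNReal.coe_rpow, coe_nnnorm,
      ← Real.mul_rpow (norm_nonneg _) (norm_nonneg _), ← norm_mul, hR, mul_div_cancel₀ _ hθ]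
  have hsame : ∀ f, SameIntegral ν circleProb (fun θ => ‖R f θ‖ ^ p) (fun θ => ‖b f θ‖ ^ p) :=
    fun f => by
    refine ⟨?_, ?_, ?_⟩
    · rw [hν, integrable_withDensity_iff_integrable_smul₀ hwm.aemeasurable]
      exact (integrable_norm_rpow_Lp _).congr (hnorm f).symm
    · obtain ⟨C, hC⟩ := exists_norm_eval_circ_le f
      refine integrable_of_continuous_circ ((continuous_norm_eval_circ _).rpow_const
        fun _ => Or.inr hp0.le) (C := C ^ p) fun θ => ?_
      rw [abs_of_nonneg (by positivity)]
      exact Real.rpow_le_rpow (norm_nonneg _) (hC θ) hp0.le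
    · rw [hν, integral_withDensity_eq_integral_smul₀ hwm.aemeasurable, integral_congr_ae (hnorm f),
        integral_norm_boundary_rpow, T.norm_map, hb, integral_norm_eval_rpow]
  have hRlin : IsLinearFamily ν R := by
    refine ⟨fun f => ?_, fun f g c => hac.ae_le ?_, hac.ae_le ?_⟩
    · exact ((Lp.stronglyMeasurable _).measurable.div hhm).aestronglyMeasurable
    · have e : boundary p (T (ofPoly p (f + c • g))) =
          boundary p (T (ofPoly p f)) + c • boundary p (T (ofPoly p g)) := by
        simp only [map_add, map_smul]
      filter_upwards [Lp.coeFn_add (boundary p (T (ofPoly p f)))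
        (c • boundary p (T (ofPoly p g))), Lp.coeFn_smul c (boundary p (T (ofPoly p g)))]
        with θ h1 h2
      simp only [hR]
      rw [e, h1, Pi.add_apply, h2, Pi.smul_apply, smul_eq_mul]
      ring
    · filter_upwards [hne] with θ hθ
      exact div_self hθ
  have hblin : IsLinearFamily circleProb b :=
    ⟨fun f => (f.continuous.comp continuous_circ).aestronglyMeasurable,
      fun f g c => Filter.Eventually.of_forall fun θ => by simp [hb],
      Filter.Eventually.of_forall fun θ => by simp [hb]⟩
  have hone : SameIntegral ν circleProb (fun _ => 1) (fun _ => 1) := by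
    refine (hsame 1).congr ?_ ?_
    · filter_upwards [hRlin.one] with θ hθ
      rw [hθ, norm_one, Real.one_rpow]
    · filter_upwards [hblin.one] with θ hθ
      rw [hθ, norm_one, Real.one_rpow]
  have fν : IsFiniteMeasure ν := (integrable_const_iff_isFiniteMeasure one_ne_zero).mp hone.left
  have hmul := hRlin.mul_ae_eq (by simpa using hone.eq) hblin
    (fun f => (exists_norm_eval_circ_le f).imp fun C hC => Filter.Eventually.of_forall hC)
    (fun f g => Filter.Eventually.of_forall fun θ => Polynomial.eval_mul) hp.out hp2 hsame f g
  rw [hν, ae_withDensity_iff (by fun_prop)] at hmul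
  refine mul_eq_mul_of_boundary MeasurableSet.univ (by simp) ?_ hz
  filter_upwards [hmul, hne] with θ h1 h2 _
  have h3 : (w θ : ENNReal) ≠ 0 := by
    rw [Ne, ENNReal.coe_eq_zero, hw, NNReal.rpow_eq_zero_iff]
    simp [h2]
  have h4 := h1 h3
  simp only [hR] at h4
  have h5 : boundary p (T (ofPoly p 1)) θ = h θ := rfl
  rw [h5]
  field_simp at h4
  linear_combination h4

/-- Continuity of evaluation: an identity of evaluations on polynomials extends. -/
theorem eq_mul_comp_of_poly (T : Hp p →L[ℂ] Hp p) {z w a : ℂ} (hz : z ∈ ball (0 : ℂ) 1)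
    (hw : w ∈ ball (0 : ℂ) 1)
    (h : ∀ P : Polynomial ℂ, T (ofPoly p P) z = a * P.eval w) (f : Hp p) : T f z = a * f w := by
  obtain ⟨P, hP, -⟩ := exists_poly_seq f
  refine tendsto_nhds_unique (tendsto_apply ((T.continuous.tendsto f).comp hP) hz) ?_
  refine ((tendsto_apply hP hw).const_mul a).congr fun n => ?_
  rw [ofPoly_apply _ hw]
  exact (h (P n)).symm

theorem ofPoly_X_pow_norm_le (n : ℕ) : ‖ofPoly p (Polynomial.X ^ n)‖ ≤ 1 := by
  refine norm_le_of_rpow_le zero_le_one ?_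
  rw [Real.one_rpow]
  refine norm_rpow_le _ fun r hr => ?_
  rw [pMean_congr (fun z hz => ofPoly_apply _ hz) hr]
  refine (exists_pMean_le_of_bound (Polynomial.differentiable _).differentiableOn (C := 1)
    (fun z hz => ?_) hr).trans_eq (Real.one_rpow _)
  rw [Polynomial.eval_pow, Polynomial.eval_X, norm_pow]
  exact pow_le_one₀ (norm_nonneg _) (mem_ball_zero_iff.mp hz).le

theorem eventually_ne_zero {F : Hp p} (hF : F ≠ 0) {w : ℂ} (hw : w ∈ ball (0 : ℂ) 1) :
    ∀ᶠ z in nhdsWithin w {w}ᶜ, F z ≠ 0 := by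
  have han : AnalyticOnNhd ℂ F (ball 0 1) := F.differentiableOn.analyticOnNhd isOpen_ball
  rcases (han w hw).eventually_eq_zero_or_eventually_ne_zero with h | h
  · refine absurd (ext fun z hz => ?_) hF
    rw [zero_apply]
    exact han.eqOn_zero_of_preconnected_of_eventuallyEq_zero (convex_ball _ _).isPreconnected hw h hz
  · exact h

open Filter Topology in
/-- Bounds for the images of the monomials under an isometry. -/
theorem norm_isometry_pow_le (hp2 : p ≠ 2) (T : Hp p →ₗᵢ[ℂ] Hp p) (n : ℕ) {z : ℂ}
    (hz : z ∈ ball (0 : ℂ) 1) :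
    ‖T (ofPoly p (Polynomial.X ^ n)) z‖ ≤ ‖T (ofPoly p 1) z‖ := by
  have hT1 : T (ofPoly p 1) ≠ 0 :=
    (map_ne_zero_iff T T.injective).mpr (ofPoly_ne_zero one_ne_zero)
  have key : ∀ z ∈ ball (0 : ℂ) 1, T (ofPoly p 1) z ≠ 0 →
      ‖T (ofPoly p (Polynomial.X ^ n)) z‖ ≤ ‖T (ofPoly p 1) z‖ := by
    intro z hz h0
    set a := T (ofPoly p 1) z with ha
    set u := T (ofPoly p (Polynomial.X ^ n)) z / a with hu
    have hpow : ∀ k : ℕ, T (ofPoly p ((Polynomial.X ^ n) ^ k)) z = a * u ^ k := by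
      intro k
      induction k with
      | zero => simp [ha]
      | succ k ih =>
        have h1 := isometry_one_mul hp2 T ((Polynomial.X ^ n) ^ k) (Polynomial.X ^ n) hz
        rw [← pow_succ, ih, ← ha] at h1
        have hTu : T (ofPoly p (Polynomial.X ^ n)) z = a * u := by rw [hu, mul_div_cancel₀ _ h0]
        refine mul_left_cancel₀ h0 ?_
        rw [h1, hTu]
        ring
    have hz1 := mem_ball_zero_iff.mp hz
    have hbd : ∀ k : ℕ, ‖u‖ ^ k ≤ (4 / (1 - ‖z‖)) ^ (1 / p) / ‖a‖ := fun k => by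
      rw [le_div_iff₀ (norm_pos_iff.mpr h0), ← norm_pow, mul_comm, ← norm_mul, ← hpow k]
      refine (norm_apply_le _ hz1).trans ?_
      rw [T.norm_map, ← pow_mul]
      have h4 : 0 ≤ 4 / (1 - ‖z‖) := div_nonneg (by norm_num) (by linarith)
      exact mul_le_of_le_one_right (by positivity) (ofPoly_X_pow_norm_le _)
    have hu1 : ‖u‖ ≤ 1 := by
      by_contra hlt
      rw [not_le] at hlt
      obtain ⟨k, hk⟩ := pow_unbounded_of_one_lt ((4 / (1 - ‖z‖)) ^ (1 / p) / ‖a‖) hlt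
      exact absurd (hbd k) (not_le.mpr hk)
    rw [hu, norm_div, div_le_one (norm_pos_iff.mpr h0)] at hu1
    exact hu1
  have hc : ∀ F : Hp p, Tendsto F (𝓝[≠] z) (𝓝 (F z)) := fun F =>
    ((F.differentiableOn.continuousOn.continuousAt (isOpen_ball.mem_nhds hz)).tendsto).mono_left
      nhdsWithin_le_nhds
  refine le_of_tendsto_of_tendsto (hc _).norm (hc _).norm ?_
  filter_upwards [eventually_ne_zero hT1 hz, mem_nhdsWithin_of_mem_nhds (isOpen_ball.mem_nhds hz)]
    with w h1 h2
  exact key w h2 h1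

/-- Surjective isometries are weighted composition operators. -/
theorem exists_weighted_comp (hp2 : p ≠ 2) (V : Hp p ≃ₗᵢ[ℂ] Hp p) :
    ∃ Φ : ℂ → ℂ, DifferentiableOn ℂ Φ (ball 0 1) ∧ MapsTo Φ (ball 0 1) (ball 0 1) ∧
      (∀ z ∈ ball (0 : ℂ) 1, V (ofPoly p 1) z ≠ 0) ∧
      ∀ (f : Hp p), ∀ z ∈ ball (0 : ℂ) 1, V f z = V (ofPoly p 1) z * f (Φ z) := by
  set T : Hp p →ₗᵢ[ℂ] Hp p := V.toLinearIsometry with hT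
  set a : Hp p := T (ofPoly p 1) with ha
  have ha0 : ∀ z ∈ ball (0 : ℂ) 1, a z ≠ 0 := by
    intro z hz h0
    have hmon : ∀ n, T (ofPoly p (Polynomial.X ^ n)) z = 0 := fun n => by
      have := norm_isometry_pow_le hp2 T n hz
      rw [← ha, h0, norm_zero] at this
      exact norm_le_zero_iff.mp this
    have hpoly : ∀ P : Polynomial ℂ, T (ofPoly p P) z = 0 * P.eval z := fun P => by
      rw [zero_mul]
      induction P using Polynomial.induction_on' with
      | add P Q h1 h2 => rw [map_add, map_add, add_apply, h1, h2, add_zero]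
      | monomial n c =>
        rw [← Polynomial.C_mul_X_pow_eq_monomial, ← Polynomial.smul_eq_C_mul, map_smul, map_smul,
          smul_apply, hmon, mul_zero]
    have h1 := eq_mul_comp_of_poly T.toContinuousLinearMap hz hz hpoly (V.symm (ofPoly p 1))
    have h2 : T.toContinuousLinearMap (V.symm (ofPoly p 1)) = ofPoly p 1 := V.apply_symm_apply _
    rw [h2, ofPoly_apply _ hz, Polynomial.eval_one, zero_mul] at h1
    exact one_ne_zero h1
  set Φ : ℂ → ℂ := fun z => T (ofPoly p Polynomial.X) z / a z with hΦ
  have hd : DifferentiableOn ℂ Φ (ball 0 1) :=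
    (T (ofPoly p Polynomial.X)).differentiableOn.div a.differentiableOn ha0
  have hpow : ∀ z ∈ ball (0 : ℂ) 1, ∀ n, T (ofPoly p (Polynomial.X ^ n)) z = a z * Φ z ^ n := by
    intro z hz n
    induction n with
    | zero => simp [ha]
    | succ n ih =>
      have h1 := isometry_one_mul hp2 T (Polynomial.X ^ n) Polynomial.X hz
      rw [← pow_succ, ih, ← ha] at h1
      have hTu : T (ofPoly p Polynomial.X) z = a z * Φ z := (mul_div_cancel₀ _ (ha0 z hz)).symm
      refine mul_left_cancel₀ (ha0 z hz) ?_
      rw [h1, hTu]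
      ring
  have hpoly : ∀ z ∈ ball (0 : ℂ) 1, ∀ P : Polynomial ℂ,
      T (ofPoly p P) z = a z * P.eval (Φ z) := by
    intro z hz P
    induction P using Polynomial.induction_on' with
    | add P Q h1 h2 => rw [map_add, map_add, add_apply, h1, h2, Polynomial.eval_add, mul_add]
    | monomial n c =>
      rw [← Polynomial.C_mul_X_pow_eq_monomial, ← Polynomial.smul_eq_C_mul, map_smul, map_smul,
        smul_apply, hpow z hz, Polynomial.eval_smul, Polynomial.eval_pow, Polynomial.eval_X,
        smul_eq_mul]
      ring
  have hle : ∀ z ∈ ball (0 : ℂ) 1, ‖Φ z‖ ≤ 1 := fun z hz => by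
    have h1 := norm_isometry_pow_le hp2 T 1 hz
    rw [pow_one] at h1
    rw [hΦ, norm_div, div_le_one (norm_pos_iff.mpr (ha0 z hz))]
    exact h1
  have hmaps : MapsTo Φ (ball 0 1) (ball 0 1) := by
    intro z hz
    rw [mem_ball_zero_iff]
    refine lt_of_le_of_ne (hle z hz) fun h1 => ?_
    have hconst : EqOn Φ (Function.const ℂ (Φ z)) (ball 0 1) :=
      Complex.eqOn_of_isPreconnected_of_isMaxOn_norm (convex_ball _ _).isPreconnected isOpen_ball
        hd hz fun w hw => by
          simp only [Function.comp_apply, mem_ofPred_eq]; rw [h1]; exact hle w hw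
    have h2 : T (ofPoly p (Polynomial.X - Polynomial.C (Φ z))) = 0 := ext fun w hw => by
      rw [hpoly w hw, hconst hw, zero_apply]; simp
    exact (map_ne_zero_iff T T.injective).mpr (ofPoly_ne_zero (Polynomial.X_sub_C_ne_zero _)) h2
  exact ⟨Φ, hd, hmaps, ha0, fun f z hz =>
    eq_mul_comp_of_poly T.toContinuousLinearMap hz (hmaps hz) (hpoly z hz) f⟩

end Hp

/-- Biholomorphic self-maps of the disc are the Möbius automorphisms. -/
theorem exists_discAut_of_inverse {Φ Φ' : ℂ → ℂ} (hd : DifferentiableOn ℂ Φ (ball 0 1))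
    (hm : MapsTo Φ (ball 0 1) (ball 0 1)) (hd' : DifferentiableOn ℂ Φ' (ball 0 1))
    (hm' : MapsTo Φ' (ball 0 1) (ball 0 1)) (h : ∀ z ∈ ball (0 : ℂ) 1, Φ (Φ' z) = z)
    (h' : ∀ z ∈ ball (0 : ℂ) 1, Φ' (Φ z) = z) :
    ∃ η : DiscAut, ∀ z ∈ ball (0 : ℂ) 1, Φ z = η z := by
  have h00 : (0 : ℂ) ∈ ball (0 : ℂ) 1 := mem_ball_self one_pos
  have hz₀ := mem_ball_zero_iff.mp (hm' h00)
  set z₀ := Φ' 0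
  set β : DiscAut := ⟨1, z₀, by simp, hz₀⟩ with hβ
  have hβ0 : β z₀ = 0 := by simp [DiscAut.apply_def, hβ]
  have hβi : β.inv 0 = z₀ := by rw [← hβ0, β.inv_apply_apply hz₀]
  set G : ℂ → ℂ := fun w => Φ (β.inv w) with hG
  have hGd : DifferentiableOn ℂ G (ball 0 1) := hd.comp β.inv.differentiableOn β.inv.mapsTo
  have hGm : MapsTo G (ball 0 1) (ball 0 1) := hm.comp β.inv.mapsTo
  have hG0 : G 0 = 0 := by rw [hG]; simp only [hβi]; exact h 0 h00
  set H : ℂ → ℂ := fun w => β (Φ' w) with hH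
  have hHd : DifferentiableOn ℂ H (ball 0 1) := β.differentiableOn.comp hd' hm'
  have hHm : MapsTo H (ball 0 1) (ball 0 1) := β.mapsTo.comp hm'
  have hHG : ∀ w ∈ ball (0 : ℂ) 1, H (G w) = w := fun w hw => by
    simp only [hH, hG]
    rw [h' _ (β.inv.mapsTo hw), β.apply_inv_apply (mem_ball_zero_iff.mp hw)]
  have hw : (1 / 2 : ℂ) ∈ ball (0 : ℂ) 1 := by rw [mem_ball_zero_iff]; norm_num
  have h1 : ‖G (1 / 2)‖ ≤ ‖(1 / 2 : ℂ)‖ := Complex.norm_le_norm_of_mapsTo_ball hGd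
    (hGm.mono_right ball_subset_closedBall) hG0 (mem_ball_zero_iff.mp hw)
  have h2 : ‖H (G (1 / 2))‖ ≤ ‖G (1 / 2)‖ := Complex.norm_le_norm_of_mapsTo_ball hHd
    (hHm.mono_right ball_subset_closedBall) hβ0 (mem_ball_zero_iff.mp (hGm hw))
  rw [hHG _ hw] at h2
  have h3 : ‖dslope G 0 (1 / 2)‖ = 1 / 1 := by
    rw [dslope_of_ne _ (by norm_num), slope_def_field, hG0, sub_zero, sub_zero, norm_div,
      le_antisymm h1 h2]
    norm_num
  obtain ⟨c, hc, heq⟩ := Complex.affine_of_mapsTo_ball_of_exists_norm_dslope_eq_div' hGd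
    (by rw [hG0]; exact hGm.mono_right ball_subset_closedBall) ⟨_, hw, h3⟩
  refine ⟨⟨c, z₀, by simpa using hc, hz₀⟩, fun z hz => ?_⟩
  have h4 := heq (β.mapsTo hz)
  have h5 : G (β z) = Φ z := by
    simp only [hG]; rw [β.inv_apply_apply (mem_ball_zero_iff.mp hz)]
  have h6 : G (β.toFun z) = G (β z) := rfl
  rw [h6, h5, hG0] at h4
  rw [h4, DiscAut.apply_def]
  show 0 + (1 * (z - z₀) / (1 - conj z₀ * z) - 0) * c = c * (z - z₀) / (1 - conj z₀ * z)
  ring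

namespace Hp

variable {p : ℝ} [hp : Fact (1 ≤ p)]

theorem norm_le_one_of_mul {W : Hp p →ₗᵢ[ℂ] Hp p} {K : ℂ} {z : ℂ} (hz : z ∈ ball (0 : ℂ) 1)
    (h : ∀ f : Hp p, W f z = K * f z) : ‖K‖ ≤ 1 := by
  by_contra hlt
  rw [not_le] at hlt
  have hz1 := mem_ball_zero_iff.mp hz
  have hpow : ∀ n : ℕ, ‖(W^[n] (ofPoly p 1) : Hp p)‖ = ‖ofPoly p 1‖ ∧
      (W^[n] (ofPoly p 1) : Hp p) z = K ^ n := by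
    intro n
    induction n with
    | zero => simp [ofPoly_apply _ hz]
    | succ n ih =>
      rw [Function.iterate_succ_apply', W.norm_map, h, ih.2]
      exact ⟨ih.1, (pow_succ' _ _).symm⟩
  obtain ⟨n, hn⟩ := pow_unbounded_of_one_lt ((4 / (1 - ‖z‖)) ^ (1 / p) * ‖ofPoly p 1‖) hlt
  have h1 := norm_apply_le (W^[n] (ofPoly p 1)) hz1
  rw [(hpow n).1, (hpow n).2, norm_pow] at h1
  linarith

/-- Forelli's theorem: the isometries of the Hardy space onto itself, `p ≠ 2`. -/
theorem exists_eq_smul_U (hp2 : p ≠ 2) (V : Hp p ≃ₗᵢ[ℂ] Hp p) :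
    ∃ (η : DiscAut) (c : ℂ), ‖c‖ = 1 ∧ ∀ f, V f = c • U p η f := by
  obtain ⟨Φ, hd, hm, ha, hV⟩ := exists_weighted_comp hp2 V
  obtain ⟨Φ', hd', hm', ha', hV'⟩ := exists_weighted_comp hp2 V.symm
  have inv : ∀ {V : Hp p ≃ₗᵢ[ℂ] Hp p} {Φ Φ' : ℂ → ℂ}, MapsTo Φ (ball 0 1) (ball 0 1) →
      MapsTo Φ' (ball 0 1) (ball 0 1) →
      (∀ (f : Hp p), ∀ z ∈ ball (0 : ℂ) 1, V f z = V (ofPoly p 1) z * f (Φ z)) →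
      (∀ (f : Hp p), ∀ z ∈ ball (0 : ℂ) 1, V.symm f z = V.symm (ofPoly p 1) z * f (Φ' z)) →
      ∀ z ∈ ball (0 : ℂ) 1, Φ' (Φ z) = z := by
    intro V Φ Φ' hm hm' hV hV' z hz
    have e : ∀ P : Polynomial ℂ, V (ofPoly p 1) z * (V.symm (ofPoly p 1) (Φ z) *
        P.eval (Φ' (Φ z))) = P.eval z := fun P => by
      have h1 := hV (V.symm (ofPoly p P)) z hz
      rw [V.apply_symm_apply, hV' _ _ (hm hz), ofPoly_apply _ hz,
        ofPoly_apply _ (hm' (hm hz))] at h1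
      exact h1.symm
    have e1 := e 1
    have e2 := e Polynomial.X
    rw [Polynomial.eval_one, Polynomial.eval_one, mul_one] at e1
    rw [Polynomial.eval_X, Polynomial.eval_X, ← mul_assoc, e1, one_mul] at e2
    exact e2
  obtain ⟨η, hη⟩ := exists_discAut_of_inverse hd hm hd' hm'
    (inv (V := V.symm) hm' hm hV' (by simpa using hV)) (inv hm hm' hV hV')
  set K : ℂ → ℂ := fun z => V (ofPoly p 1) z / (weight p η).toFun z with hK
  have hwne : ∀ z ∈ ball (0 : ℂ) 1, (weight p η).toFun z ≠ 0 := fun z hz =>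
    weight_ne_zero η (mem_ball_zero_iff.mp hz)
  have hKd : DifferentiableOn ℂ K (ball 0 1) :=
    (V (ofPoly p 1)).differentiableOn.div (weight p η).differentiableOn hwne
  have hVU : ∀ f, ∀ z ∈ ball (0 : ℂ) 1, V f z = K z * U p η f z := fun f z hz => by
    rw [hV f z hz, U_apply' _ _ hz, hη z hz, hK]
    have := hwne z hz
    field_simp
  have hKne : ∀ z ∈ ball (0 : ℂ) 1, K z ≠ 0 := fun z hz => div_ne_zero (ha z hz) (hwne z hz)
  have hKnorm : ∀ z ∈ ball (0 : ℂ) 1, ‖K z‖ = 1 := by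
    intro z hz
    refine le_antisymm ?_ ?_
    · refine norm_le_one_of_mul (W := ((UEquiv η).symm.trans V).toLinearIsometry) hz fun f => ?_
      show V (U p η.inv f) z = _
      rw [hVU _ z hz, U_U_inv_apply]
    · have h1 : ‖(K z)⁻¹‖ ≤ 1 := by
        refine norm_le_one_of_mul (W := (V.symm.trans (UEquiv η)).toLinearIsometry) hz fun f => ?_
        show U p η (V.symm f) z = _
        have h2 := hVU (V.symm f) z hz
        rw [V.apply_symm_apply] at h2
        rw [h2, inv_mul_cancel_left₀ (hKne z hz)]
      rw [norm_inv] at h1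
      exact (inv_le_one₀ (norm_pos_iff.mpr (hKne z hz))).mp h1
  refine ⟨η, K 0, hKnorm 0 (mem_ball_self one_pos), fun f => ext fun z hz => ?_⟩
  rw [hVU f z hz, smul_apply, eq_const_of_norm_eq_one hKd hKnorm z hz]

end Hp

theorem mainTheorem9 (p : ℝ) [Fact (1 ≤ p)] (hp2 : p ≠ 2) :
    ∃ ρ : DiscAut → DiscAut → ℂ,
      (∀ φ η : DiscAut, ‖ρ φ η‖ = 1 ∧
        Hp.U p η ∘L Hp.U p φ ∘L Hp.U p η.inv =
          ρ φ η • Hp.U p (η.inv.comp (φ.comp η))) ∧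
      ∀ d : ℕ, 1 ≤ d → ∀ Ψ : HInf, Ψ.IsBlaschke d → ∀ φ : DiscAut, ∀ S : Hp p →L[ℂ] Hp p,
        S = Hp.mulOp Ψ ∘L Hp.U p φ →
          (∀ S' : Hp p →L[ℂ] Hp p, IsometricallyEquivalent S' S ↔
            ∃ η : DiscAut,
              S' = ρ φ η • (Hp.mulOp (Ψ.comp η) ∘L Hp.U p (η.inv.comp (φ.comp η)))) ∧
          ((⋂ n : ℕ, Set.range (S ^ n)) = {0} ↔ φ = DiscAut.id ∨ φ.IsElliptic) := by
  choose ρ hρ using fun φ η : DiscAut => Hp.exists_rho (p := p) φ η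
  refine ⟨ρ, hρ, fun d hd Ψ hΨ φ S hS => ?_⟩
  subst hS
  refine ⟨fun S' => ?_, Hp.iInter_range_pow_eq_iff hd hΨ φ⟩
  have conj_eq : ∀ η : DiscAut, Hp.U p η ∘L (Hp.mulOp Ψ ∘L Hp.U p φ) ∘L Hp.U p η.inv =
      ρ φ η • (Hp.mulOp (Ψ.comp η) ∘L Hp.U p (η.inv.comp (φ.comp η))) := fun η => by
    rw [ContinuousLinearMap.comp_assoc, ← ContinuousLinearMap.comp_assoc (Hp.U p η),
      Hp.U_comp_mulOp, ContinuousLinearMap.comp_assoc, (hρ φ η).2,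
      ContinuousLinearMap.comp_smul]
  constructor
  · rintro ⟨V, hV⟩
    obtain ⟨η, c, hc, hVc⟩ := Hp.exists_eq_smul_U hp2 V
    have hc0 : c ≠ 0 := norm_ne_zero_iff.mp (hc ▸ one_ne_zero)
    have hsymm : ∀ f, V.symm f = c⁻¹ • Hp.U p η.inv f := fun f => by
      rw [V.symm_apply_eq, hVc, map_smul, Hp.U_U_inv_apply, smul_inv_smul₀ hc0]
    refine ⟨η, ?_⟩
    rw [← conj_eq η]
    refine ContinuousLinearMap.ext fun f => ?_
    rw [hV, hVc, hsymm, map_smul, map_smul, smul_inv_smul₀ hc0]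
    rfl
  · rintro ⟨η, rfl⟩
    refine ⟨Hp.UEquiv η, fun f => ?_⟩
    rw [← conj_eq η]
    rfl
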